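/- **Setting.** Let $X$ be a compact geodesic metric space (any two points $x,y$ are joined by a path of length $d(x,y)$, called a geodesic), let $\bullet\in X$ be a basepoint and let $r>0$. For $s>0$ let $\mathrm{Rips}(X,s)$, respectively $\overline{\mathrm{Rips}}(X,s)$, be the simplicial complex on the vertex set $X$ whose simplices are the nonempty finite subsets of diameter $<s$, respectively $\le s$. A number $q>0$ is a *critical value* (of the $\pi_1$-persistence via open Rips complexes) if either for all small enough $\varepsilon>0$ the inclusion-induced map $\pi_1(\mathrm{Rips}(X,q-\varepsilon),\bullet)\to\pi_1(\mathrm{Rips}(X,q),\bullet)$ is not an isomorphism, or for all $\varepsilon>0$ the map $\pi_1(\mathrm{Rips}(X,q),\bullet)\to\pi_1(\mathrm{Rips}(X,q+\varepsilon),\bullet)$ is not an isomorphism. For a loop $\alpha$ in $X$, an *$\alpha$-lasso* is a based loop $\gamma*\alpha*\gamma^-$, where $\gamma$ is a path from $\bullet$ to some point of $\alpha$ and $\alpha$ is traversed starting from that point. $\mathcal L(X,l,\pi_1)\le\pi_1(X,\bullet)$ is the subgroup generated by all $\beta$-lassos with $\beta$ a loop of length less than $l$. A *filling* of $x_1,x_2,x_3,x_1$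 is a loop obtained by joining consecutive points by geodesics. An *$s$-sample* of a loop $\alpha\colon[0,a]\to X$ is a choice of $0\le t_0<\dots<t_m\le a$ with $\mathrm{Diam}\,\alpha([t_i,t_{i+1}])<s$ for $0\le i<m$ and $\mathrm{Diam}\,\alpha([0,t_0]\cup[t_m,a])<s$; it induces the simplicial loop $\alpha(t_0),\dots,\alpha(t_m),\alpha(t_0)$ in $\mathrm{Rips}(X,s)$. For based loops one takes $t_0=0$. A triangle $\sigma\in\overline{\mathrm{Rips}}(X,r)$ with vertices $x_1,x_2,x_3$ is *critical* if, for some filling of $x_1,x_2,x_3,x_1$ and some $(r/2)$-sample of it, attaching a disc to $\mathrm{Rips}(X,r)$ along that sample induces a map on $\pi_1(\,\cdot\,,\bullet)$ with nontrivial kernel. A *geodesic circle* is an isometrically embedded circle of positive circumference, with the arc-length metric (as a loop: traversed once, up to monotone reparameterization). **Theorem (Intrinsic Localization).** 1. If $\sigma\in\overline{\mathrm{Rips}}(X,r)$ is a critical triangle with vertices $x_1,x_2,x_3$, then $d(x_1,x_2)=d(x_2,x_3)=d(x_3,x_1)=r$, and for every filling $\alpha_\sigma$ of $x_1,x_2,x_3,x_1$,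 the length of $\alpha_\sigma$ is $3r$ and the class of no $\alpha_\sigma$-lasso is contained in $\mathcal L(X,3r,\pi_1)$. 2. If $r<r'$ are consecutive critical values, then the kernel of $\pi_1(\mathrm{Rips}(X,r),\bullet)\to\pi_1(\mathrm{Rips}(X,r'),\bullet)$ is generated by the classes of $r$-samples of all $\alpha'$-lassos, where $\alpha'$ ranges over all fillings of the vertices of all critical triangles in $\overline{\mathrm{Rips}}(X,r)$. 3. Conversely, let $\alpha$ be a loop in $X$ of length $3r$. Then some $\alpha$-lasso is not contained in $\mathcal L(X,3r,\pi_1)$ if and only if each $\alpha$-lasso is not contained in $\mathcal L(X,3r,\pi_1)$. If this is the case, then $\alpha$ is a geodesic circle, $r$ is a critical value, and any three distinct points on $\alpha$ with equal pairwise distances are the vertices of a critical triangle in $\overline{\mathrm{Rips}}(X,r)$. -/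

import Mathlib

open Set Topology unitInterval
open scoped ENNReal

noncomputable section

namespace RipsLoc

/-! ### Geometric realization of an abstract simplicial complex -/

section Realization

variable {V : Type*}

/-- The points of the geometric realization `|K|`: barycentric coordinates supported on a face. -/
def Realization (K : AbstractSimplicialComplex V) : Type _ :=
  {f : V → ℝ // ∃ s ∈ K.faces, (∀ v, 0 ≤ f v) ∧ (∀ v, v ∉ s → f v = 0) ∧ ∑ v ∈ s, f v = 1}

/-- The closed simplex of `|K|` spanned by a finite set `s` of vertices. -/
def ClosedSimplex (K : AbstractSimplicialComplex V) (s : Finset V) : Type _ :=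
  {f : Realization K // ∀ v, v ∉ s → f.1 v = 0}

/-- The inclusion of a closed simplex into `|K|`. -/
def ClosedSimplex.val {K : AbstractSimplicialComplex V} {s : Finset V}
    (f : ClosedSimplex K s) : Realization K := f.1

/-- The Euclidean topology (by barycentric coordinates) of a closed simplex. -/
instance (K : AbstractSimplicialComplex V) (s : Finset V) :
    TopologicalSpace (ClosedSimplex K s) :=
  TopologicalSpace.induced (fun f => f.val.1) (inferInstanceAs (TopologicalSpace (V → ℝ)))

/-- The weak (coherent) topology on `|K|`: a set is open iff its intersection with each closed
simplex is open there. -/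
instance (K : AbstractSimplicialComplex V) : TopologicalSpace (Realization K) :=
  ⨆ s : K.faces, TopologicalSpace.coinduced
    (ClosedSimplex.val : ClosedSimplex K s.1 → Realization K) inferInstance

theorem continuous_closedSimplex_val (K : AbstractSimplicialComplex V) {s : Finset V}
    (hs : s ∈ K.faces) :
    Continuous (ClosedSimplex.val : ClosedSimplex K s → Realization K) := by
  rw [continuous_iff_coinduced_le]
  exact le_iSup (fun s : K.faces => TopologicalSpace.coinduced
    (ClosedSimplex.val : ClosedSimplex K s.1 → Realization K) inferInstance) ⟨s, hs⟩

open Classical in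
/-- The vertex `v`, as a point of `|K|`. -/
def Realization.vertex (K : AbstractSimplicialComplex V) (v : V) : Realization K :=
  ⟨Pi.single v 1, {v}, K.singleton_mem v,
    fun w => by by_cases h : w = v <;> simp [h],
    fun w hw => by simp at hw; simp [hw], by simp⟩

/-- The continuous map `|K| → |L|` induced by the inclusion of a subcomplex `K ⊆ L`. -/
def Realization.incl {K L : AbstractSimplicialComplex V} (h : K.faces ⊆ L.faces) :
    C(Realization K, Realization L) where
  toFun f := ⟨f.1, by obtain ⟨s, hs, hf⟩ := f.2; exact ⟨s, h hs, hf⟩⟩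
  continuous_toFun := by
    refine continuous_iSup_dom.2 fun s => continuous_coinduced_dom.2 ?_
    let g : ClosedSimplex K s.1 → ClosedSimplex L s.1 := fun f =>
      ⟨⟨f.1.1, by obtain ⟨s, hs, hf⟩ := f.1.2; exact ⟨s, h hs, hf⟩⟩, f.2⟩
    have hg : Continuous g := continuous_induced_rng.2 continuous_induced_dom
    exact (continuous_closedSimplex_val L (h s.2)).comp hg

theorem Realization.incl_vertex {K L : AbstractSimplicialComplex V} (h : K.faces ⊆ L.faces)
    (v : V) : Realization.incl h (Realization.vertex K v) = Realization.vertex L v := rfl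

open Classical in
/-- The point `(1 - t) x + t y` of the edge (or vertex) `{x, y}`. -/
def edgePoint (K : AbstractSimplicialComplex V) {x y : V} (h : {x, y} ∈ K.faces) (t : I) :
    Realization K :=
  ⟨fun v => (1 - (t : ℝ)) * (Pi.single x 1 : V → ℝ) v + t * (Pi.single y 1 : V → ℝ) v,
    {x, y}, h, by
      intro v
      have h0 := t.2.1
      have h1 : 0 ≤ 1 - (t : ℝ) := sub_nonneg.2 t.2.2
      by_cases hx : v = x <;> by_cases hy : v = y <;> simp [Pi.single_apply, hx, hy] <;>
        (try split_ifs) <;> linarith,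
    by
      intro v hv
      simp only [Finset.mem_insert, Finset.mem_singleton, not_or] at hv
      simp [hv.1, hv.2],
    by
      rw [Finset.sum_add_distrib, ← Finset.mul_sum, ← Finset.mul_sum]
      simp [Pi.single_apply, Finset.sum_ite_eq']⟩

open Classical in
/-- The edge from the vertex `x` to the vertex `y`, traversed linearly (constant if `x = y`). -/
def edgePath (K : AbstractSimplicialComplex V) {x y : V} (h : {x, y} ∈ K.faces) :
    Path (Realization.vertex K x) (Realization.vertex K y) where
  toFun := edgePoint K h
  continuous_toFun := by
    let g : I → ClosedSimplex K {x, y} := fun t => ⟨edgePoint K h t, by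
      intro v hv
      simp only [Finset.mem_insert, Finset.mem_singleton, not_or] at hv
      simp [edgePoint, hv.1, hv.2]⟩
    have hg : Continuous g := by
      refine continuous_induced_rng.2 (continuous_pi fun v => ?_)
      change Continuous fun t : I =>
        (1 - (t : ℝ)) * (Pi.single x 1 : V → ℝ) v + t * (Pi.single y 1 : V → ℝ) v
      fun_prop
    exact (continuous_closedSimplex_val K h).comp hg
  source' := by apply Subtype.ext; funext v; simp [edgePoint, Realization.vertex]
  target' := by apply Subtype.ext; funext v; simp [edgePoint, Realization.vertex]

open Classical in
/-- The polygonal path in `|K|` through the vertices `x 0, x 1, …, x n`. -/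
def edgeWalk (K : AbstractSimplicialComplex V) (x : ℕ → V) :
    (n : ℕ) → (∀ i < n, {x i, x (i + 1)} ∈ K.faces) →
      Path (Realization.vertex K (x 0)) (Realization.vertex K (x n))
  | 0, _ => Path.refl _
  | n + 1, h => (edgeWalk K x n fun i hi => h i (Nat.lt_succ_of_lt hi)).trans
      (edgePath K (h n (Nat.lt_succ_self n)))

end Realization

/-! ### Attaching a disc along a loop -/

section AttachDisc

variable {Y : Type*} [TopologicalSpace Y] {y : Y}

/-- The boundary point `exp (2πit)` of the closed unit disc. -/
def discBoundary (t : I) : Metric.closedBall (0 : ℂ) 1 :=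
  ⟨Complex.exp ((2 * Real.pi * (t : ℝ) : ℝ) * Complex.I), by
    rw [mem_closedBall_zero_iff, Complex.norm_exp_ofReal_mul_I]⟩

/-- The gluing relation `exp (2πit) ∼ ℓ t` on the disjoint union of `Y` and the disc. -/
inductive DiscGlue (ℓ : Path y y) :
    Y ⊕ Metric.closedBall (0 : ℂ) 1 → Y ⊕ Metric.closedBall (0 : ℂ) 1 → Prop
  | glue (t : I) : DiscGlue ℓ (Sum.inr (discBoundary t)) (Sum.inl (ℓ t))

/-- The adjunction space `Y ∪_ℓ D²`, with the quotient topology. -/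
def AttachDisc (ℓ : Path y y) : Type _ := Quot (DiscGlue ℓ)

instance (ℓ : Path y y) : TopologicalSpace (AttachDisc ℓ) :=
  inferInstanceAs (TopologicalSpace (Quot (DiscGlue ℓ)))

/-- The inclusion `Y → Y ∪_ℓ D²`. -/
def AttachDisc.incl (ℓ : Path y y) : C(Y, AttachDisc ℓ) where
  toFun z := Quot.mk _ (Sum.inl z)
  continuous_toFun := continuous_quot_mk.comp continuous_inl

end AttachDisc

/-! ### Length, geodesics, lassos -/

section Lasso

variable {X : Type*} [MetricSpace X]

/-- The length of a path (possibly `∞`). -/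
def pathLength {x y : X} (γ : Path x y) : ℝ≥0∞ := eVariationOn γ univ

/-- A geodesic from `x` to `y` is a path of length `d(x, y)`. -/
def IsGeodesic {x y : X} (γ : Path x y) : Prop := pathLength γ = ENNReal.ofReal (dist x y)

variable (X) in
/-- Any two points are joined by a geodesic. -/
def IsGeodesicSpace : Prop := ∀ x y : X, ∃ γ : Path x y, IsGeodesic γ

/-- The loop `α` is a geodesic circle: up to a monotone reparameterization it runs once around an
isometrically embedded circle of positive circumference `l`. (The metric of `AddCircle l = ℝ / lℤ`
is the arc length metric.) -/
def IsGeodesicCircle {y : X} (α : Path y y) : Prop :=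
  ∃ l : ℝ, 0 < l ∧ ∃ c : AddCircle l → X, Isometry c ∧
    ∃ φ : I → ℝ, Continuous φ ∧ Monotone φ ∧ φ 0 = 0 ∧ φ 1 = l ∧
      ∀ t, α t = c (φ t : AddCircle l)

/-- The lasso `γ * β * γ⁻`. -/
def lasso {p y : X} (γ : Path p y) (β : Path y y) : Path p p := (γ.trans β).trans γ.symm

/-- The loop `α`, started at the point `α s`. -/
def rotateLoop {y : X} (α : Path y y) (s : I) : Path (α s) (α s) :=
  ((α.subpath s 1).cast rfl α.target.symm).trans ((α.subpath 0 s).cast α.source.symm rfl)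

/-- The class in `π₁(X, p)` of a based loop. -/
def loopClass {Y : Type*} [TopologicalSpace Y] {p : Y} (α : Path p p) : FundamentalGroup Y p :=
  FundamentalGroup.fromPath (Path.Homotopic.Quotient.mk α)

/-- `ℒ(X, l, π₁)`: the subgroup of `π₁(X, p)` generated by all lassos whose loop has length
less than `l`. -/
def lassoSubgroup (p : X) (l : ℝ) : Subgroup (FundamentalGroup X p) :=
  Subgroup.closure {g | ∃ (y : X) (γ : Path p y) (β : Path y y),
    pathLength β < ENNReal.ofReal l ∧ g = loopClass (lasso γ β)}

/-- A filling of `x₁, x₂, x₃, x₁`: consecutive points are joined by geodesics. -/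
def IsFilling {x₁ : X} (x₂ x₃ : X) (α : Path x₁ x₁) : Prop :=
  ∃ (g₁ : Path x₁ x₂) (g₂ : Path x₂ x₃) (g₃ : Path x₃ x₁),
    IsGeodesic g₁ ∧ IsGeodesic g₂ ∧ IsGeodesic g₃ ∧ α = (g₁.trans g₂).trans g₃

end Lasso

/-! ### Rips complexes and their persistence -/

section Rips

variable (X : Type*) [MetricSpace X]

/-- The open Rips complex `Rips(X, r)`: finite sets of diameter `< r`. -/
def rips (r : ℝ) (hr : 0 < r) : AbstractSimplicialComplex X where
  faces := {s | s.Nonempty ∧ Metric.diam (s : Set X) < r}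
  isRelLowerSet_faces := fun s hs => ⟨hs.1, fun _ hτ hne =>
    ⟨hne, (Metric.diam_mono (by exact_mod_cast hτ)
      s.finite_toSet.isBounded).trans_lt hs.2⟩⟩
  singleton_mem := fun v => ⟨Finset.singleton_nonempty v, by simpa using hr⟩

/-- The closed Rips complex: finite sets of diameter `≤ r`. -/
def closedRips (r : ℝ) (hr : 0 < r) : AbstractSimplicialComplex X where
  faces := {s | s.Nonempty ∧ Metric.diam (s : Set X) ≤ r}
  isRelLowerSet_faces := fun s hs => ⟨hs.1, fun _ hτ hne =>
    ⟨hne, (Metric.diam_mono (by exact_mod_cast hτ)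
      s.finite_toSet.isBounded).trans hs.2⟩⟩
  singleton_mem := fun v => ⟨Finset.singleton_nonempty v, by simpa using hr.le⟩

theorem rips_mono {a b : ℝ} (ha : 0 < a) (hab : a ≤ b) :
    (rips X a ha).faces ⊆ (rips X b (ha.trans_le hab)).faces :=
  fun _ hs => ⟨hs.1, hs.2.trans_le hab⟩

variable {X}

/-- `π₁(Rips(X, r), p)`. -/
abbrev RipsGroup (p : X) (r : ℝ) (hr : 0 < r) : Type _ :=
  FundamentalGroup (Realization (rips X r hr)) (Realization.vertex (rips X r hr) p)

/-- The bonding map `π₁(Rips(X, a), p) → π₁(Rips(X, b), p)`, for `0 < a ≤ b`. -/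
def bonding (p : X) {a b : ℝ} (ha : 0 < a) (hab : a ≤ b) :
    RipsGroup p a ha →* RipsGroup p b (ha.trans_le hab) :=
  FundamentalGroup.mapOfEq (Realization.incl (rips_mono X ha hab))
    (Realization.incl_vertex (rips_mono X ha hab) p)

/-- `q > 0` is a left critical value: for all small enough `ε > 0` the bonding map from `q - ε`
to `q` is not an isomorphism. -/
def IsLeftCritical (p : X) (q : ℝ) : Prop :=
  0 < q ∧ ∃ δ > 0, ∀ ε, 0 < ε → ε < δ → ∀ h : 0 < q - ε,
    ∀ h' : q - ε ≤ q, ¬ Function.Bijective (bonding p h h')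

/-- `q > 0` is a right critical value: for all `ε > 0` the bonding map from `q` to `q + ε`
is not an isomorphism. -/
def IsRightCritical (p : X) (q : ℝ) : Prop :=
  ∃ hq : 0 < q, ∀ ε, 0 < ε → ∀ h' : q ≤ q + ε, ¬ Function.Bijective (bonding p hq h')

/-- Critical values of the `π₁`-persistence of `(X, p)` via the open Rips filtration. -/
def IsCriticalValue (p : X) (q : ℝ) : Prop := IsLeftCritical p q ∨ IsRightCritical p q

/-- `a < b` are consecutive critical values. -/
def AreConsecutiveCritical (p : X) (a b : ℝ) : Prop :=
  IsCriticalValue p a ∧ IsCriticalValue p b ∧ a < b ∧ ∀ q, a < q → q < b → ¬ IsCriticalValue p q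

/-- A `δ`-sample `t 0 < t 1 < ⋯ < t m` of the loop `α` (values `t i` with `i > m` play no role). -/
structure LoopSample {y : X} (α : Path y y) (δ : ℝ) where
  m : ℕ
  t : ℕ → I
  lt_succ : ∀ i < m, t i < t (i + 1)
  diam_lt : ∀ i < m, Metric.diam (α '' Icc (t i) (t (i + 1))) < δ
  diam_wrap : Metric.diam (α '' (Icc 0 (t 0) ∪ Icc (t m) 1)) < δ

theorem pair_mem_rips {y : X} (α : Path y y) {δ r : ℝ} (hr : 0 < r) (hδ : δ ≤ r) {S : Set I}
    (hS : Metric.diam (α '' S) < δ) {a b : I} (ha : a ∈ S) (hb : b ∈ S) [DecidableEq X] :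
    ({α a, α b} : Finset X) ∈ (rips X r hr).faces := by
  refine ⟨Finset.insert_nonempty _ _, ?_⟩
  have hbd : Bornology.IsBounded (α '' S) :=
    (isCompact_range α.continuous).isBounded.subset (image_subset_range _ _)
  have hd := Metric.dist_le_diam_of_mem hbd (mem_image_of_mem α ha) (mem_image_of_mem α hb)
  rw [Finset.coe_pair, Metric.diam_pair]
  exact hd.trans_lt (hS.trans_le hδ)

open Classical in
/-- The closed polygonal loop `α (t 0), α (t 1), …, α (t m), α (t 0)` in `Rips(X, r)` given by a
`δ`-sample of `α`, where `δ ≤ r`. -/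
def LoopSample.ripsLoop {y : X} {α : Path y y} {δ r : ℝ} (S : LoopSample α δ) (hr : 0 < r)
    (hδ : δ ≤ r) :
    Path (Realization.vertex (rips X r hr) (α (S.t 0)))
      (Realization.vertex (rips X r hr) (α (S.t 0))) :=
  (edgeWalk (rips X r hr) (fun i => α (S.t i)) S.m fun i hi =>
      pair_mem_rips α hr hδ (S.diam_lt i hi) (left_mem_Icc.2 (S.lt_succ i hi).le)
        (right_mem_Icc.2 (S.lt_succ i hi).le)).trans
    (edgePath (rips X r hr) (pair_mem_rips α hr hδ S.diam_wrap
      (Or.inr (left_mem_Icc.2 unitInterval.le_one')) (Or.inl (right_mem_Icc.2 bot_le))))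

/-- The class in `π₁(Rips(X, r), p)` of an `r`-sample, with `t 0 = 0`, of a loop based at `p`. -/
def LoopSample.ripsClass {p : X} {α : Path p p} {r : ℝ} (S : LoopSample α r) (hr : 0 < r)
    (h0 : S.t 0 = 0) : RipsGroup p r hr :=
  loopClass ((S.ripsLoop hr le_rfl).cast (by rw [h0, α.source]) (by rw [h0, α.source]))

open Classical in
/-- A triangle `{x₁, x₂, x₃}` of the closed Rips complex at scale `r` is critical if attaching a
disc to `Rips(X, r)` along some `(r/2)`-sample of some filling of `x₁, x₂, x₃, x₁` induces a map on
fundamental groups with nontrivial kernel. -/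
def IsCriticalTriangle (p : X) (r : ℝ) (hr : 0 < r) (x₁ x₂ x₃ : X) : Prop :=
  {x₁, x₂, x₃} ∈ (closedRips X r hr).faces ∧ x₁ ≠ x₂ ∧ x₂ ≠ x₃ ∧ x₃ ≠ x₁ ∧
    ∃ α : Path x₁ x₁, IsFilling x₂ x₃ α ∧ ∃ S : LoopSample α (r / 2),
      (FundamentalGroup.map (AttachDisc.incl (S.ripsLoop hr (half_le_self hr.le)))
        (Realization.vertex (rips X r hr) p)).ker ≠ ⊥

end Rips

end RipsLoc

end

/-! Sampling a path finely turns its homotopy class in `X` into the class of an edge path in the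
Rips complex. This `sampling` is a functor of fundamental groupoids. It is onto, since an edge is
the sample of a geodesic, and it commutes with the bonding maps. Hence `π₁` of the Rips complex at
scale `s` is a quotient of `π₁(X)`, and persistence asks which classes die at which scale.

A loop shorter than `3s` dies at scale `s`: three arcs shorter than `s` sample to a triangle that is
a simplex (`sampling_of_pathLength_lt`). In the other direction, let `ν` be a functor from the
fundamental groupoid of `X` to a group (a `PathLabel`, in practice the quotient by a normal
subgroup). If `ν` is trivial on geodesic triangles with sides `< s`, the labels of geodesics are
multiplicative on triangles and extend to edge paths. So a loop with trivial sample has trivial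
label, provided that its small arcs are labelled like geodesics (`label_eq_one_of_sampling`). Both
the functor and the extension are holonomies of group-valued cocycles, on the cover of `X` by balls
and on the cover of the complex by open stars.

Critical triangles: attaching a disc has nontrivial kernel exactly when the attaching loop is
essential, so a triangle is critical iff the sample of a filling is nontrivial. The filling then has
length at least `3r` while its sides are at most `r`, so every side equals `r`. Different fillings
differ by bigons of length at most `2r`, so they have the same sample.

Kernels: take the label modulo the critical lassos. It is trivial on closed hexagons with sides at
most `r/2`, and by compactness of `X` also on those with sides below `r/2 + ε`, hence on geodesic
triangles with sides below `r + ε`. Since there is no critical value between `r` and `r'`, a class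
that dies at `r'` dies at some scale in `(r, r + ε)`; its label is therefore trivial.

Converse: take the label modulo `lassoSubgroup p (3 * r)`. If a loop of length `3r` has nontrivial
label, no chord is shorter than both arcs that it cuts off, as otherwise the loop would be a product
of two shorter loops. Thus the loop is a geodesic circle. Its sample is nontrivial at scale `r` and
trivial at every larger scale. -/

namespace RipsLoc

/-! ### Holonomy of a group-valued cocycle -/

section Holonomy

open Path.Homotopic (Quotient)
open Path.Homotopic.Quotient renaming mk → cls

/-- An open cover with group-valued transition elements that satisfy the cocycle identity. -/
structure GroupCocycle (Y V G : Type*) [TopologicalSpace Y] [Group G] where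
  U : V → Set Y
  isOpen_U : ∀ v, IsOpen (U v)
  cover : ∀ y, ∃ v, y ∈ U v
  g : V → V → G
  mul : ∀ u v w y, y ∈ U u → y ∈ U v → y ∈ U w → g u v * g v w = g u w

variable {Y V G : Type*} [TopologicalSpace Y] [Group G]

theorem GroupCocycle.g_self (C : GroupCocycle Y V G) {v : V} {y : Y} (h : y ∈ C.U v) :
    C.g v v = 1 := by
  simpa using C.mul v v v y h h h

/-- The bundle of discrete fibre `G` glued by the transition elements. -/
noncomputable def GroupCocycle.core [TopologicalSpace G] [DiscreteTopology G]
    (C : GroupCocycle Y V G) : FiberBundleCore V Y G where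
  baseSet := C.U
  isOpen_baseSet := C.isOpen_U
  indexAt y := (C.cover y).choose
  mem_baseSet_at y := (C.cover y).choose_spec
  coordChange u v _ x := x * C.g u v
  coordChange_self v y hy x := by rw [C.g_self hy, mul_one]
  continuousOn_coordChange u v :=
    ((continuous_of_discreteTopology (f := fun x : G => x * C.g u v)).comp
      continuous_snd).continuousOn
  coordChange_comp u v w y hy x := by rw [mul_assoc, C.mul u v w y hy.1.1 hy.1.2 hy.2]

/-- Additivity along subpaths and validity on short subpaths imply validity. -/
theorem subpath_induction (P : I → I → Prop) (trans : ∀ a b c, P a b → P b c → P a c)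
    (loc : ∀ t : I, ∃ W : Set I, IsOpen W ∧ t ∈ W ∧ ∀ a b, a ≤ b → Icc a b ⊆ W → P a b) :
    P 0 1 := by
  choose W hWo hWt hW using loc
  obtain ⟨t, t0, tm, ⟨n, hn⟩, ht⟩ :=
    exists_monotone_Icc_subset_open_cover_unitInterval hWo
      (fun s _ => mem_iUnion.2 ⟨s, hWt s⟩)
  have key : ∀ k, P 0 (t k) := by
    intro k
    induction k with
    | zero =>
      obtain ⟨s, hs⟩ := ht 0
      have h0 : t 0 ∈ W s := hs (left_mem_Icc.2 (tm (Nat.le_succ 0)))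
      rw [t0] at h0 ⊢
      exact hW s 0 0 le_rfl (by rw [Icc_self]; exact singleton_subset_iff.2 h0)
    | succ k ih =>
      obtain ⟨s, hs⟩ := ht k
      exact trans _ _ _ ih (hW s _ _ (tm (Nat.le_succ k)) hs)
  simpa [hn n le_rfl] using key n

/-- The class of the subpath of `f` from `f s` to `f t`. -/
noncomputable def seg {a b : Y} (f : Path a b) (s t : I) : Quotient (f s) (f t) :=
  cls (f.subpath s t)

theorem seg_trans {a b : Y} (f : Path a b) (s t u : I) :
    (seg f s t).trans (seg f t u) = seg f s u := by
  rw [seg, seg, ← Path.Homotopic.Quotient.mk_trans]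
  exact Path.Homotopic.Quotient.eq.2 ⟨Path.Homotopy.subpathTransSubpath f s t u⟩

theorem seg_self {a b : Y} (f : Path a b) (s : I) : seg f s s = Path.Homotopic.Quotient.refl (f s)
    := by
  rw [seg, Path.subpath_self, Path.Homotopic.Quotient.mk_refl]

theorem seg_symm {a b : Y} (f : Path a b) (s t : I) : (seg f s t).symm = seg f t s := by
  rw [seg, ← Path.Homotopic.Quotient.mk_symm, Path.symm_subpath, seg]

theorem seg_zero_one {a b : Y} (f : Path a b) :
    seg f 0 1 = (cls f).cast f.source f.target := by
  rw [seg, Path.subpath_zero_one, Path.Homotopic.Quotient.mk_cast]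

/-- Parallel transport of fibre coordinates along homotopy classes of paths. -/
theorem GroupCocycle.exists_transport (C : GroupCocycle Y V G) :
    ∃ T : ∀ {a b : Y}, Quotient a b → V → V → G → G,
      (∀ (a b c : Y) (p : Quotient a b) (q : Quotient b c) (u v w : V) (x : G), b ∈ C.U v →
        T (p.trans q) u w x = T q v w (T p u v x)) ∧
      (∀ (a b : Y) (f : Path a b) (v : V) (x : G), (∀ t, f t ∈ C.U v) → T (cls f) v v x = x) ∧
      (∀ (a : Y) (u v : V) (x : G), a ∈ C.U u → a ∈ C.U v →
        T (Path.Homotopic.Quotient.refl a) u v x = x * C.g u v) := by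
  -- With discrete fibre the bundle is a covering, so its monodromy depends only on the homotopy
  -- class of a path.
  let : TopologicalSpace G := ⊥
  have : DiscreteTopology G := ⟨rfl⟩
  set Z := C.core with hZ
  have cov : IsCoveringMap (Bundle.TotalSpace.proj : Z.TotalSpace → Y) :=
    FiberBundle.isCoveringMap (F := G) (E := Z.Fiber)
  -- Points of the total space are stored in the preferred chart at `a`; `pt` and `cd` translate
  -- from and to the chart `u`.
  let pt : ∀ (a : Y) (u : V) (x : G),
      (Bundle.TotalSpace.proj : Z.TotalSpace → Y) ⁻¹' {a} :=
    fun a u x => ⟨⟨a, x * C.g u (Z.indexAt a)⟩, rfl⟩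
  let cd : ∀ (a : Y) (u : V), (Bundle.TotalSpace.proj : Z.TotalSpace → Y) ⁻¹' {a} → G :=
    fun a u e => (show G from e.1.2) * C.g (Z.indexAt a) u
  have hidx : ∀ a, a ∈ C.U (Z.indexAt a) := Z.mem_baseSet_at
  have hptcd : ∀ a u e, a ∈ C.U u → pt a u (cd a u e) = e := by
    rintro a u ⟨⟨a', x⟩, ha⟩ hu
    obtain rfl : a' = a := ha
    apply Subtype.ext
    have : C.g (Z.indexAt a') u * C.g u (Z.indexAt a') = 1 := by
      rw [C.mul _ _ _ a' (hidx a') hu (hidx a'), C.g_self (hidx a')]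
    have e : ∀ x : G, x * C.g (Z.indexAt a') u * C.g u (Z.indexAt a') = x := fun x => by
      rw [mul_assoc, this, mul_one]
    exact congrArg (fun z : G => (⟨a', z⟩ : Z.TotalSpace)) (e x)
  have hcdpt : ∀ a u v x, a ∈ C.U u → a ∈ C.U v → cd a v (pt a u x) = x * C.g u v := by
    intro a u v x hu hv
    change x * C.g u (Z.indexAt a) * C.g (Z.indexAt a) v = _
    rw [mul_assoc, C.mul _ _ _ a hu (hidx a) hv]
  refine ⟨fun {a b} p u v x => cd b v (cov.monodromy p (pt a u x)), ?_, ?_, ?_⟩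
  · intro a b c p q u v w x hb
    dsimp only
    rw [cov.monodromy_trans_apply, hptcd b v _ hb]
  · intro a b f v x hf
    have ha : a ∈ C.U v := by simpa using hf 0
    have hb : b ∈ C.U v := by simpa using hf 1
    let Γ : I → Z.TotalSpace := fun t => (Z.localTriv v).toOpenPartialHomeomorph.symm (f t, x)
    have hΓc : Continuous Γ := by
      refine (Z.localTriv v).toOpenPartialHomeomorph.symm.continuousOn.comp_continuous
        (f.continuous.prodMk continuous_const) fun t => ?_
      exact (Z.mem_localTriv_target v _).2 (hf t)
    have hΓ : ∀ t, Γ t = (pt (f t) v x).1 := fun t => rfl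
    have e : cov.monodromy (cls f) (pt a v x) = pt b v x := by
      let Γ' : Path (pt a v x).1 (pt b v x).1 :=
        ⟨⟨Γ, hΓc⟩, by change Γ 0 = _; rw [hΓ, f.source], by change Γ 1 = _; rw [hΓ, f.target]⟩
      exact cov.monodromy_eq_of_map_eq (cls Γ') rfl
    dsimp only
    rw [e, hcdpt b v v x hb hb, C.g_self hb, mul_one]
  · intro a u v x hu hv
    simp only [cov.monodromy_refl, id]
    exact hcdpt a u v x hu hv

/-- Coordinate changes multiply on the right, so transport commutes with left multiplication and has
the form `x ↦ x * T 1`. Taking `T 1` as the holonomy turns composition of transports into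
multiplication. -/
theorem GroupCocycle.exists_holonomy (C : GroupCocycle Y V G) :
    ∃ H : ∀ {a b : Y}, Quotient a b → V → V → G,
      (∀ (a b c : Y) (p : Quotient a b) (q : Quotient b c) (u v w : V), a ∈ C.U u → b ∈ C.U v →
        c ∈ C.U w → H (p.trans q) u w = H p u v * H q v w) ∧
      (∀ (a b : Y) (f : Path a b) (v : V), (∀ t, f t ∈ C.U v) → H (cls f) v v = 1) ∧
      (∀ (a : Y) (u v : V), a ∈ C.U u → a ∈ C.U v →
        H (Path.Homotopic.Quotient.refl a) u v = C.g u v) := by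
  obtain ⟨T, Ttrans, Tloc, Trefl⟩ := C.exists_transport
  choose idx hidx using C.cover
  have Teq : ∀ (a b : Y) (f : Path a b) (u v : V) (x : G), a ∈ C.U u → b ∈ C.U v →
      T (cls f) u v x = x * T (cls f) u v 1 := by
    intro a b f u v x hu hv
    have key := subpath_induction (fun s t => ∀ u v x, f s ∈ C.U u → f t ∈ C.U v →
      T (seg f s t) u v x = x * T (seg f s t) u v 1) ?_ ?_
    · have aux : ∀ {a' b' : Y} (ha : a' = a) (hb : b' = b) (u v x),
          T ((cls f).cast ha hb) u v x = T (cls f) u v x := by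
        rintro _ _ rfl rfl u v x; rw [Path.Homotopic.Quotient.cast_rfl_rfl]
      have := key u v x (by simpa using hu) (by simpa using hv)
      rwa [seg_zero_one, aux, aux] at this
    · intro r s t h1 h2 u w x hu hw
      rw [← seg_trans f r s t, Ttrans _ _ _ _ _ u (idx (f s)) w x (hidx _),
        Ttrans _ _ _ _ _ u (idx (f s)) w 1 (hidx _), h1 u _ x hu (hidx _),
        h2 _ w _ (hidx _) hw, h2 _ w (T (seg f r s) u _ 1) (hidx _) hw, mul_assoc]
    · intro t
      refine ⟨f ⁻¹' C.U (idx (f t)), (C.isOpen_U _).preimage f.continuous, hidx _, ?_⟩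
      intro r s hrs hsub u w x hu hw
      have hr : f r ∈ C.U (idx (f t)) := hsub (left_mem_Icc.2 hrs)
      have hs : f s ∈ C.U (idx (f t)) := hsub (right_mem_Icc.2 hrs)
      have key : ∀ x, T (seg f r s) u w x = x * (C.g u (idx (f t)) * C.g (idx (f t)) w) := by
        intro x
        -- The constant paths at the two ends absorb the chart changes; in between, the path stays
        -- in a single chart and transport is trivial.
        have e : seg f r s = ((Path.Homotopic.Quotient.refl _).trans (seg f r s)).trans
          (Path.Homotopic.Quotient.refl _) := by simp
        rw [e, Ttrans _ _ _ _ _ u (idx (f t)) w _ hs,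
          Ttrans _ _ _ _ _ u (idx (f t)) _ _ hr, Trefl _ u _ _ hu hr,
          Trefl _ _ w _ hs hw, seg, Tloc _ _ _ _ _ ?_, mul_assoc]
        intro q
        have : f.subpath r s q ∈ range (f.subpath r s) := mem_range_self q
        rw [Path.range_subpath_of_le _ _ _ hrs] at this
        obtain ⟨z, hz, hz'⟩ := this
        rw [← hz']
        exact hsub hz
      rw [key, key 1, one_mul]
  refine ⟨fun {a b} p u v => T p u v 1, ?_, ?_, ?_⟩
  · intro a b c p q u v w ha hb hc
    induction q using Path.Homotopic.Quotient.ind with | mk q =>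
    dsimp only
    rw [Ttrans _ _ _ _ _ u v w _ hb, Teq _ _ q v w _ hb hc]
  · intro a b f v hf
    exact Tloc a b f v 1 hf
  · intro a u v hu hv
    dsimp only
    rw [Trefl a u v 1 hu hv, one_mul]

end Holonomy

end RipsLoc

namespace RipsLoc

/-! ### Paths in the geometric realization -/

section RealizationPaths

open Path.Homotopic (Quotient)
open Path.Homotopic.Quotient renaming mk → cls

/-- Commutativity in the fundamental groupoid of the boundary of a square. -/
theorem cls_square {Y : Type*} [TopologicalSpace Y] {a b c d : Y} (H : C(I × I, Y))
    (f : Path a b) (l : Path a c) (r : Path b d) (g : Path c d)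
    (hf : ∀ t, H (t, 0) = f t) (hl : ∀ s, H (0, s) = l s) (hr : ∀ s, H (1, s) = r s)
    (hg : ∀ t, H (t, 1) = g t) : (cls f).trans (cls r) = (cls l).trans (cls g) := by
  obtain rfl : a = H (0, 0) := by rw [hf, f.source]
  obtain rfl : b = H (1, 0) := by rw [hf, f.target]
  obtain rfl : c = H (0, 1) := by rw [hl, l.target]
  obtain rfl : d = H (1, 1) := by rw [hr, r.target]
  let b' : Path ((0 : I), (0 : I)) (1, 0) := ⟨⟨fun t => (t, 0), by fun_prop⟩, rfl, rfl⟩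
  let l' : Path ((0 : I), (0 : I)) (0, 1) := ⟨⟨fun t => (0, t), by fun_prop⟩, rfl, rfl⟩
  let r' : Path ((1 : I), (0 : I)) (1, 1) := ⟨⟨fun t => (1, t), by fun_prop⟩, rfl, rfl⟩
  let t' : Path ((0 : I), (1 : I)) (1, 1) := ⟨⟨fun t => (t, 1), by fun_prop⟩, rfl, rfl⟩
  have ef : f = b'.map H.continuous := by ext t; exact (hf t).symm
  have el : l = l'.map H.continuous := by ext t; exact (hl t).symm
  have er : r = r'.map H.continuous := by ext t; exact (hr t).symm
  have eg : g = t'.map H.continuous := by ext t; exact (hg t).symm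
  -- The two ways around the boundary are homotopic already in the simply connected square.
  have : ContractibleSpace I := (convex_Icc (0 : ℝ) 1).contractibleSpace ⟨0, by simp⟩
  have : SimplyConnectedSpace (I × I) := inferInstance
  rw [ef, el, er, eg, ← Path.Homotopic.Quotient.mk_trans, ← Path.Homotopic.Quotient.mk_trans,
    ← Path.map_trans, ← Path.map_trans]
  exact Path.Homotopic.Quotient.eq.2
    ((SimplyConnectedSpace.paths_homotopic (b'.trans r') (l'.trans t')).map H)

theorem trans_forall {Y : Type*} [TopologicalSpace Y] {a b c : Y} {P : Y → Prop} (f : Path a b)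
    (g : Path b c) (hf : ∀ t, P (f t)) (hg : ∀ t, P (g t)) (t : I) : P ((f.trans g) t) := by
  have h : (f.trans g) t ∈ range (f.trans g) := mem_range_self t
  rw [Path.trans_range] at h
  rcases h with ⟨t', ht'⟩ | ⟨t', ht'⟩
  · rw [← ht']; exact hf t'
  · rw [← ht']; exact hg t'

theorem symm_forall {Y : Type*} [TopologicalSpace Y] {a b : Y} {P : Y → Prop} (f : Path a b)
    (hf : ∀ t, P (f t)) (t : I) : P (f.symm t) := hf _

theorem subpath_forall {Y : Type*} [TopologicalSpace Y] {a b : Y} {P : Y → Prop} (f : Path a b)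
    {s t : I} (hst : s ≤ t) (hf : ∀ u ∈ Icc s t, P (f u)) (u : I) : P (f.subpath s t u) := by
  have h : f.subpath s t u ∈ range (f.subpath s t) := mem_range_self u
  rw [Path.range_subpath_of_le _ _ _ hst] at h
  obtain ⟨z, hz, hz'⟩ := h
  rw [← hz']
  exact hf z hz

variable {V : Type*} {K : AbstractSimplicialComplex V}

/-- The barycentric coordinates of a point of `|K|`. -/
def Realization.coord (f : Realization K) : V → ℝ := f.1

theorem Realization.ext_coord {f g : Realization K} (h : ∀ v, f.coord v = g.coord v) : f = g :=
  Subtype.ext (funext h)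

theorem Realization.continuous_coord (v : V) :
    Continuous (fun f : Realization K => f.coord v) :=
  (continuous_apply v).comp (continuous_iSup_dom.2 fun _ =>
    continuous_coinduced_dom.2 continuous_induced_dom :
      Continuous (fun f : Realization K => f.coord))

theorem Realization.exists_face (f : Realization K) : ∃ s ∈ K.faces, (∀ v, 0 ≤ f.coord v) ∧
    (∀ v, v ∉ s → f.coord v = 0) ∧ ∑ v ∈ s, f.coord v = 1 := f.2

theorem Realization.nonneg (f : Realization K) (v : V) : 0 ≤ f.coord v := by
  obtain ⟨s, _, h, _⟩ := f.exists_face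
  exact h v

theorem Realization.le_one (f : Realization K) (v : V) : f.coord v ≤ 1 := by
  obtain ⟨s, _, h, h0, h1⟩ := f.exists_face
  by_cases hv : v ∈ s
  · rw [← h1]
    exact Finset.single_le_sum (fun i _ => h i) hv
  · rw [h0 v hv]; exact zero_le_one

theorem Realization.exists_pos (f : Realization K) : ∃ v, 0 < f.coord v := by
  obtain ⟨s, _, h, h0, h1⟩ := f.exists_face
  obtain ⟨v, _, hv⟩ := Finset.exists_ne_zero_of_sum_ne_zero (h1.trans_ne one_ne_zero)
  exact ⟨v, lt_of_le_of_ne (h v) hv.symm⟩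

theorem Realization.mem_faces_of_pos (f : Realization K) (s : Finset V) (hne : s.Nonempty)
    (h : ∀ v ∈ s, 0 < f.coord v) : s ∈ K.faces := by
  obtain ⟨s', hs', _, h0, _⟩ := f.exists_face
  refine (K.isRelLowerSet_faces hs').2 (fun v hv => ?_) hne
  by_contra hv'
  exact (h v hv).ne' (h0 v hv')

theorem Realization.sum_eq_one (f : Realization K) {s : Finset V}
    (h : ∀ v, v ∉ s → f.coord v = 0) : ∑ v ∈ s, f.coord v = 1 := by
  classical
  obtain ⟨s', _, _, h0, h1⟩ := f.exists_face
  have e1 : ∑ v ∈ s, f.coord v = ∑ v ∈ s ∪ s', f.coord v :=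
    Finset.sum_subset Finset.subset_union_left fun v _ hv => h v hv
  have e2 : ∑ v ∈ s', f.coord v = ∑ v ∈ s ∪ s', f.coord v :=
    Finset.sum_subset Finset.subset_union_right fun v _ hv => h0 v hv
  rw [e1, ← e2, h1]

/-- In the weak topology, coordinatewise continuity is not enough in general. A map into one closed
simplex factors through that simplex, whose topology is given by the coordinates. -/
theorem Realization.continuous_of_support {Z : Type*} [TopologicalSpace Z] {s : Finset V}
    (hs : s ∈ K.faces) (h : Z → Realization K) (h0 : ∀ z v, v ∉ s → (h z).coord v = 0)
    (hc : ∀ v, Continuous fun z => (h z).coord v) : Continuous h := by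
  let g : Z → ClosedSimplex K s := fun z => ⟨h z, h0 z⟩
  have hg : Continuous g := continuous_induced_rng.2 (continuous_pi hc)
  exact (continuous_closedSimplex_val K hs).comp hg

open Classical in
theorem Realization.coord_vertex (u v : V) :
    (vertex K u).coord v = if v = u then 1 else 0 := by
  change (Pi.single u 1 : V → ℝ) v = _
  rw [Pi.single_apply]

/-- The point `(1 - t) f + t g` for `f`, `g` in a common closed simplex. -/
def Realization.mix {s : Finset V} (hs : s ∈ K.faces) (f g : Realization K)
    (hf : ∀ v, v ∉ s → f.coord v = 0) (hg : ∀ v, v ∉ s → g.coord v = 0) (t : I) :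
    Realization K :=
  ⟨fun v => (1 - (t : ℝ)) * f.coord v + t * g.coord v, s, hs,
    fun v => add_nonneg (mul_nonneg (sub_nonneg.2 t.2.2) (f.nonneg v))
      (mul_nonneg t.2.1 (g.nonneg v)),
    fun v hv => by simp [hf v hv, hg v hv],
    by rw [Finset.sum_add_distrib, ← Finset.mul_sum, ← Finset.mul_sum, f.sum_eq_one hf,
      g.sum_eq_one hg]; ring⟩

theorem Realization.coord_mix {s : Finset V} (hs : s ∈ K.faces) (f g : Realization K)
    (hf : ∀ v, v ∉ s → f.coord v = 0) (hg : ∀ v, v ∉ s → g.coord v = 0) (t : I) (v : V) :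
    (mix hs f g hf hg t).coord v = (1 - (t : ℝ)) * f.coord v + t * g.coord v := rfl

/-- Paths in a common closed simplex are homotopic. -/
theorem Realization.cls_eq_of_support {s : Finset V} (hs : s ∈ K.faces) {a b : Realization K}
    (f g : Path a b) (hf : ∀ t v, v ∉ s → (f t).coord v = 0)
    (hg : ∀ t v, v ∉ s → (g t).coord v = 0) : cls f = cls g := by
  let h : I × I → Realization K := fun z => mix hs (f z.1) (g z.1) (hf z.1) (hg z.1) z.2
  have hc : ∀ z v, (h z).coord v = (1 - (z.2 : ℝ)) * (f z.1).coord v + z.2 * (g z.1).coord v :=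
    fun z v => rfl
  have hcont : Continuous h := by
    refine continuous_of_support hs _ (fun z v hv => ?_) fun v => ?_
    · rw [hc, hf z.1 v hv, hg z.1 v hv]; simp
    · have h1 : Continuous fun z : I × I => (f z.1).coord v :=
        (continuous_coord v).comp (f.continuous.comp continuous_fst)
      have h2 : Continuous fun z : I × I => (g z.1).coord v :=
        (continuous_coord v).comp (g.continuous.comp continuous_fst)
      simp only [hc]
      exact ((continuous_const.sub (continuous_subtype_val.comp continuous_snd)).mul h1).add
        ((continuous_subtype_val.comp continuous_snd).mul h2)
  have key := cls_square ⟨h, hcont⟩ f (Path.refl a) (Path.refl b) g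
    (fun t => ext_coord fun v => by simp [hc])
    (fun t => ext_coord fun v => by simp [hc]; ring)
    (fun t => ext_coord fun v => by simp [hc]; ring)
    (fun t => ext_coord fun v => by simp [hc])
  simpa using key

/-- The segment between two points of a closed simplex. -/
def Realization.segment {s : Finset V} (hs : s ∈ K.faces) (f g : Realization K)
    (hf : ∀ v, v ∉ s → f.coord v = 0) (hg : ∀ v, v ∉ s → g.coord v = 0) : Path f g where
  toFun := mix hs f g hf hg
  continuous_toFun := by
    refine continuous_of_support hs _ (fun z v hv => ?_) fun v => ?_
    · rw [coord_mix, hf v hv, hg v hv]; simp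
    · simp only [coord_mix]; fun_prop
  source' := ext_coord fun v => by simp [coord_mix]
  target' := ext_coord fun v => by simp [coord_mix]

theorem Realization.segment_support {s : Finset V} (hs : s ∈ K.faces) (f g : Realization K)
    (hf : ∀ v, v ∉ s → f.coord v = 0) (hg : ∀ v, v ∉ s → g.coord v = 0) (t : I) (v : V)
    (hv : v ∉ s) : (segment hs f g hf hg t).coord v = 0 := by
  change (1 - (t : ℝ)) * f.coord v + t * g.coord v = 0
  rw [hf v hv, hg v hv]; simp

/-! ### Contraction inside an open star. -/

/-- The factor by which the coordinates other than `v` are scaled. -/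
noncomputable def starFactor (δ y : ℝ) (t : I) : ℝ := max (1 - (t : ℝ)) (δ - y)

theorem starFactor_nonneg (δ y : ℝ) (t : I) : 0 ≤ starFactor δ y t :=
  le_max_of_le_left (sub_nonneg.2 t.2.2)

/-- This is the normalizing denominator of `contract`. The term `δ - y` of `starFactor` keeps it
positive at `t = 1` even where the coordinate `v` vanishes, so the deformation is defined on all of
`|K|`; on `{δ ≤ f v}` the term does no harm. -/
theorem starFactor_sum_pos {δ y : ℝ} (hδ : 0 < δ) (hy : 0 ≤ y) (hy1 : y ≤ 1) (t : I) :
    0 < starFactor δ y t + (1 - starFactor δ y t) * y := by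
  have h := starFactor_nonneg δ y t
  rcases hy.eq_or_lt with rfl | hy
  · have : 0 < starFactor δ 0 t := lt_max_of_lt_right (by simpa using hδ)
    simpa using this
  · nlinarith

open Classical in
/-- A deformation of `|K|` that contracts `{f | δ ≤ f v}` to the vertex `v`. -/
noncomputable def Realization.contract (v : V) {δ : ℝ} (hδ : 0 < δ) (f : Realization K) (t : I) :
    Realization K :=
  ⟨fun u => (starFactor δ (f.coord v) t * f.coord u +
      (1 - starFactor δ (f.coord v) t) * (if u = v then f.coord v else 0)) /
      (starFactor δ (f.coord v) t + (1 - starFactor δ (f.coord v) t) * f.coord v), by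
    obtain ⟨s, hs, -, h0, -⟩ := f.exists_face
    have hS := starFactor_sum_pos hδ (f.nonneg v) (f.le_one v) t
    have hm := starFactor_nonneg δ (f.coord v) t
    refine ⟨s, hs, fun u => div_nonneg ?_ hS.le, fun u hu => ?_, ?_⟩
    · split_ifs with huv
      · subst huv; nlinarith [f.nonneg u]
      · have := mul_nonneg hm (f.nonneg u)
        linarith
    · dsimp only
      split_ifs with huv
      · subst huv; simp [h0 u hu]
      · simp [h0 u hu]
    · have : ∑ u ∈ s, (if u = v then f.coord v else 0) = f.coord v := by
        rw [Finset.sum_ite_eq' s v fun _ => f.coord v]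
        split_ifs with hv
        · rfl
        · exact (h0 v hv).symm
      rw [← Finset.sum_div, Finset.sum_add_distrib, ← Finset.mul_sum, ← Finset.mul_sum,
        f.sum_eq_one h0, this, mul_one, div_self hS.ne']⟩

open Classical in
theorem Realization.coord_contract (v : V) {δ : ℝ} (hδ : 0 < δ) (f : Realization K) (t : I)
    (u : V) : (contract v hδ f t).coord u = (starFactor δ (f.coord v) t * f.coord u +
      (1 - starFactor δ (f.coord v) t) * (if u = v then f.coord v else 0)) /
      (starFactor δ (f.coord v) t + (1 - starFactor δ (f.coord v) t) * f.coord v) := rfl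

theorem Realization.contract_support (v : V) {δ : ℝ} (hδ : 0 < δ) (f : Realization K) (t : I)
    (u : V) (hu : f.coord u = 0) : (contract v hδ f t).coord u = 0 := by
  rw [coord_contract]
  split_ifs with huv
  · subst huv; simp [hu]
  · simp [hu]

theorem Realization.contract_zero (v : V) {δ : ℝ} (hδ : 0 < δ) (hδ1 : δ ≤ 1)
    (f : Realization K) : contract v hδ f 0 = f := by
  have : starFactor δ (f.coord v) 0 = 1 :=
    max_eq_left (by simp only [Icc.coe_zero]; linarith [f.nonneg v]) |>.trans (by simp)
  exact ext_coord fun u => by simp [coord_contract, this]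

theorem Realization.contract_one (v : V) {δ : ℝ} (hδ : 0 < δ)
    (f : Realization K) (hf : δ ≤ f.coord v) : contract v hδ f 1 = vertex K v := by
  have : starFactor δ (f.coord v) 1 = 0 :=
    max_eq_left (by simpa using hf) |>.trans (by simp)
  have h0 : f.coord v ≠ 0 := (hδ.trans_le hf).ne'
  refine ext_coord fun u => ?_
  rw [coord_contract, coord_vertex, this]
  split_ifs <;> simp [h0]

theorem Realization.continuous_contract_of_support (v : V) {δ : ℝ} (hδ : 0 < δ) {Z : Type*}
    [TopologicalSpace Z] {s : Finset V} (hs : s ∈ K.faces) (g : Z → Realization K) (τ : Z → I)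
    (h0 : ∀ z v, v ∉ s → (g z).coord v = 0) (hc : ∀ v, Continuous fun z => (g z).coord v)
    (hτ : Continuous τ) : Continuous fun z => contract v hδ (g z) (τ z) := by
  refine continuous_of_support hs _
    (fun z u hu => contract_support v hδ _ _ u (h0 z u hu)) fun u => ?_
  have h2 := hc v
  have hm : Continuous fun z => starFactor δ ((g z).coord v) (τ z) := by
    simp only [starFactor]
    fun_prop
  have h1 := hc u
  simp only [coord_contract]
  refine Continuous.div ?_ (by fun_prop) fun z =>
    (starFactor_sum_pos hδ ((g z).nonneg v) ((g z).le_one v) (τ z)).ne'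
  split_ifs <;> fun_prop

/-- The weak topology tests continuity of maps out of `|K|`, not out of `|K| × I`. Currying moves
`I` into the target, where the test applies simplex by simplex; uncurrying is legitimate because `I`
is locally compact. -/
theorem Realization.continuous_contract (v : V) {δ : ℝ} (hδ : 0 < δ) :
    Continuous fun z : Realization K × I => contract v hδ z.1 z.2 := by
  let F : Realization K → C(I, Realization K) := fun f =>
    ⟨fun t => contract v hδ f t, by
      obtain ⟨s, hs, -, h0, -⟩ := f.exists_face
      exact continuous_contract_of_support v hδ hs (fun _ => f) id
        (fun _ => h0) (fun _ => continuous_const) continuous_id⟩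
  have hF : Continuous F := by
    refine continuous_iSup_dom.2 fun s => continuous_coinduced_dom.2 ?_
    have : Continuous fun z : ClosedSimplex K s.1 × I => contract v hδ z.1.val z.2 := by
      refine continuous_contract_of_support v hδ s.2
        (fun z : ClosedSimplex K s.1 × I => z.1.val) Prod.snd
        (fun z => z.1.2) (fun u => ?_) continuous_snd
      exact (continuous_coord u).comp
        ((continuous_closedSimplex_val K s.2).comp continuous_fst)
    exact (ContinuousMap.curry ⟨_, this⟩).continuous
  exact ContinuousMap.continuous_uncurry_of_continuous ⟨F, hF⟩

/-- A face that supports a given point. -/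
noncomputable def Realization.carrier (a : Realization K) : Finset V := a.exists_face.choose

theorem Realization.carrier_mem (a : Realization K) : a.carrier ∈ K.faces :=
  a.exists_face.choose_spec.1

theorem Realization.carrier_support (a : Realization K) (v : V) (hv : v ∉ a.carrier) :
    a.coord v = 0 := a.exists_face.choose_spec.2.2.1 v hv

/-- A path class from a point of the open star of `v` to the vertex `v`. -/
noncomputable def Realization.toVertex (a : Realization K) (v : V) (hv : 0 < a.coord v) :
    Quotient a (vertex K v) :=
  cls (segment a.carrier_mem a (vertex K v) a.carrier_support
    fun u hu => by
      rw [coord_vertex, if_neg]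
      rintro rfl; exact hv.ne' (a.carrier_support u hu))

theorem Realization.toVertex_eq (a : Realization K) (v : V) (hv : 0 < a.coord v)
    (f : Path a (vertex K v)) (hf : ∀ t u, a.coord u = 0 → (f t).coord u = 0) :
    cls f = toVertex a v hv :=
  cls_eq_of_support a.carrier_mem _ _
    (fun t u hu => hf t u (a.carrier_support u hu)) (segment_support _ _ _ _ _)

/-- By compactness the coordinate `v` has a positive minimum `δ` along `f`, so `contract` shrinks
`f` to the vertex `v`. The endpoints move inside their carriers, so their tracks are homotopic to
the straight segments. -/
theorem Realization.cls_of_star {a b : Realization K} (f : Path a b) (v : V)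
    (hf : ∀ t, 0 < (f t).coord v) (ha : 0 < a.coord v) (hb : 0 < b.coord v) :
    cls f = (toVertex a v ha).trans (toVertex b v hb).symm := by
  obtain ⟨t₀, -, ht₀⟩ := isCompact_univ.exists_isMinOn univ_nonempty
    ((continuous_coord v).comp f.continuous).continuousOn
  set δ := (f t₀).coord v with hδdef
  have hδ : 0 < δ := hf t₀
  have hmin : ∀ t, δ ≤ (f t).coord v := fun t => ht₀ (mem_univ t)
  have hδ1 : δ ≤ 1 := le_one _ v
  let H : C(I × I, Realization K) := ⟨fun z => contract v hδ (f z.1) z.2,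
    (continuous_contract v hδ).comp ((f.continuous.comp continuous_fst).prodMk continuous_snd)⟩
  have hc : ∀ y : Realization K, Continuous fun t => contract v hδ y t := fun y =>
    (continuous_contract v hδ).comp (continuous_const.prodMk continuous_id)
  let l : Path a (vertex K v) := ⟨⟨fun t => contract v hδ a t, hc a⟩,
    contract_zero v hδ hδ1 a, contract_one v hδ a (by simpa using hmin 0)⟩
  let r : Path b (vertex K v) := ⟨⟨fun t => contract v hδ b t, hc b⟩,
    contract_zero v hδ hδ1 b, contract_one v hδ b (by simpa using hmin 1)⟩
  have key := cls_square H f l r (Path.refl _) (fun t => contract_zero v hδ hδ1 _)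
    (fun t => by simp [H, l]) (fun t => by simp [H, r])
    (fun t => contract_one v hδ _ (hmin t))
  rw [toVertex_eq a v ha l fun t u hu => contract_support v hδ a t u hu,
    toVertex_eq b v hb r fun t u hu => contract_support v hδ b t u hu] at key
  simp only [Path.Homotopic.Quotient.mk_refl, Path.Homotopic.Quotient.trans_refl] at key
  rw [← key]; simp

open Classical in
theorem edgePath_support {x y : V} (h : {x, y} ∈ K.faces) (t : I) (v : V)
    (hv : v ∉ ({x, y} : Finset V)) : (edgePath K h t).coord v = 0 := by
  simp only [Finset.mem_insert, Finset.mem_singleton, not_or] at hv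
  change (1 - (t : ℝ)) * (Pi.single x 1 : V → ℝ) v + t * (Pi.single y 1 : V → ℝ) v = 0
  rw [Pi.single_eq_of_ne hv.1, Pi.single_eq_of_ne hv.2]; simp

open Classical in
theorem Realization.toVertex_symm_trans (a : Realization K) (u v : V) (hu : 0 < a.coord u)
    (hv : 0 < a.coord v) (h : {u, v} ∈ K.faces) :
    (toVertex a u hu).symm.trans (toVertex a v hv) = cls (edgePath K h) := by
  rw [toVertex, toVertex, ← Path.Homotopic.Quotient.mk_symm, ← Path.Homotopic.Quotient.mk_trans]
  have hs := a.carrier_support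
  refine cls_eq_of_support a.carrier_mem _ _ (fun t w hw => ?_) fun t w hw => ?_
  · exact trans_forall (P := fun y : Realization K => y.coord w = 0) _ _
      (symm_forall (P := fun y : Realization K => y.coord w = 0) _
        fun t => segment_support a.carrier_mem _ _ _ _ t w hw)
      (fun t => segment_support a.carrier_mem _ _ _ _ t w hw) t
  · refine edgePath_support h t w fun hw' => ?_
    rcases Finset.mem_insert.1 hw' with rfl | hw'
    · exact hu.ne' (hs w hw)
    · rw [Finset.mem_singleton] at hw'; subst hw'; exact hv.ne' (hs w hw)

theorem Realization.vertex_pos (v : V) : 0 < (vertex K v).coord v := by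
  simp [coord_vertex]

theorem Realization.toVertex_vertex (v : V) :
    toVertex (vertex K v) v (vertex_pos v) = Path.Homotopic.Quotient.refl _ := by
  rw [← Path.Homotopic.Quotient.mk_refl]
  exact (toVertex_eq _ v _ _ fun t u hu => hu).symm

open Classical in
/-- Up to homotopy, a path between vertices is a concatenation of edges. -/
theorem Realization.edge_induction
    (P : ∀ x y : V, Quotient (vertex K x) (vertex K y) → Prop)
    (edge : ∀ x y (h : {x, y} ∈ K.faces), P x y (cls (edgePath K h)))
    (trans : ∀ x y z p q, P x y p → P y z q → P x z (p.trans q))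
    (x y : V) (q : Quotient (vertex K x) (vertex K y)) : P x y q := by
  have pair : ∀ (a : Realization K) (u v : V), 0 < a.coord u → 0 < a.coord v → {u, v} ∈ K.faces :=
      by
    intro a u v hu hv
    refine a.mem_faces_of_pos _ (Finset.insert_nonempty _ _) fun w hw => ?_
    rcases Finset.mem_insert.1 hw with rfl | hw
    · exact hu
    · rw [Finset.mem_singleton] at hw; subst hw; exact hv
  induction q using Path.Homotopic.Quotient.ind with | mk f =>
  -- Intermediate points are not vertices. Each arc is closed up by segments to vertices of the
  -- carriers of its ends, and all choices are allowed so that consecutive arcs match.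
  have key := subpath_induction (fun s t => ∀ u v (hu : 0 < (f s).coord u) (hv : 0 < (f t).coord v),
    P u v (((toVertex (f s) u hu).symm.trans (seg f s t)).trans (toVertex (f t) v hv))) ?_ ?_
  · have aux : ∀ {a b : Realization K} (g : Path a b) (ha : a = vertex K x) (hb : b = vertex K y)
        (hu : 0 < a.coord x) (hv : 0 < b.coord y), ((toVertex a x hu).symm.trans (cls g)).trans
          (toVertex b y hv) = (cls g).cast ha.symm hb.symm := by
      rintro _ _ g rfl rfl hu hv
      rw [Path.Homotopic.Quotient.cast_rfl_rfl, toVertex_vertex, toVertex_vertex]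
      have : (Path.Homotopic.Quotient.refl (vertex K x)).symm = Path.Homotopic.Quotient.refl _ := by
        rw [← Path.Homotopic.Quotient.mk_refl, ← Path.Homotopic.Quotient.mk_symm, Path.refl_symm]
      rw [this]; simp
    have := key x y (by rw [f.source]; exact vertex_pos x) (by rw [f.target]; exact vertex_pos y)
    rw [seg, aux _ f.source f.target, ← Path.Homotopic.Quotient.mk_cast] at this
    rw [Path.subpath_zero_one] at this
    exact this
  · intro r s t h1 h2 u v hu hv
    obtain ⟨w, hw⟩ := (f s).exists_pos
    convert trans _ _ _ _ _ (h1 u w hu hw) (h2 w v hw hv) using 1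
    rw [← seg_trans f r s t]
    simp only [Path.Homotopic.Quotient.trans_assoc]
    congr 2
    rw [← Path.Homotopic.Quotient.trans_assoc (toVertex (f s) w hw)]
    simp
  · intro t
    obtain ⟨w, hw⟩ := (f t).exists_pos
    refine ⟨{s | 0 < (f s).coord w}, ?_, hw, ?_⟩
    · exact isOpen_lt continuous_const ((continuous_coord w).comp f.continuous)
    intro a b hab hsub u v hu hv
    have ha : 0 < (f a).coord w := hsub (left_mem_Icc.2 hab)
    have hb : 0 < (f b).coord w := hsub (right_mem_Icc.2 hab)
    have e : seg f a b = (toVertex (f a) w ha).trans (toVertex (f b) w hb).symm := by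
      exact cls_of_star _ w (subpath_forall (P := fun y => 0 < y.coord w) f hab fun z hz => hsub
          hz) ha hb
    convert trans _ _ _ _ _ (edge u w (pair _ u w hu ha)) (edge w v (pair _ w v hb hv)) using 1
    rw [← toVertex_symm_trans (f a) u w hu ha, ← toVertex_symm_trans (f b) w v hb hv, e]
    simp only [Path.Homotopic.Quotient.trans_assoc]

end RealizationPaths

end RipsLoc

namespace RipsLoc

/-! ### Sampling paths in the Rips complex -/

section Arcs

open Path.Homotopic (Quotient)
open Path.Homotopic.Quotient renaming mk → cls

variable {Y : Type*} [TopologicalSpace Y]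

theorem refl_symm (y : Y) :
    (Path.Homotopic.Quotient.refl y).symm = Path.Homotopic.Quotient.refl y := by
  rw [← Path.Homotopic.Quotient.mk_refl, ← Path.Homotopic.Quotient.mk_symm, Path.refl_symm]

theorem trans_symm_cancel {a b c : Y} (p : Quotient a b) (q : Quotient a c) :
    p.trans (p.symm.trans q) = q := by
  rw [← Path.Homotopic.Quotient.trans_assoc]; simp

theorem symm_trans_cancel {a b c : Y} (p : Quotient b a) (q : Quotient a c) :
    p.symm.trans (p.trans q) = q := by
  rw [← Path.Homotopic.Quotient.trans_assoc]; simp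

theorem eq_symm_of_trans_eq_refl {a b : Y} {p : Quotient a b} {q : Quotient b a}
    (h : p.trans q = Path.Homotopic.Quotient.refl a) : q = p.symm := by
  rw [← symm_trans_cancel p q, h, Path.Homotopic.Quotient.trans_refl]

theorem symm_symm {a b : Y} (p : Quotient a b) : p.symm.symm = p := by
  induction p using Path.Homotopic.Quotient.ind with | mk f =>
  rw [← Path.Homotopic.Quotient.mk_symm, ← Path.Homotopic.Quotient.mk_symm, Path.symm_symm]

theorem trans_symm_rev {a b c : Y} (p : Quotient a b) (q : Quotient b c) :
    (p.trans q).symm = q.symm.trans p.symm := by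
  refine (eq_symm_of_trans_eq_refl ?_).symm
  rw [Path.Homotopic.Quotient.trans_assoc, trans_symm_cancel]; simp

/-- `P` ranges over all endpoints because arcs run between values of `f`, and `f 0 = x` is only a
propositional equality. -/
theorem seg_induction {x y : Y} (f : Path x y) (P : ∀ a b : Y, Quotient a b → Prop)
    (trans : ∀ r s t, P _ _ (seg f r s) → P _ _ (seg f s t) → P _ _ (seg f r t))
    (loc : ∀ t : I, ∃ W : Set I, IsOpen W ∧ t ∈ W ∧ ∀ a b, a ≤ b → Icc a b ⊆ W →
      P _ _ (seg f a b)) : P x y (cls f) := by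
  have key := subpath_induction (fun s t => P _ _ (seg f s t)) trans loc
  have aux : ∀ {a b : Y} (ha : a = x) (hb : b = y), P a b ((cls f).cast ha hb) →
      P x y (cls f) := by
    rintro _ _ rfl rfl h; rwa [Path.Homotopic.Quotient.cast_rfl_rfl] at h
  rw [seg_zero_one] at key
  exact aux _ _ key

/-- The class of the initial arc of `f` that ends at `f s`. -/
noncomputable def arc {x y : Y} (f : Path x y) (s : I) : Quotient x (f s) :=
  cls ((f.subpath 0 s).cast f.source.symm rfl)

theorem seg_eq_arc {x y : Y} (f : Path x y) (s t : I) :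
    seg f s t = (arc f s).symm.trans (arc f t) := by
  have aux : ∀ {a : Y} (ha : x = a) (p : Quotient a (f s)) (q : Quotient a (f t)),
      p.symm.trans q = (p.cast ha rfl).symm.trans (q.cast ha rfl) := by
    rintro _ rfl p q; simp
  have h := seg_trans f s 0 t
  rw [← seg_symm f 0 s] at h
  rw [← h, arc, arc, Path.Homotopic.Quotient.mk_cast, Path.Homotopic.Quotient.mk_cast]
  exact aux f.source.symm _ _

theorem arc_symm_trans_cls {x y : Y} (f : Path x y) (s : I) :
    (arc f s).symm.trans (cls f) = cls ((f.subpath s 1).cast rfl f.target.symm) := by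
  have aux : ∀ {a b : Y} (ha : x = a) (hb : y = b) (p : Quotient a (f s)) (q : Quotient a b)
      (q' : Quotient x y), q = q'.cast ha.symm hb.symm →
      (p.cast ha rfl).symm.trans q' = (p.symm.trans q).cast rfl hb := by
    rintro _ _ rfl rfl p q q' rfl; simp
  have h := seg_trans f s 0 1
  rw [← seg_symm f 0 s] at h
  rw [arc, Path.Homotopic.Quotient.mk_cast, Path.Homotopic.Quotient.mk_cast,
    aux f.source.symm f.target.symm (cls (f.subpath 0 s)) (seg f 0 1) (cls f) (seg_zero_one f)]
  exact congrArg (fun q => Path.Homotopic.Quotient.cast q rfl f.target.symm) h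

theorem cls_rotateLoop {X : Type*} [MetricSpace X] {y : X} (α : Path y y) (s : I) :
    cls (rotateLoop α s) = ((arc α s).symm.trans (cls α)).trans (arc α s) := by
  rw [arc_symm_trans_cls, rotateLoop, Path.Homotopic.Quotient.mk_trans, arc]

theorem arc_zero_conj {x y : Y} (f : Path x y) {s : I} (hs : s = 0) :
    ∃ h : f s = x, arc f s = (Path.Homotopic.Quotient.refl x).cast rfl h := by
  subst hs
  refine ⟨f.source, ?_⟩
  rw [arc, ← Path.Homotopic.Quotient.mk_refl, ← Path.Homotopic.Quotient.mk_cast]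
  congr 1
  ext t; simp

end Arcs

/-! ### The sampling functor from paths in `X` to edge paths. -/

section Sampling

open Path.Homotopic (Quotient)
open Path.Homotopic.Quotient renaming mk → cls

theorem exists_nhd_diam_lt {X : Type*} [MetricSpace X] {x y : X} (f : Path x y) {r : ℝ}
    (hr : 0 < r) (t : I) : ∃ W : Set I, IsOpen W ∧ t ∈ W ∧ ∀ a b, a ≤ b → Icc a b ⊆ W →
      Metric.diam (range (f.subpath a b)) < r := by
  refine ⟨f ⁻¹' Metric.ball (f t) (r / 3), Metric.isOpen_ball.preimage f.continuous,
    Metric.mem_ball_self (by positivity), fun a b hab hsub => ?_⟩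
  have h : range (f.subpath a b) ⊆ Metric.ball (f t) (r / 3) := by
    rw [Path.range_subpath_of_le _ _ _ hab]; exact image_subset_iff.2 hsub
  have := (Metric.diam_mono h Metric.isBounded_ball).trans (Metric.diam_ball (by positivity))
  linarith

theorem small_induction {X : Type*} [MetricSpace X] {r : ℝ} (hr : 0 < r)
    (P : ∀ x y : X, Quotient x y → Prop)
    (small : ∀ x y (f : Path x y), Metric.diam (range f) < r → P x y (cls f))
    (trans : ∀ x y z p q, P x y p → P y z q → P x z (p.trans q)) (x y : X) (q : Quotient x y) :
    P x y q := by
  induction q using Path.Homotopic.Quotient.ind with | mk f =>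
  refine seg_induction f P (fun a b c h1 h2 => ?_) fun t => ?_
  · rw [← seg_trans f a b c]; exact trans _ _ _ _ _ h1 h2
  · obtain ⟨W, hW, ht, h⟩ := exists_nhd_diam_lt f hr t
    exact ⟨W, hW, ht, fun a b hab hs => small _ _ _ (h a b hab hs)⟩

variable {X : Type*} [MetricSpace X] {r : ℝ}

open Classical in
theorem pair_mem_rips_of_dist (hr : 0 < r) {x y : X} (h : dist x y < r) :
    ({x, y} : Finset X) ∈ (rips X r hr).faces :=
  ⟨Finset.insert_nonempty _ _, by rwa [Finset.coe_pair, Metric.diam_pair]⟩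

open Classical in
theorem triple_mem_rips (hr : 0 < r) {x y z : X} (hxy : dist x y < r) (hyz : dist y z < r)
    (hxz : dist x z < r) : ({x, y, z} : Finset X) ∈ (rips X r hr).faces :=
  ⟨Finset.insert_nonempty _ _, by
    rw [Finset.coe_insert, Finset.coe_pair, Metric.diam_triple]
    exact max_lt (max_lt hxy hxz) hyz⟩

/-- The class of the edge from `x` to `y`. -/
noncomputable def ripsEdge (hr : 0 < r) {x y : X} (h : dist x y < r) :
    Quotient (Realization.vertex (rips X r hr) x) (Realization.vertex (rips X r hr) y) :=
  cls (edgePath (rips X r hr) (pair_mem_rips_of_dist hr h))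

theorem ripsEdge_trans (hr : 0 < r) {x y z : X} (hxy : dist x y < r) (hyz : dist y z < r)
    (hxz : dist x z < r) :
    (ripsEdge hr hxy).trans (ripsEdge hr hyz) = ripsEdge hr hxz := by
  classical
  rw [ripsEdge, ripsEdge, ripsEdge, ← Path.Homotopic.Quotient.mk_trans]
  refine Realization.cls_eq_of_support (triple_mem_rips hr hxy hyz hxz) _ _
    (fun t w hw => ?_) fun t w hw => ?_
  all_goals simp only [Finset.mem_insert, Finset.mem_singleton, not_or] at hw
  · exact trans_forall (P := fun a : Realization (rips X r hr) => a.coord w = 0) _ _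
      (fun t => edgePath_support _ t w (by simp [hw.1, hw.2.1]))
      (fun t => edgePath_support _ t w (by simp [hw.2.1, hw.2.2])) t
  · exact edgePath_support _ t w (by simp [hw.1, hw.2.2])

theorem ripsEdge_self (hr : 0 < r) {x : X} (h : dist x x < r) :
    ripsEdge hr h = Path.Homotopic.Quotient.refl _ := by
  have := ripsEdge_trans hr h h h
  calc ripsEdge hr h = (ripsEdge hr h).symm.trans ((ripsEdge hr h).trans (ripsEdge hr h)) := by
        rw [symm_trans_cancel]
    _ = _ := by rw [this]; simp

theorem dist_lt_of_diam_lt {x y : X} {f : Path x y} (h : Metric.diam (range f) < r) :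
    dist x y < r := by
  refine lt_of_le_of_lt (Metric.dist_le_diam_of_mem (isCompact_range f.continuous).isBounded
    ⟨0, f.source⟩ ⟨1, f.target⟩) h

theorem nonempty_vertex_path (hX : IsGeodesicSpace X) (hr : 0 < r) (x y : X) :
    Nonempty (Quotient (Realization.vertex (rips X r hr) x)
      (Realization.vertex (rips X r hr) y)) := by
  obtain ⟨f, -⟩ := hX x y
  exact small_induction hr (fun a b _ => Nonempty (Quotient (Realization.vertex (rips X r hr) a)
      (Realization.vertex (rips X r hr) b)))
    (fun a b f hf => ⟨ripsEdge hr (dist_lt_of_diam_lt hf)⟩)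
    (fun a b c _ _ p q => p.elim fun p => q.elim fun q => ⟨p.trans q⟩) x y (cls f)

/-- The cocycle of edge classes on the cover of `X` by balls. -/
theorem exists_sampling (hX : IsGeodesicSpace X) (p : X) (hr : 0 < r) :
    ∃ S : ∀ {x y : X}, Quotient x y → Quotient (Realization.vertex (rips X r hr) x)
        (Realization.vertex (rips X r hr) y),
      (∀ (x y z : X) (a : Quotient x y) (b : Quotient y z),
        S (a.trans b) = (S a).trans (S b)) ∧
      ∀ (x y : X) (f : Path x y) (h : Metric.diam (range f) < r),
        S (cls f) = ripsEdge hr (dist_lt_of_diam_lt h) := by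
  classical
  have c := fun x => (nonempty_vertex_path hX hr p x).some
  -- The product of the fundamental group is concatenation in reverse order; the opposite group
  -- restores the order of the holonomy.
  let G := (RipsGroup p r hr)ᵐᵒᵖ
  obtain ⟨op, unop, unop_op, opmul, unopmul⟩ : ∃ (op : Quotient (Realization.vertex (rips X r hr) p)
      (Realization.vertex (rips X r hr) p) → G) (unop : G → Quotient _ _),
      (∀ a, unop (op a) = a) ∧ (∀ a b, op a * op b = op (a.trans b)) ∧
      ∀ a b, unop (a * b) = (unop a).trans (unop b) :=
    ⟨fun a => MulOpposite.op a, fun a => MulOpposite.unop a, fun _ => rfl, fun _ _ => rfl,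
      fun _ _ => rfl⟩
  let g : X → X → G := fun x y => if h : dist x y < r then
    op (((c x).trans (ripsEdge hr h)).trans (c y).symm) else 1
  have gval : ∀ x y (h : dist x y < r), g x y =
      op (((c x).trans (ripsEdge hr h)).trans (c y).symm) := fun x y h => dif_pos h
  have gmul : ∀ x y z, dist x y < r → dist y z < r → dist x z < r → g x y * g y z = g x z := by
    intro x y z hxy hyz hxz
    rw [gval _ _ hxy, gval _ _ hyz, gval _ _ hxz, opmul, ← ripsEdge_trans hr hxy hyz hxz]
    simp only [Path.Homotopic.Quotient.trans_assoc, symm_trans_cancel]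
  -- With radius `r / 2`, the centres of balls sharing a point are pairwise at distance `< r` and
  -- span a simplex; this is what the cocycle identity needs.
  have hdist : ∀ x y z : X, z ∈ Metric.ball x (r / 2) → z ∈ Metric.ball y (r / 2) →
      dist x y < r := by
    intro x y z hx hy
    have := dist_triangle x z y
    rw [Metric.mem_ball, dist_comm] at hx
    rw [Metric.mem_ball] at hy
    linarith
  let C : GroupCocycle X X G :=
    { U := fun x => Metric.ball x (r / 2)
      isOpen_U := fun _ => Metric.isOpen_ball
      cover := fun y => ⟨y, Metric.mem_ball_self (by positivity)⟩
      g := g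
      mul := fun u v w y hu hv hw => gmul u v w (hdist u v y hu hv) (hdist v w y hv hw)
        (hdist u w y hu hw) }
  have hU : ∀ y, y ∈ C.U y := fun y => Metric.mem_ball_self (by positivity)
  obtain ⟨H, Htrans, Hloc, Hrefl⟩ := C.exists_holonomy
  refine ⟨fun {x y} q => ((c x).symm.trans (unop (H q x y))).trans (c y), ?_, ?_⟩
  · intro x y z a b
    dsimp only
    rw [Htrans x y z a b x y z (hU x) (hU y) (hU z)]
    rw [unopmul]
    simp only [Path.Homotopic.Quotient.trans_assoc, trans_symm_cancel]
  · intro x y f hf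
    have key : H (cls f) x y = g x y := by
      have hd : ∀ s t, dist (f s) (f t) < r := fun s t =>
        (Metric.dist_le_diam_of_mem (isCompact_range f.continuous).isBounded
          (mem_range_self s) (mem_range_self t)).trans_lt hf
      -- All points of `f` are within `r` of each other, so the edges between them multiply and the
      -- local statement adds up to the whole path.
      refine seg_induction f (fun a b q => H q a b = g a b) (fun a b c h1 h2 => ?_) fun t => ?_
      · rw [← seg_trans f a b c, Htrans _ _ _ _ _ _ (f b) _ (hU _) (hU _) (hU _), h1, h2,
          gmul _ _ _ (hd _ _) (hd _ _) (hd _ _)]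
      · refine ⟨f ⁻¹' Metric.ball (f t) (r / 2), Metric.isOpen_ball.preimage f.continuous,
          Metric.mem_ball_self (by positivity), fun a b hab hsub => ?_⟩
        have e : seg f a b = ((Path.Homotopic.Quotient.refl _).trans (seg f a b)).trans
          (Path.Homotopic.Quotient.refl _) := by simp
        have ha : f a ∈ C.U (f t) := hsub (left_mem_Icc.2 hab)
        have hb : f b ∈ C.U (f t) := hsub (right_mem_Icc.2 hab)
        rw [e, Htrans _ _ _ _ _ (f a) (f t) (f b) (hU _) hb (hU _),
          Htrans _ _ _ _ _ (f a) (f t) (f t) (hU _) ha hb, Hrefl _ _ _ (hU _) ha,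
          Hrefl _ _ _ hb (hU _), seg, Hloc, mul_one]
        · exact gmul _ _ _ (hd _ _) (hd _ _) (hd _ _)
        · exact subpath_forall f hab fun z hz => hsub hz
    dsimp only
    rw [key, gval _ _ (dist_lt_of_diam_lt hf)]
    simp only [unop_op, Path.Homotopic.Quotient.trans_assoc, symm_trans_cancel,
      Path.Homotopic.Quotient.symm_trans, Path.Homotopic.Quotient.trans_refl]

/-- The functor from the fundamental groupoid of `X` to that of `Rips(X, r)` that sends a path to
the class of any of its samples. -/
noncomputable def sampling (hX : IsGeodesicSpace X) (p : X) (hr : 0 < r) {x y : X}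
    (q : Quotient x y) : Quotient (Realization.vertex (rips X r hr) x)
      (Realization.vertex (rips X r hr) y) :=
  (exists_sampling hX p hr).choose q

variable (hX : IsGeodesicSpace X) (p : X) (hr : 0 < r)
include hX

theorem sampling_trans {x y z : X} (a : Quotient x y) (b : Quotient y z) :
    sampling hX p hr (a.trans b) = (sampling hX p hr a).trans (sampling hX p hr b) :=
  (exists_sampling hX p hr).choose_spec.1 x y z a b

theorem sampling_small {x y : X} (f : Path x y) (h : Metric.diam (range f) < r)
    (h' : dist x y < r) : sampling hX p hr (cls f) = ripsEdge hr h' :=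
  (exists_sampling hX p hr).choose_spec.2 x y f h

theorem sampling_refl (x : X) : sampling hX p hr (Path.Homotopic.Quotient.refl x) =
    Path.Homotopic.Quotient.refl _ := by
  rw [← ripsEdge_self hr (x := x) (by simpa using hr), ← Path.Homotopic.Quotient.mk_refl]
  exact sampling_small hX p hr _ (by simpa using hr) _

theorem sampling_symm {x y : X} (a : Quotient x y) :
    sampling hX p hr a.symm = (sampling hX p hr a).symm := by
  refine eq_symm_of_trans_eq_refl ?_
  rw [← sampling_trans, Path.Homotopic.Quotient.trans_symm, sampling_refl]

end Sampling

end RipsLoc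

namespace RipsLoc

/-! ### Length of paths -/

section Length

variable {X : Type*} [MetricSpace X]

theorem pathLength_symm {x y : X} (f : Path x y) : pathLength f.symm = pathLength f := by
  have h := eVariationOn.comp_eq_of_antitoneOn f (t := univ) σ
    (fun a _ b _ hab => unitInterval.symm_le_symm.2 hab)
  rw [image_univ, unitInterval.symm_bijective.surjective.range_eq] at h
  exact h

theorem pathLength_cast {x y x' y' : X} (f : Path x y) (hx : x' = x) (hy : y' = y) :
    pathLength (f.cast hx hy) = pathLength f := rfl

theorem pathLength_refl (x : X) : pathLength (Path.refl x) = 0 :=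
  eVariationOn.constant_on (by rintro _ ⟨a, -, rfl⟩ _ ⟨b, -, rfl⟩; rfl)

theorem pathLength_subpath {x y : X} (f : Path x y) {s t : I} (hst : s ≤ t) :
    pathLength (f.subpath s t) = eVariationOn f (Icc s t) := by
  have hst' : (s : ℝ) ≤ t := hst
  have hm : MonotoneOn (Icc.convexComb s t) univ := by
    intro a _ b _ hab
    have : (a : ℝ) ≤ b := hab
    change (Icc.convexComb s t a : ℝ) ≤ Icc.convexComb s t b
    rw [Icc.coe_convexComb, Icc.coe_convexComb]
    nlinarith
  have h := eVariationOn.comp_eq_of_monotoneOn f _ hm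
  rw [image_univ, Path.range_subpathAux, uIcc_of_le hst] at h
  exact h

theorem pathLength_trans {x y z : X} (f : Path x y) (g : Path y z) :
    pathLength (f.trans g) = pathLength f + pathLength g := by
  let h : I := ⟨1 / 2, by norm_num, by norm_num⟩
  have hu : (univ : Set I) = Iic h ∪ Ici h := Iic_union_Ici.symm
  rw [pathLength, hu, eVariationOn.union _ (x := h) isGreatest_Iic isLeast_Ici]
  congr 1
  · let φ : I → I := fun t => projIcc 0 1 zero_le_one (2 * (t : ℝ))
    have hφ : Monotone φ := fun a b hab => monotone_projIcc _
      (mul_le_mul_of_nonneg_left (show (a : ℝ) ≤ b from hab) zero_le_two)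
    have e : EqOn (f.trans g) (f ∘ φ) (Iic h) := fun t ht => by
      have ht' : (t : ℝ) ≤ 1 / 2 := ht
      change (if (t : ℝ) ≤ 1 / 2 then f.extend (2 * t) else g.extend (2 * t - 1)) = _
      rw [if_pos ht']; rfl
    rw [eVariationOn.congr e, eVariationOn.comp_eq_of_monotoneOn f φ (hφ.monotoneOn _)]
    congr 1
    refine eq_univ_of_forall fun u => ⟨⟨u / 2, ?_, ?_⟩, ?_, ?_⟩
    · linarith [u.2.1]
    · linarith [u.2.2]
    · change (u : ℝ) / 2 ≤ 1 / 2
      linarith [u.2.2]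
    · have : (2 * ((u : ℝ) / 2)) = u := by ring
      simp only [φ, this]
      exact projIcc_val _ u
  · let φ : I → I := fun t => projIcc 0 1 zero_le_one (2 * (t : ℝ) - 1)
    have hφ : Monotone φ := fun a b hab => monotone_projIcc _
      (sub_le_sub_right (mul_le_mul_of_nonneg_left (show (a : ℝ) ≤ b from hab) zero_le_two) 1)
    have e : EqOn (f.trans g) (g ∘ φ) (Ici h) := fun t ht => by
      have ht' : (1 : ℝ) / 2 ≤ t := ht
      change (if (t : ℝ) ≤ 1 / 2 then f.extend (2 * t) else g.extend (2 * t - 1)) = _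
      split_ifs with h1
      · have : (t : ℝ) = 1 / 2 := le_antisymm h1 ht'
        simp [φ, this]
      · rfl
    rw [eVariationOn.congr e, eVariationOn.comp_eq_of_monotoneOn g φ (hφ.monotoneOn _)]
    congr 1
    refine eq_univ_of_forall fun u => ⟨⟨(u + 1) / 2, ?_, ?_⟩, ?_, ?_⟩
    · linarith [u.2.1]
    · linarith [u.2.2]
    · change (1 : ℝ) / 2 ≤ (u + 1) / 2
      linarith [u.2.1]
    · have : (2 * (((u : ℝ) + 1) / 2) - 1) = u := by ring
      simp only [φ, this]
      exact projIcc_val _ u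

theorem edist_le_pathLength {x y : X} (f : Path x y) (s t : I) :
    edist (f s) (f t) ≤ pathLength f := eVariationOn.edist_le f (mem_univ s) (mem_univ t)

theorem ofReal_dist_le_pathLength {x y : X} (f : Path x y) :
    ENNReal.ofReal (dist x y) ≤ pathLength f := by
  have := edist_le_pathLength f 0 1
  rwa [f.source, f.target, edist_dist] at this

theorem diam_range_lt {x y : X} {f : Path x y} {r : ℝ} (h : pathLength f < ENNReal.ofReal r) :
    Metric.diam (range f) < r := by
  have hr : 0 < r := ENNReal.ofReal_pos.1 (bot_le.trans_lt h)
  have h1 : Metric.ediam (range f) ≤ pathLength f := by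
    refine Metric.ediam_le ?_
    rintro _ ⟨s, rfl⟩ _ ⟨t, rfl⟩
    exact edist_le_pathLength f s t
  rw [Metric.diam]
  exact (ENNReal.toReal_lt_of_lt_ofReal (h1.trans_lt h))

/-- The length of the initial arc of a rectifiable path. -/
noncomputable def arcLength {x y : X} (f : Path x y) (t : I) : ℝ := variationOnFromTo f univ 0 t

variable {x y : X} {f : Path x y}

theorem locallyBoundedVariationOn_of_pathLength (hf : pathLength f ≠ ∞) :
    LocallyBoundedVariationOn f univ :=
  BoundedVariationOn.locallyBoundedVariationOn (f := f) (s := univ) hf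

theorem arcLength_zero : arcLength f 0 = 0 := variationOnFromTo.self _ _ _

theorem arcLength_one : arcLength f 1 = (pathLength f).toReal := by
  rw [arcLength, variationOnFromTo.eq_of_le _ _ zero_le_one, pathLength]
  congr 2
  exact eq_univ_of_forall fun t => ⟨mem_univ _, t.2.1, t.2.2⟩

theorem arcLength_monotone (hf : pathLength f ≠ ∞) : Monotone (arcLength f) :=
  monotoneOn_univ.1
    (variationOnFromTo.monotoneOn (locallyBoundedVariationOn_of_pathLength hf) (mem_univ 0))

theorem arcLength_nonneg (t : I) : 0 ≤ arcLength f t :=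
  variationOnFromTo.nonneg_of_le _ _ t.2.1

theorem continuous_arcLength (hf : pathLength f ≠ ∞) : Continuous (arcLength f) := by
  have hl := locallyBoundedVariationOn_of_pathLength hf
  rw [continuous_iff_continuousAt]
  intro b
  rw [continuousAt_iff_continuous_left'_right']
  constructor
  · have := variationOnFromTo.tendsto_left (l := f b) (mem_univ 0) (mem_univ b) hl
      (f.continuous.continuousAt.mono_left nhdsWithin_le_nhds)
    rw [dist_self, sub_zero, univ_inter] at this
    exact this
  · have := variationOnFromTo.tendsto_right (l := f b) (mem_univ 0) (mem_univ b) hl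
      (f.continuous.continuousAt.mono_left nhdsWithin_le_nhds)
    rw [dist_self, add_zero, univ_inter] at this
    exact this

theorem pathLength_subpath_eq (hf : pathLength f ≠ ∞) {s t : I} (hst : s ≤ t) :
    pathLength (f.subpath s t) = ENNReal.ofReal (arcLength f t - arcLength f s) := by
  have hl := locallyBoundedVariationOn_of_pathLength hf
  rw [arcLength, arcLength, variationOnFromTo.sub_right hl (mem_univ _) (mem_univ _) (mem_univ _),
    variationOnFromTo.eq_of_le _ _ hst, univ_inter, pathLength_subpath f hst, ENNReal.ofReal_toReal]
  exact ne_top_of_le_ne_top hf (eVariationOn.mono _ (subset_univ _))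

theorem dist_le_arcLength (hf : pathLength f ≠ ∞) {s t : I} (hst : s ≤ t) :
    dist (f s) (f t) ≤ arcLength f t - arcLength f s := by
  have h := ofReal_dist_le_pathLength (f.subpath s t)
  rw [pathLength_subpath_eq hf hst] at h
  exact (ENNReal.ofReal_le_ofReal_iff (sub_nonneg.2 (arcLength_monotone hf hst))).1 h

/-- A rectifiable path has points at every intermediate length. -/
theorem exists_arcLength_eq (hf : pathLength f ≠ ∞) {l : ℝ} (h0 : 0 ≤ l)
    (h1 : l ≤ (pathLength f).toReal) : ∃ t, arcLength f t = l := by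
  have := intermediate_value_univ (0 : I) 1 (continuous_arcLength hf)
  rw [arcLength_zero, arcLength_one] at this
  exact this ⟨h0, h1⟩

theorem IsGeodesic.ne_top (hf : IsGeodesic f) : pathLength f ≠ ∞ := by
  rw [hf]; exact ENNReal.ofReal_ne_top

theorem IsGeodesic.symm (hf : IsGeodesic f) : IsGeodesic f.symm := by
  rw [IsGeodesic, pathLength_symm, hf, dist_comm]

/-- The three arcs cut off by `s` and `t` have total length `d(x, y)`, and none is shorter than its
chord; the triangle inequality forces equality in each. -/
theorem IsGeodesic.subpath (hf : IsGeodesic f) {s t : I} (hst : s ≤ t) :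
    IsGeodesic (f.subpath s t) ∧ dist (f s) (f t) = arcLength f t - arcLength f s := by
  have h1 := dist_le_arcLength hf.ne_top (f := f) (s := 0) (t := s) s.2.1
  have h2 := dist_le_arcLength hf.ne_top hst
  have h3 := dist_le_arcLength hf.ne_top (f := f) (s := t) (t := 1) t.2.2
  have h4 := dist_triangle4 (f 0) (f s) (f t) (f 1)
  rw [arcLength_zero] at h1
  rw [arcLength_one, hf, ENNReal.toReal_ofReal dist_nonneg] at h3
  rw [f.source, f.target] at h4
  rw [f.source] at h1
  rw [f.target] at h3
  have h5 : dist (f s) (f t) = arcLength f t - arcLength f s := by linarith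
  exact ⟨by rw [IsGeodesic, pathLength_subpath_eq hf.ne_top hst, h5], h5⟩

theorem isGeodesic_refl (x : X) : IsGeodesic (Path.refl x) := by
  rw [IsGeodesic, pathLength_refl, dist_self, ENNReal.ofReal_zero]

end Length

end RipsLoc

namespace RipsLoc

/-! ### Properties of sampling -/

section SamplingFacts

open Path.Homotopic (Quotient)
open Path.Homotopic.Quotient renaming mk → cls

variable {X : Type*} [MetricSpace X]

theorem cls_eq_of_seg {Y : Type*} [TopologicalSpace Y] {x y : Y} (f : Path x y)
    (P : ∀ a b : Y, Quotient a b → Prop) (h : P _ _ (seg f 0 1)) : P x y (cls f) := by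
  have aux : ∀ {a b : Y} (ha : a = x) (hb : b = y), P a b ((cls f).cast ha hb) →
      P x y (cls f) := by
    rintro _ _ rfl rfl h; rwa [Path.Homotopic.Quotient.cast_rfl_rfl] at h
  rw [seg_zero_one] at h
  exact aux _ _ h

theorem cls_rotateLoop_zero {x : X} (α : Path x x) {s : I} (hs : s = 0) (h : x = α s) :
    (cls (rotateLoop α s)).cast h h = cls α := by
  obtain ⟨h', e⟩ := arc_zero_conj α hs
  have aux : ∀ {a : X} (h : a = x) (q : Quotient x a) (e : q = (Path.Homotopic.Quotient.refl x).cast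
      rfl h), ((q.symm.trans (cls α)).trans q).cast h.symm h.symm = cls α := by
    rintro _ rfl q rfl
    simp [refl_symm]
  rw [cls_rotateLoop]
  exact aux h' _ e

theorem exists_loopSample {x : X} (α : Path x x) {δ : ℝ} (hδ : 0 < δ) :
    ∃ S : LoopSample α δ, S.t 0 = 0 := by
  have huc := CompactSpace.uniformContinuous_of_continuous α.continuous
  rw [Metric.uniformContinuous_iff] at huc
  obtain ⟨η, hη, h⟩ := huc (δ / 2) (half_pos hδ)
  obtain ⟨m, hm⟩ := exists_nat_one_div_lt hη
  have hm0 : (0 : ℝ) < m + 1 := by positivity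
  -- There are `m + 1` equal pieces but only the points `t 0, …, t m` are kept: `t (m + 1) = 1`
  -- gives the base point again, and the last piece becomes the wrap-around arc.
  let t : ℕ → I := fun i => projIcc 0 1 zero_le_one ((i : ℝ) / (m + 1))
  have ht : ∀ i : ℕ, i ≤ m + 1 → (t i : ℝ) = i / (m + 1) := by
    intro i hi
    have hi' : (i : ℝ) ≤ m + 1 := by exact_mod_cast hi
    have : (i : ℝ) / (m + 1) ∈ Icc (0 : ℝ) 1 :=
      ⟨by positivity, (div_le_one hm0).2 hi'⟩
    simp only [t]
    rw [projIcc_of_mem _ this]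
  have hd : ∀ i ≤ m, Metric.diam (α '' Icc (t i) (t (i + 1))) < δ := by
    intro i hi
    refine lt_of_le_of_lt (Metric.diam_le_of_forall_dist_le (half_pos hδ).le ?_) (half_lt_self hδ)
    rintro _ ⟨a, ha, rfl⟩ _ ⟨b, hb, rfl⟩
    refine (h ?_).le
    have h1 := ht i (by omega)
    have h2 := ht (i + 1) (by omega)
    have e : ((i + 1 : ℕ) : ℝ) / (m + 1) = i / (m + 1) + 1 / (m + 1) := by push_cast; ring
    have a1 : (t i : ℝ) ≤ a := ha.1
    have a2 : (a : ℝ) ≤ t (i + 1) := ha.2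
    have b1 : (t i : ℝ) ≤ b := hb.1
    have b2 : (b : ℝ) ≤ t (i + 1) := hb.2
    rw [Subtype.dist_eq, Real.dist_eq]
    refine lt_of_le_of_lt (abs_le.2 ⟨?_, ?_⟩) hm <;> linarith
  have t0 : t 0 = 0 := Subtype.ext (by rw [ht 0 (by omega)]; simp)
  have t1 : t (m + 1) = 1 := Subtype.ext (by
    rw [ht (m + 1) le_rfl]; push_cast; rw [div_self hm0.ne'])
  refine ⟨⟨m, t, fun i hi => ?_, fun i hi => hd i hi.le, ?_⟩, t0⟩
  · change (t i : ℝ) < t (i + 1)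
    rw [ht i (by omega), ht (i + 1) (by omega), div_lt_div_iff_of_pos_right hm0]
    push_cast
    linarith
  · have : α '' (Icc 0 (t 0) ∪ Icc (t m) 1) ⊆ α '' Icc (t m) (t (m + 1)) := by
      rw [t0, t1, Icc_self]
      rintro _ ⟨u, rfl | hu, rfl⟩
      · exact ⟨1, right_mem_Icc.2 (t m).2.2, by simp⟩
      · exact mem_image_of_mem α hu
    exact (Metric.diam_mono this ((isCompact_range α.continuous).isBounded.subset
      (image_subset_range _ _))).trans_lt (hd m le_rfl)

variable {r : ℝ} (hX : IsGeodesicSpace X) (p : X) (hr : 0 < r)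

theorem IsGeodesic.diam_lt {x y : X} {f : Path x y} (hf : IsGeodesic f) (h : dist x y < r) :
    Metric.diam (range f) < r := by
  refine diam_range_lt ?_
  rw [hf]
  exact (ENNReal.ofReal_lt_ofReal_iff (dist_nonneg.trans_lt h)).2 h

include hX in
theorem exists_geodesic_of_edge {x y : X} (h : dist x y < r) :
    ∃ f : Path x y, IsGeodesic f ∧ sampling hX p hr (cls f) = ripsEdge hr h := by
  obtain ⟨f, hf⟩ := hX x y
  exact ⟨f, hf, sampling_small hX p hr f (hf.diam_lt h) h⟩

theorem sampling_surjective {x y : X} (q : Quotient (Realization.vertex (rips X r hr) x)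
    (Realization.vertex (rips X r hr) y)) : ∃ a : Quotient x y, sampling hX p hr a = q := by
  classical
  refine Realization.edge_induction (fun x y q => ∃ a : Quotient x y, sampling hX p hr a = q)
    (fun x y h => ?_) ?_ x y q
  · have hd : dist x y < r := by
      have := h.2
      rwa [Finset.coe_pair, Metric.diam_pair] at this
    obtain ⟨f, -, hf⟩ := exists_geodesic_of_edge hX p hr hd
    exact ⟨cls f, hf⟩
  · rintro x y z _ _ ⟨a, rfl⟩ ⟨b, rfl⟩
    exact ⟨a.trans b, sampling_trans hX p hr a b⟩

theorem sampling_cast {x y x' y' : X} (q : Quotient x y) (hx : x' = x) (hy : y' = y) :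
    sampling hX p hr (q.cast hx hy) =
      (sampling hX p hr q).cast (by rw [hx]) (by rw [hy]) := by
  subst hx hy; simp

theorem sampling_edgeWalk {y : X} {α : Path y y} {δ : ℝ} (S : LoopSample α δ) (hδ : δ ≤ r) (n : ℕ)
    (hn : n ≤ S.m) (h : ∀ i < n, _) :
    cls (edgeWalk (rips X r hr) (fun i => α (S.t i)) n h) =
      sampling hX p hr (seg α (S.t 0) (S.t n)) := by
  classical
  induction n with
  | zero =>
    rw [edgeWalk, seg_self, sampling_refl, Path.Homotopic.Quotient.mk_refl]
  | succ n ih =>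
    have hle : S.t n ≤ S.t (n + 1) := (S.lt_succ n hn).le
    have hd : Metric.diam (range (α.subpath (S.t n) (S.t (n + 1)))) < r := by
      rw [Path.range_subpath_of_le _ _ _ hle]
      exact (S.diam_lt n hn).trans_le hδ
    rw [edgeWalk, Path.Homotopic.Quotient.mk_trans, ih (Nat.le_of_succ_le hn), ← seg_trans α _
        (S.t n) (S.t (n + 1)),
      sampling_trans]
    congr 1
    rw [seg, sampling_small hX p hr _ hd (dist_lt_of_diam_lt hd)]
    rfl

/-- Each arc of the sample has diameter `< r`, so `sampling` sends it to the corresponding edge. The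
polygonal loop therefore depends on the sample only through its starting point. -/
theorem cls_ripsLoop {y : X} {α : Path y y} {δ : ℝ} (S : LoopSample α δ) (hδ : δ ≤ r) :
    cls (S.ripsLoop hr hδ) = sampling hX p hr (cls (rotateLoop α (S.t 0))) := by
  classical
  -- The arc from `S.t S.m` through the base point to `S.t 0` gives the closing edge.
  have hw : Metric.diam (range (((α.subpath (S.t S.m) 1).cast rfl α.target.symm).trans
      ((α.subpath 0 (S.t 0)).cast α.source.symm rfl))) < r := by
    rw [Path.trans_range]
    refine lt_of_le_of_lt ?_ (S.diam_wrap.trans_le hδ)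
    refine (congrArg Metric.diam ?_).le
    have h1 := Path.range_subpath_of_le α (S.t S.m) 1 (S.t S.m).2.2
    have h2 := Path.range_subpath_of_le α 0 (S.t 0) (S.t 0).2.1
    rw [image_union, union_comm, ← h1, ← h2]
    rfl
  rw [LoopSample.ripsLoop, Path.Homotopic.Quotient.mk_trans, sampling_edgeWalk hX p hr S hδ S.m
      le_rfl]
  have key := sampling_small hX p hr _ hw (dist_lt_of_diam_lt hw)
  rw [Path.Homotopic.Quotient.mk_trans, ← arc_symm_trans_cls] at key
  have e : cls (rotateLoop α (S.t 0)) = (seg α (S.t 0) (S.t S.m)).trans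
      (((arc α (S.t S.m)).symm.trans (cls α)).trans (arc α (S.t 0))) := by
    rw [cls_rotateLoop, seg_eq_arc]
    simp only [Path.Homotopic.Quotient.trans_assoc, trans_symm_cancel]
  rw [e, sampling_trans]
  exact congrArg _ key.symm

/-- Sampling as a homomorphism of fundamental groups. -/
noncomputable def samplingHom : FundamentalGroup X p →* RipsGroup p r hr where
  toFun q := sampling hX p hr (show Quotient p p from q)
  map_one' := sampling_refl hX p hr p
  map_mul' a b := sampling_trans hX p hr (show Quotient p p from b) (show Quotient p p from a)

theorem samplingHom_apply (q : Quotient p p) :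
    samplingHom hX p hr (FundamentalGroup.fromPath q) = FundamentalGroup.fromPath (sampling hX p
        hr q) :=
  rfl

theorem samplingHom_surjective : Function.Surjective (samplingHom hX p hr) := fun q =>
  sampling_surjective hX p hr (show Quotient (Realization.vertex (rips X r hr) p)
    (Realization.vertex (rips X r hr) p) from q)

theorem ripsClass_eq {α : Path p p} (S : LoopSample α r) (h0 : S.t 0 = 0) :
    S.ripsClass hr h0 = samplingHom hX p hr (loopClass α) := by
  have h : p = α (S.t 0) := by rw [h0, α.source]
  rw [LoopSample.ripsClass, loopClass, loopClass, samplingHom_apply,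
      Path.Homotopic.Quotient.mk_cast,
    cls_ripsLoop hX p hr, ← cls_rotateLoop_zero α h0 h, sampling_cast]

/-- The map of fundamental groupoids induced by the inclusion of Rips complexes, on vertices. -/
noncomputable def ripsMap {a b : ℝ} (ha : 0 < a) (hab : a ≤ b) {x y : X}
    (q : Quotient (Realization.vertex (rips X a ha) x) (Realization.vertex (rips X a ha) y)) :
    Quotient (Realization.vertex (rips X b (ha.trans_le hab)) x)
      (Realization.vertex (rips X b (ha.trans_le hab)) y) :=
  q.map (Realization.incl (rips_mono X ha hab))

theorem bonding_apply {a b : ℝ} (ha : 0 < a) (hab : a ≤ b)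
    (q : Quotient (Realization.vertex (rips X a ha) p) (Realization.vertex (rips X a ha) p)) :
    bonding p ha hab (FundamentalGroup.fromPath q) =
      FundamentalGroup.fromPath (ripsMap ha hab q) := by
  rw [bonding, FundamentalGroup.mapOfEq_apply]
  exact Path.Homotopic.Quotient.cast_rfl_rfl _

theorem ripsMap_ripsEdge {a b : ℝ} (ha : 0 < a) (hab : a ≤ b) {x y : X} (h : dist x y < a)
    (h' : dist x y < b) :
    ripsMap ha hab (ripsEdge ha h) = ripsEdge (ha.trans_le hab) h' := rfl

theorem ripsMap_trans {a b : ℝ} (ha : 0 < a) (hab : a ≤ b) {x y z : X}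
    (q : Quotient (Realization.vertex (rips X a ha) x) (Realization.vertex (rips X a ha) y))
    (q' : Quotient (Realization.vertex (rips X a ha) y) (Realization.vertex (rips X a ha) z)) :
    ripsMap ha hab (q.trans q') = (ripsMap ha hab q).trans (ripsMap ha hab q') := by
  induction q using Path.Homotopic.Quotient.ind with | mk f =>
  induction q' using Path.Homotopic.Quotient.ind with | mk g =>
  exact congrArg cls (Path.map_trans f g (Realization.incl (rips_mono X ha hab)).continuous)

theorem ripsMap_sampling {a b : ℝ} (ha : 0 < a) (hab : a ≤ b) {x y : X} (q : Quotient x y) :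
    ripsMap ha hab (sampling hX p ha q) = sampling hX p (ha.trans_le hab) q := by
  refine small_induction ha (fun x y q => ripsMap ha hab (sampling hX p ha q) =
    sampling hX p (ha.trans_le hab) q) (fun x y f hf => ?_) (fun x y z q q' h h' => ?_) x y q
  · rw [sampling_small hX p ha f hf (dist_lt_of_diam_lt hf),
      sampling_small hX p _ f (hf.trans_le hab) (dist_lt_of_diam_lt (hf.trans_le hab)),
      ripsMap_ripsEdge]
  · rw [sampling_trans, sampling_trans, ripsMap_trans, h, h']

/-- With surjectivity of `samplingHom`, this allows kernels of bonding maps to be computed in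
`π₁(X)`. -/
theorem bonding_samplingHom {a b : ℝ} (ha : 0 < a) (hab : a ≤ b) (g : FundamentalGroup X p) :
    bonding p ha hab (samplingHom hX p ha g) = samplingHom hX p (ha.trans_le hab) g :=
  (bonding_apply p ha hab (sampling hX p ha (show Quotient p p from g))).trans
    (ripsMap_sampling hX p ha hab (show Quotient p p from g))

/-- Three arcs of equal length, each `< r`, sample to three edges with pairwise close vertices, so
the sample bounds a simplex. -/
theorem sampling_of_pathLength_lt {x : X} (f : Path x x)
    (hf : pathLength f < ENNReal.ofReal (3 * r)) :
    sampling hX p hr (cls f) = Path.Homotopic.Quotient.refl _ := by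
  have ht : pathLength f ≠ ∞ := hf.ne_top
  set L := (pathLength f).toReal with hL
  have hL0 : 0 ≤ L := ENNReal.toReal_nonneg
  have hLr : L < 3 * r := ENNReal.toReal_lt_of_lt_ofReal hf
  obtain ⟨t, e2⟩ := exists_arcLength_eq ht (l := 2 * L / 3) (by positivity) (by linarith)
  obtain ⟨s', e1'⟩ := exists_arcLength_eq ht (l := L / 3) (by positivity) (by linarith)
  -- The intermediate values come without an order. The minimum restores it, and monotonicity of arc
  -- length keeps the value `L / 3`.
  have hst : min s' t ≤ t := min_le_right _ _
  set s := min s' t with hs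
  have e1 : arcLength f s = L / 3 := by
    rw [hs, (arcLength_monotone ht).map_min, e1', e2]
    exact min_eq_left (by linarith)
  have d : ∀ {a b : I} (hab : a ≤ b), arcLength f b - arcLength f a < r →
      Metric.diam (range (f.subpath a b)) < r := fun {a b} hab h => by
    refine diam_range_lt ?_
    rw [pathLength_subpath_eq ht hab]
    exact (ENNReal.ofReal_lt_ofReal_iff hr).2 h
  have d1 := d (a := 0) (b := s) s.2.1 (by rw [arcLength_zero]; linarith)
  have d2 := d hst (by linarith)
  have d3 := d (a := t) (b := 1) t.2.2 (by rw [arcLength_one]; linarith)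
  have hd3 := dist_lt_of_diam_lt d3
  have h01 : f 1 = f 0 := by rw [f.source, f.target]
  have hd : dist (f 0) (f t) < r := by rw [← h01, dist_comm]; exact hd3
  have hd' : dist (f 0) (f 1) < r := by rw [h01, dist_self]; exact hr
  refine cls_eq_of_seg f (fun a b q => ∀ h : b = a, sampling hX p hr q =
    (Path.Homotopic.Quotient.refl _).cast rfl (by rw [h])) (fun h => ?_) rfl
  rw [← seg_trans f 0 s 1, ← seg_trans f s t 1, sampling_trans, sampling_trans, seg, seg, seg,
    sampling_small hX p hr _ d1 (dist_lt_of_diam_lt d1),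
    sampling_small hX p hr _ d2 (dist_lt_of_diam_lt d2), sampling_small hX p hr _ d3 hd3,
    ← Path.Homotopic.Quotient.trans_assoc,
    ripsEdge_trans hr _ _ hd, ripsEdge_trans hr _ _ hd']
  have aux : ∀ {a b : X} (h : b = a) (hab : dist a b < r), ripsEdge hr hab =
      (Path.Homotopic.Quotient.refl (Realization.vertex (rips X r hr) a)).cast rfl (by rw [h]) := by
    rintro a _ rfl h; rw [ripsEdge_self]; simp
  exact aux h hd'

theorem sampling_eq_of_pathLength_lt {x y : X} (f g : Path x y)
    (h : pathLength f + pathLength g < ENNReal.ofReal (3 * r)) :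
    sampling hX p hr (cls f) = sampling hX p hr (cls g) := by
  have := sampling_of_pathLength_lt hX p hr (f.trans g.symm)
    (by rwa [pathLength_trans, pathLength_symm])
  rw [Path.Homotopic.Quotient.mk_trans, Path.Homotopic.Quotient.mk_symm, sampling_trans,
    sampling_symm] at this
  have := eq_symm_of_trans_eq_refl this
  rw [← symm_symm (sampling hX p hr (cls f)), ← this, symm_symm]

end SamplingFacts

end RipsLoc

namespace RipsLoc

/-! ### Lassos modulo a normal subgroup -/

section Lassos

open Path.Homotopic (Quotient)
open Path.Homotopic.Quotient renaming mk → cls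

/-- A functor from the fundamental groupoid to a group. -/
structure PathLabel (Y G : Type*) [TopologicalSpace Y] [Group G] where
  map : ∀ {x y : Y}, Quotient x y → G
  map_trans : ∀ {x y z : Y} (q : Quotient x y) (q' : Quotient y z),
    map (q.trans q') = map q * map q'

namespace PathLabel

variable {Y G : Type*} [TopologicalSpace Y] [Group G] (ν : PathLabel Y G)

theorem map_refl (x : Y) : ν.map (Path.Homotopic.Quotient.refl x) = 1 := by
  have := ν.map_trans (Path.Homotopic.Quotient.refl x) (Path.Homotopic.Quotient.refl x)
  rw [Path.Homotopic.Quotient.trans_refl] at this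
  exact (left_eq_mul.1 this)

theorem map_symm {x y : Y} (q : Quotient x y) : ν.map q.symm = (ν.map q)⁻¹ := by
  refine eq_inv_of_mul_eq_one_left ?_
  rw [← ν.map_trans, Path.Homotopic.Quotient.symm_trans, ν.map_refl]

theorem map_cast {x y x' y' : Y} (q : Quotient x y) (hx : x' = x) (hy : y' = y) :
    ν.map (q.cast hx hy) = ν.map q := by
  subst hx hy; simp

theorem map_cls_cast {x y x' y' : Y} (f : Path x y) (hx : x' = x) (hy : y' = y) :
    ν.map (cls (f.cast hx hy)) = ν.map (cls f) := by
  rw [Path.Homotopic.Quotient.mk_cast, map_cast]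

theorem map_seg_zero_one {x y : Y} (f : Path x y) : ν.map (seg f 0 1) = ν.map (cls f) := by
  rw [seg_zero_one, map_cast]

theorem map_rotateLoop {X : Type*} [MetricSpace X] (ν : PathLabel X G) {x : X} (α : Path x x)
    (s : I) : ν.map (cls (rotateLoop α s)) =
      (ν.map (arc α s))⁻¹ * ν.map (cls α) * ν.map (arc α s) := by
  rw [cls_rotateLoop, map_trans, map_trans, map_symm]

end PathLabel

variable {X : Type*} [MetricSpace X] {p : X}

/-- The class of the lasso with the given path and loop. -/
noncomputable def lassoClass {y : X} (c : Quotient p y) (q : Quotient y y) :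
    FundamentalGroup X p := FundamentalGroup.fromPath ((c.trans q).trans c.symm)

theorem loopClass_lasso {y : X} (γ : Path p y) (β : Path y y) :
    loopClass (lasso γ β) = lassoClass (cls γ) (cls β) := rfl

theorem lassoClass_refl (q : Quotient p p) :
    lassoClass (Path.Homotopic.Quotient.refl p) q = FundamentalGroup.fromPath q := by
  rw [lassoClass, refl_symm]; simp

theorem lassoClass_conj {y : X} (c c' : Quotient p y) (q : Quotient y y) :
    lassoClass c' q = (FundamentalGroup.fromPath (c'.trans c.symm))⁻¹ * lassoClass c q *
      FundamentalGroup.fromPath (c'.trans c.symm) := by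
  change (c'.trans q).trans c'.symm = (c'.trans c.symm).trans
    (((c.trans q).trans c.symm).trans (c'.trans c.symm).symm)
  rw [trans_symm_rev, symm_symm]
  simp only [Path.Homotopic.Quotient.trans_assoc, symm_trans_cancel]

/-- Changing the tail of a lasso conjugates its class, which is why one lasso decides for all tails.
-/
theorem lassoClass_mem_of_normal {N : Subgroup (FundamentalGroup X p)} (hN : N.Normal) {y : X}
    (c c' : Quotient p y) {q : Quotient y y} (h : lassoClass c q ∈ N) : lassoClass c' q ∈ N := by
  rw [lassoClass_conj c c']
  simpa using hN.conj_mem _ h (FundamentalGroup.fromPath (c'.trans c.symm))⁻¹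

/-- Chosen tails from `p` close every path to a loop at `p`, whose class modulo `N` is functorial
since tails cancel. The opposite group accounts for the reversed product. -/
theorem exists_pathLabel.{u} {X : Type u} [MetricSpace X] {p : X} (hX : IsGeodesicSpace X) {N :
    Subgroup (FundamentalGroup X p)}
    (hN : N.Normal) : ∃ (G : Type u) (_ : Group G) (ν : PathLabel X G),
      ∀ {y : X} (c : Quotient p y) (q : Quotient y y), ν.map q = 1 ↔ lassoClass c q ∈ N := by
  let c : ∀ x, Quotient p x := fun x => cls (hX p x).choose
  let Q := FundamentalGroup X p ⧸ N
  let mk : Quotient p p → Qᵐᵒᵖ := fun q =>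
    MulOpposite.op (QuotientGroup.mk (FundamentalGroup.fromPath q) : Q)
  have hmk : ∀ a b, mk (a.trans b) = mk a * mk b := fun a b => rfl
  have hone : ∀ a, mk a = 1 ↔ FundamentalGroup.fromPath a ∈ N := fun a =>
    (MulOpposite.op_eq_one_iff _).trans (QuotientGroup.eq_one_iff _)
  refine ⟨Qᵐᵒᵖ, inferInstance, ⟨fun {x y} q => mk (((c x).trans q).trans (c y).symm), ?_⟩, ?_⟩
  · intro x y z q q'
    rw [← hmk]
    simp only [Path.Homotopic.Quotient.trans_assoc, symm_trans_cancel]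
  · intro y d q
    refine (hone _).trans ⟨fun h => ?_, fun h => ?_⟩
    · exact lassoClass_mem_of_normal hN (c y) d h
    · exact lassoClass_mem_of_normal hN d (c y) h

theorem closure_normal_of_conj {G : Type*} [Group G] {S : Set G}
    (h : ∀ g, ∀ x ∈ S, g * x * g⁻¹ ∈ S) : (Subgroup.closure S).Normal := by
  have : Subgroup.closure S = Subgroup.normalClosure S := by
    refine le_antisymm Subgroup.closure_le_normalClosure ?_
    refine (Subgroup.closure_le _).2 fun y hy => ?_
    obtain ⟨x, hx, hxy⟩ := Group.mem_conjugatesOfSet_iff.1 hy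
    obtain ⟨g, rfl⟩ := isConj_iff.1 hxy
    exact Subgroup.subset_closure (h g x hx)
  rw [this]
  infer_instance

-- Conjugation by a loop only lengthens the tail of a lasso and leaves its loop unchanged.
variable (p) in
theorem lassoSubgroup_normal (l : ℝ) : (lassoSubgroup p l).Normal := by
  refine closure_normal_of_conj ?_
  rintro g _ ⟨y, γ, β, hβ, rfl⟩
  obtain ⟨δ, hδ⟩ := Path.Homotopic.Quotient.mk_surjective (FundamentalGroup.toPath g)
  refine ⟨y, δ.symm.trans γ, β, hβ, ?_⟩
  have hg : g = FundamentalGroup.fromPath (cls δ) := by rw [hδ]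
  rw [loopClass_lasso, loopClass_lasso, hg, Path.Homotopic.Quotient.mk_trans,
    Path.Homotopic.Quotient.mk_symm, lassoClass_conj (cls γ) ((cls δ).symm.trans (cls γ)),
    Path.Homotopic.Quotient.trans_assoc, Path.Homotopic.Quotient.trans_symm,
    Path.Homotopic.Quotient.trans_refl]
  change _ = (FundamentalGroup.fromPath (cls δ))⁻¹⁻¹ * _ * (FundamentalGroup.fromPath (cls δ))⁻¹
  rw [inv_inv]

theorem lassoClass_mem_of_pathLength_lt {l : ℝ} {y : X} (c : Quotient p y) (β : Path y y)
    (hβ : pathLength β < ENNReal.ofReal l) : lassoClass c (cls β) ∈ lassoSubgroup p l := by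
  induction c using Path.Homotopic.Quotient.ind with | mk γ =>
  exact Subgroup.subset_closure ⟨y, γ, β, hβ, loopClass_lasso γ β⟩

variable {r : ℝ} (hX : IsGeodesicSpace X) (hr : 0 < r)

theorem samplingHom_lassoClass {y : X} (c : Quotient p y) (q : Quotient y y) :
    samplingHom hX p hr (lassoClass c q) = 1 ↔
      sampling hX p hr q = Path.Homotopic.Quotient.refl _ := by
  rw [lassoClass, samplingHom_apply, sampling_trans, sampling_trans, sampling_symm]
  change ((sampling hX p hr c).trans (sampling hX p hr q)).trans (sampling hX p hr c).symm =
    Path.Homotopic.Quotient.refl _ ↔ _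
  constructor
  · intro h
    have e := congrArg (fun z => ((sampling hX p hr c).symm.trans z).trans (sampling hX p hr c)) h
    simpa only [Path.Homotopic.Quotient.trans_assoc, symm_trans_cancel,
      Path.Homotopic.Quotient.symm_trans, Path.Homotopic.Quotient.trans_refl,
      Path.Homotopic.Quotient.refl_trans] using e
  · rintro h
    rw [h]; simp

theorem lassoSubgroup_le_ker : lassoSubgroup p (3 * r) ≤ (samplingHom hX p hr).ker := by
  refine (Subgroup.closure_le _).2 ?_
  rintro _ ⟨y, γ, β, hβ, rfl⟩
  rw [loopClass_lasso]
  exact (samplingHom_lassoClass hX hr _ _).2 (sampling_of_pathLength_lt hX p hr β hβ)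

end Lassos

end RipsLoc

namespace RipsLoc

/-! ### The kernel of attaching a disc -/

section DiscKernel

open Path.Homotopic (Quotient)
open Path.Homotopic.Quotient renaming mk → cls

theorem discBoundary_zero : discBoundary 0 = discBoundary 1 := by
  refine Subtype.ext ?_
  simp [discBoundary, Complex.exp_two_pi_mul_I]

theorem continuous_discBoundary : Continuous discBoundary := by
  unfold discBoundary
  fun_prop

/-- Polar coordinates on the closed unit disc. -/
noncomputable def discPolar (z : I × I) : Metric.closedBall (0 : ℂ) 1 :=
  ⟨(z.1 : ℝ) * (discBoundary z.2 : ℂ), by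
    rw [mem_closedBall_zero_iff, norm_mul, discBoundary, Complex.norm_exp_ofReal_mul_I, mul_one,
      Complex.norm_real, Real.norm_of_nonneg z.1.2.1]
    exact z.1.2.2⟩

theorem norm_discBoundary (t : I) : ‖(discBoundary t : ℂ)‖ = 1 :=
  Complex.norm_exp_ofReal_mul_I _

theorem norm_discPolar (z : I × I) : ‖(discPolar z : ℂ)‖ = z.1 := by
  rw [discPolar, norm_mul, norm_discBoundary, mul_one, Complex.norm_real,
    Real.norm_of_nonneg z.1.2.1]

theorem discPolar_one (t : I) : discPolar (1, t) = discBoundary t :=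
  Subtype.ext (by simp [discPolar])

theorem discBoundary_surjective {w : ℂ} (hw : ‖w‖ = 1) : ∃ t : I, (discBoundary t : ℂ) = w := by
  have hpi := Real.pi_pos
  have h0 : 0 ≤ toIcoMod Real.two_pi_pos 0 w.arg := left_le_toIcoMod _ _ _
  have h1 : toIcoMod Real.two_pi_pos 0 w.arg < 0 + 2 * Real.pi := toIcoMod_lt_right _ _ _
  refine ⟨⟨toIcoMod Real.two_pi_pos 0 w.arg / (2 * Real.pi), by positivity,
    (div_le_one Real.two_pi_pos).2 (by linarith)⟩, ?_⟩
  rw [discBoundary]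
  have e : 2 * Real.pi * (toIcoMod Real.two_pi_pos 0 w.arg / (2 * Real.pi)) =
      w.arg - toIcoDiv Real.two_pi_pos 0 w.arg • (2 * Real.pi) := by
    rw [mul_div_cancel₀ _ Real.two_pi_pos.ne']; rfl
  simp only [e]
  have e2 : ((w.arg - toIcoDiv Real.two_pi_pos 0 w.arg • (2 * Real.pi) : ℝ) : ℂ) * Complex.I =
      w.arg * Complex.I - toIcoDiv Real.two_pi_pos 0 w.arg * (2 * Real.pi * Complex.I) := by
    push_cast [zsmul_eq_mul]; ring
  rw [e2, Complex.exp_sub, Complex.exp_int_mul_two_pi_mul_I, div_one]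
  have := Complex.norm_mul_exp_arg_mul_I w
  rwa [hw, Complex.ofReal_one, one_mul] at this

theorem discPolar_surjective : Function.Surjective discPolar := by
  rintro ⟨w, hw⟩
  rw [mem_closedBall_zero_iff] at hw
  by_cases h : w = 0
  · exact ⟨(0, 0), Subtype.ext (by simp [discPolar, h])⟩
  · have hn : ‖w‖ ≠ 0 := norm_ne_zero_iff.2 h
    obtain ⟨t, ht⟩ := discBoundary_surjective (w := w / ‖w‖)
      (by rw [norm_div, Complex.norm_real, norm_norm, div_self hn])
    refine ⟨(⟨‖w‖, norm_nonneg w, hw⟩, t), Subtype.ext ?_⟩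
    simp only [discPolar, ht]
    exact mul_div_cancel₀ _ (Complex.ofReal_ne_zero.2 hn)

theorem discBoundary_eq {s t : I} (h : discBoundary s = discBoundary t) :
    s = t ∨ (s = 0 ∧ t = 1) ∨ (s = 1 ∧ t = 0) := by
  have h' := congrArg Subtype.val h
  simp only [discBoundary] at h'
  obtain ⟨n, hn⟩ := Complex.exp_eq_exp_iff_exists_int.1 h'
  have e : (s : ℝ) = t + n := by
    have h2 : (2 * Real.pi * Complex.I : ℂ) ≠ 0 := Complex.two_pi_I_ne_zero
    have h3 : ((s : ℝ) : ℂ) * (2 * Real.pi * Complex.I) =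
        (((t : ℝ) : ℂ) + n) * (2 * Real.pi * Complex.I) := by
      push_cast at hn
      linear_combination hn
    have := mul_right_cancel₀ h2 h3
    exact_mod_cast this
  have hs0 := s.2.1
  have hs1 := s.2.2
  have ht0 := t.2.1
  have ht1 := t.2.2
  have h1 : -1 ≤ n := by
    have : (-1 : ℝ) ≤ n := by linarith
    exact_mod_cast this
  have h2 : n ≤ 1 := by
    have : (n : ℝ) ≤ 1 := by linarith
    exact_mod_cast this
  interval_cases n
  · right; left
    push_cast at e
    exact ⟨Subtype.ext (by simp only [Icc.coe_zero]; linarith),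
      Subtype.ext (by simp only [Icc.coe_one]; linarith)⟩
  · left; exact Subtype.ext (by simpa using e)
  · right; right
    push_cast at e
    exact ⟨Subtype.ext (by simp only [Icc.coe_one]; linarith),
      Subtype.ext (by simp only [Icc.coe_zero]; linarith)⟩

theorem isQuotientMap_discPolar : IsQuotientMap discPolar := by
  have hc : Continuous discPolar := by
    unfold discPolar
    have := continuous_discBoundary
    fun_prop
  exact hc.isClosedMap.isQuotientMap hc discPolar_surjective

variable {Y : Type*} [TopologicalSpace Y] {y : Y}

/-- A null-homotopic loop extends to the disc. -/
theorem exists_disc_extension (l : Path y y) (h : cls l = Path.Homotopic.Quotient.refl y) :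
    ∃ e : C(Metric.closedBall (0 : ℂ) 1, Y), ∀ t, e (discBoundary t) = l t := by
  rw [← Path.Homotopic.Quotient.mk_refl] at h
  -- The homotopy starts at the constant path, so its time serves as the radius: it is constant at
  -- radius `0` and descends through polar coordinates.
  obtain ⟨H⟩ := Path.Homotopic.Quotient.eq.1 h.symm
  have hresp : ∀ a b : I × I, discPolar a = discPolar b → H a = H b := by
    rintro ⟨s, t⟩ ⟨s', t'⟩ hab
    have hs : s = s' := Subtype.ext (by
      rw [← norm_discPolar (s, t), ← norm_discPolar (s', t'), hab])
    subst hs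
    rcases eq_or_ne s 0 with rfl | hs
    · rw [H.apply_zero, H.apply_zero]; rfl
    · have hb : discBoundary t = discBoundary t' := by
        refine Subtype.ext ?_
        have h' := congrArg Subtype.val hab
        exact mul_left_cancel₀ (Complex.ofReal_ne_zero.2 fun h0 => hs (Subtype.ext h0)) h'
      rcases discBoundary_eq hb with rfl | ⟨rfl, rfl⟩ | ⟨rfl, rfl⟩
      · rfl
      · rw [H.source, H.target]
      · rw [H.source, H.target]
  refine ⟨isQuotientMap_discPolar.lift (f := ⟨discPolar, isQuotientMap_discPolar.continuous⟩)
    ⟨fun z => H z, H.continuous⟩ fun a b hab => hresp a b hab, fun t => ?_⟩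
  rw [← discPolar_one]
  have := congrArg (fun φ : C(I × I, Y) => φ (1, t)) (isQuotientMap_discPolar.lift_comp
    (f := ⟨discPolar, isQuotientMap_discPolar.continuous⟩) (⟨fun z => H z, H.continuous⟩ : C(I ×
        I, Y))
    fun a b hab => hresp a b hab)
  refine this.trans ?_
  exact H.apply_one t

/-- An extension of `l` over the disc gives a retraction of the adjunction space onto `Y`, so the
inclusion is injective on `π₁`. -/
theorem attachDisc_ker_eq_bot (l : Path y y) (h : cls l = Path.Homotopic.Quotient.refl y) (b : Y) :
    (FundamentalGroup.map (AttachDisc.incl l) b).ker = ⊥ := by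
  obtain ⟨e, he⟩ := exists_disc_extension l h
  let ρ : C(AttachDisc l, Y) :=
    ⟨Quot.lift (Sum.elim id e) (by rintro _ _ ⟨t⟩; exact he t),
      continuous_quot_lift _ (continuous_id.sumElim e.continuous)⟩
  rw [eq_bot_iff]
  intro q hq
  obtain ⟨f, hf⟩ := Path.Homotopic.Quotient.mk_surjective (FundamentalGroup.toPath q)
  have hq' : (cls f).map (AttachDisc.incl l) = Path.Homotopic.Quotient.refl _ := by
    rw [hf]; exact hq
  have h2 := congrArg (fun z => Path.Homotopic.Quotient.map z ρ) hq'
  have h3 : cls f = Path.Homotopic.Quotient.refl b := h2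
  exact hf.symm.trans h3

theorem attachDisc_map_eq_refl (l : Path y y) :
    (cls l).map (AttachDisc.incl l) = Path.Homotopic.Quotient.refl _ := by
  let j : C(Metric.closedBall (0 : ℂ) 1, AttachDisc l) :=
    ⟨fun z => Quot.mk _ (Sum.inr z), continuous_quot_mk.comp continuous_inr⟩
  have hj : ∀ t, j (discBoundary t) = AttachDisc.incl l (l t) := fun t =>
    Quot.sound (DiscGlue.glue t)
  let b : Path (discBoundary 0) (discBoundary 0) :=
    ⟨⟨discBoundary, continuous_discBoundary⟩, rfl, discBoundary_zero.symm⟩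
  have : ContractibleSpace (Metric.closedBall (0 : ℂ) 1) :=
    (convex_closedBall (0 : ℂ) 1).contractibleSpace ⟨0, by simp⟩
  have hb : cls b = Path.Homotopic.Quotient.refl _ := by
    rw [← Path.Homotopic.Quotient.mk_refl]
    exact Path.Homotopic.Quotient.eq.2 (SimplyConnectedSpace.paths_homotopic _ _)
  have h0 : AttachDisc.incl l y = j (discBoundary 0) := by rw [hj, l.source]
  have e1 : l.map (AttachDisc.incl l).continuous = (b.map j.continuous).cast h0 h0 := by
    ext t
    exact (hj t).symm
  have e2 : cls (b.map j.continuous) = Path.Homotopic.Quotient.refl _ :=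
    congrArg (fun z => Path.Homotopic.Quotient.map z j) hb
  have e3 : ∀ {a a' : AttachDisc l} (h : a = a'),
      (Path.Homotopic.Quotient.refl a').cast h h = Path.Homotopic.Quotient.refl a := by
    rintro _ _ rfl; simp
  calc (cls l).map (AttachDisc.incl l) = cls (l.map (AttachDisc.incl l).continuous) := rfl
    _ = _ := by rw [e1, Path.Homotopic.Quotient.mk_cast, e2, e3]

/-- The lasso around `l` with tail `d` is essential in `Y` and dies across the disc. -/
theorem attachDisc_ker_ne_bot (l : Path y y) (h : cls l ≠ Path.Homotopic.Quotient.refl y) {b : Y}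
    (d : Quotient b y) : (FundamentalGroup.map (AttachDisc.incl l) b).ker ≠ ⊥ := by
  intro hbot
  induction d using Path.Homotopic.Quotient.ind with | mk d =>
  let g : FundamentalGroup Y b := FundamentalGroup.fromPath (((cls d).trans (cls l)).trans (cls
      d).symm)
  have hg : g ∈ (FundamentalGroup.map (AttachDisc.incl l) b).ker := by
    rw [MonoidHom.mem_ker]
    change Path.Homotopic.Quotient.map (((cls d).trans (cls l)).trans (cls d).symm)
      (AttachDisc.incl l) = Path.Homotopic.Quotient.refl _
    rw [← Path.Homotopic.Quotient.mk_symm, ← Path.Homotopic.Quotient.mk_trans,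
      ← Path.Homotopic.Quotient.mk_trans]
    let d' := d.map (AttachDisc.incl l).continuous
    let l' := l.map (AttachDisc.incl l).continuous
    have hl : cls l' = Path.Homotopic.Quotient.refl _ := attachDisc_map_eq_refl l
    have e : ((d.trans l).trans d.symm).map (AttachDisc.incl l).continuous =
        (d'.trans l').trans d'.symm := by
      rw [Path.map_trans, Path.map_trans, Path.map_symm]
    change cls (((d.trans l).trans d.symm).map (AttachDisc.incl l).continuous) = _
    rw [e, Path.Homotopic.Quotient.mk_trans, Path.Homotopic.Quotient.mk_trans, hl,
      Path.Homotopic.Quotient.mk_symm]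
    simp
  rw [hbot, Subgroup.mem_bot] at hg
  have hg' : ((cls d).trans (cls l)).trans (cls d).symm = Path.Homotopic.Quotient.refl _ := hg
  refine h ?_
  have e := congrArg (fun z => ((cls d).symm.trans z).trans (cls d)) hg'
  simpa only [Path.Homotopic.Quotient.trans_assoc, symm_trans_cancel,
      Path.Homotopic.Quotient.symm_trans, Path.Homotopic.Quotient.trans_refl,
      Path.Homotopic.Quotient.refl_trans] using e

end DiscKernel

end RipsLoc

namespace RipsLoc

/-! ### Detecting classes with trivial sampling -/

section KerSampling

open Path.Homotopic (Quotient)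
open Path.Homotopic.Quotient renaming mk → cls

variable {X : Type*} [MetricSpace X] {G : Type*} [Group G] {r : ℝ}

theorem vertices_dist_lt (hr : 0 < r) {s : Finset X} (hs : s ∈ (rips X r hr).faces) {x y : X}
    (hx : x ∈ s) (hy : y ∈ s) : dist x y < r :=
  (Metric.dist_le_diam_of_mem s.finite_toSet.isBounded hx hy).trans_lt hs.2

/-- A labelling of edges that is multiplicative on triangles extends to path classes. -/
theorem exists_edge_holonomy (hr : 0 < r) (g : X → X → G)
    (hg : ∀ x y z, dist x y < r → dist y z < r → dist x z < r → g x y * g y z = g x z) :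
    ∃ Ψ : ∀ {x y : X}, Quotient (Realization.vertex (rips X r hr) x)
        (Realization.vertex (rips X r hr) y) → G,
      (∀ {x y z : X} (q : Quotient (Realization.vertex (rips X r hr) x)
        (Realization.vertex (rips X r hr) y)) (q' : Quotient (Realization.vertex (rips X r hr) y)
        (Realization.vertex (rips X r hr) z)), Ψ (q.trans q') = Ψ q * Ψ q') ∧
      ∀ {x y : X} (h : dist x y < r), Ψ (ripsEdge hr h) = g x y := by
  classical
  let K := rips X r hr
  -- The cover consists of the open stars. Vertices whose stars share a point span a face, so
  -- multiplicativity on triangles is the cocycle identity.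
  let C : GroupCocycle (Realization K) X G :=
    { U := fun v => {y | 0 < y.coord v}
      isOpen_U := fun v => isOpen_lt continuous_const (Realization.continuous_coord v)
      cover := fun y => y.exists_pos
      g := g
      mul := fun u v w y hu hv hw => by
        have hface : ({u, v, w} : Finset X) ∈ K.faces := by
          refine y.mem_faces_of_pos _ (Finset.insert_nonempty _ _) fun a ha => ?_
          simp only [Finset.mem_insert, Finset.mem_singleton] at ha
          rcases ha with rfl | rfl | rfl <;> assumption
        exact hg u v w (vertices_dist_lt hr hface (by simp) (by simp))
          (vertices_dist_lt hr hface (by simp) (by simp))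
          (vertices_dist_lt hr hface (by simp) (by simp)) }
  obtain ⟨H, Htrans, Hloc, Hrefl⟩ := C.exists_holonomy
  have hv : ∀ x, Realization.vertex K x ∈ C.U x := fun x => Realization.vertex_pos x
  refine ⟨fun {x y} q => H q x y, fun {x y z} q q' => ?_, fun {x y} h => ?_⟩
  · exact Htrans _ _ _ q q' x y z (hv x) (hv y) (hv z)
  · set e := edgePath K (pair_mem_rips_of_dist hr h) with he
    have hval : ∀ (t : I) (v : X), (e t).coord v =
        (1 - (t : ℝ)) * (Pi.single x 1 : X → ℝ) v + t * (Pi.single y 1 : X → ℝ) v :=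
      fun t v => rfl
    have hs : ∀ u v : X, 0 ≤ (Pi.single u 1 : X → ℝ) v := fun u v => by
      rw [Pi.single_apply]; split_ifs <;> norm_num
    have hx : ∀ t : I, (t : ℝ) < 1 → 0 < (e t).coord x := fun t ht => by
      rw [hval, Pi.single_eq_same]
      have := mul_nonneg t.2.1 (hs y x)
      linarith
    have hy : ∀ t : I, 0 < (t : ℝ) → 0 < (e t).coord y := fun t ht => by
      rw [hval, Pi.single_eq_same]
      have := mul_nonneg (sub_nonneg.2 t.2.2) (hs x y)
      linarith
    -- The first half of the edge lies in the star of `x` and the second in the star of `y`; the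
    -- chart change at the midpoint contributes `g x y`.
    let m : I := ⟨1 / 2, by norm_num, by norm_num⟩
    have hm0 : (0 : I) ≤ m := m.2.1
    have hm1 : m ≤ 1 := m.2.2
    have hm : (m : ℝ) = 1 / 2 := rfl
    have hmx : e m ∈ C.U x := hx m (by rw [hm]; norm_num)
    have hmy : e m ∈ C.U y := hy m (by rw [hm]; norm_num)
    refine cls_eq_of_seg e (fun a b q => H q x y = g x y) ?_
    have e1 : seg e 0 1 = (seg e 0 m).trans ((Path.Homotopic.Quotient.refl _).trans (seg e m 1))
        := by
      rw [Path.Homotopic.Quotient.refl_trans, seg_trans]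
    have h0 : e 0 ∈ C.U x := hx 0 (by simp)
    have h1 : e 1 ∈ C.U y := hy 1 (by simp)
    rw [e1, Htrans _ _ _ _ _ x x y h0 hmx h1, Htrans _ _ _ _ _ x y y hmx hmy h1,
      Hrefl _ _ _ hmx hmy, seg, seg, Hloc, Hloc, one_mul, mul_one]
    · exact subpath_forall (P := fun a => a ∈ C.U y) e hm1 fun u hu => hy u (by
        have : (m : ℝ) ≤ u := hu.1
        rw [hm] at this; linarith)
    · exact subpath_forall (P := fun a => a ∈ C.U x) e hm0 fun u hu => hx u (by
        have : (u : ℝ) ≤ m := hu.2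
        rw [hm] at this; linarith)

/-- A label that is trivial on geodesic triangles is independent of the choice of geodesics. -/
theorem label_geodesic_eq (ν : PathLabel X G)
    (tri : ∀ x y z (f : Path x y) (g : Path y z) (k : Path z x), IsGeodesic f → IsGeodesic g →
      IsGeodesic k → dist x y < r → dist y z < r → dist z x < r →
      ν.map (cls f) * ν.map (cls g) * ν.map (cls k) = 1) {x y : X} {f g : Path x y}
    (hf : IsGeodesic f) (hg : IsGeodesic g) (h : dist x y < r) :
    ν.map (cls f) = ν.map (cls g) := by
  have := tri x y y f (Path.refl y) g.symm hf (isGeodesic_refl y) hg.symm h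
    (by rw [dist_self]; exact dist_nonneg.trans_lt h) (by rwa [dist_comm])
  rw [Path.Homotopic.Quotient.mk_refl, ν.map_refl, mul_one, Path.Homotopic.Quotient.mk_symm,
    ν.map_symm, mul_inv_eq_one] at this
  exact this

/-- Geodesic labels extend to a label `Ψ` of edge paths, and `Ψ ∘ sampling` agrees with `ν` on `f`.
The hypothesis `loc` is needed because a short arc of a general path need not be homotopic to a
geodesic. -/
theorem label_eq_one_of_sampling (hX : IsGeodesicSpace X) (p : X) (hr : 0 < r)
    (ν : PathLabel X G)
    (tri : ∀ x y z (f : Path x y) (g : Path y z) (k : Path z x), IsGeodesic f → IsGeodesic g →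
      IsGeodesic k → dist x y < r → dist y z < r → dist z x < r →
      ν.map (cls f) * ν.map (cls g) * ν.map (cls k) = 1)
    {x : X} (f : Path x x)
    (loc : ∀ t : I, ∃ W : Set I, IsOpen W ∧ t ∈ W ∧ ∀ a b, a ≤ b → Icc a b ⊆ W →
      ∃ g : Path (f a) (f b), IsGeodesic g ∧ ν.map (seg f a b) = ν.map (cls g))
    (hs : sampling hX p hr (cls f) = Path.Homotopic.Quotient.refl _) : ν.map (cls f) = 1 := by
  let g : X → X → G := fun x y => ν.map (cls (hX x y).choose)
  have hgeq : ∀ {x y : X} (f : Path x y), IsGeodesic f → dist x y < r → ν.map (cls f) = g x y :=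
    fun f hf h => label_geodesic_eq ν tri hf (hX _ _).choose_spec h
  obtain ⟨Ψ, Ψtrans, Ψedge⟩ := exists_edge_holonomy hr g (fun x y z hxy hyz hxz => by
    have := tri x y z (hX x y).choose (hX y z).choose (hX x z).choose.symm (hX x y).choose_spec
      (hX y z).choose_spec (hX x z).choose_spec.symm hxy hyz (by rwa [dist_comm])
    rwa [Path.Homotopic.Quotient.mk_symm, ν.map_symm, mul_inv_eq_one] at this)
  have key : Ψ (sampling hX p hr (cls f)) = ν.map (cls f) := by
    refine seg_induction f (fun a b q => Ψ (sampling hX p hr q) = ν.map q)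
      (fun a b c h1 h2 => ?_) fun t => ?_
    · rw [← seg_trans f a b c, sampling_trans, Ψtrans, ν.map_trans, h1, h2]
    · obtain ⟨W, hWo, htW, hW⟩ := loc t
      obtain ⟨W', hWo', htW', hW'⟩ := exists_nhd_diam_lt f hr t
      refine ⟨W ∩ W', hWo.inter hWo', ⟨htW, htW'⟩, fun a b hab hsub => ?_⟩
      obtain ⟨k, hk, hk'⟩ := hW a b hab (hsub.trans inter_subset_left)
      have hd := hW' a b hab (hsub.trans inter_subset_right)
      rw [hk', hgeq k hk (dist_lt_of_diam_lt hd), seg,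
        sampling_small hX p hr _ hd (dist_lt_of_diam_lt hd), Ψedge]
  have h1 : Ψ (Path.Homotopic.Quotient.refl (Realization.vertex (rips X r hr) x)) = 1 := by
    have := Ψtrans (Path.Homotopic.Quotient.refl (Realization.vertex (rips X r hr) x))
      (Path.Homotopic.Quotient.refl _)
    rw [Path.Homotopic.Quotient.trans_refl] at this
    exact left_eq_mul.1 this
  rw [← key, hs, h1]

end KerSampling

end RipsLoc

namespace RipsLoc

/-! ### Critical triangles -/

section CriticalTriangles

open Path.Homotopic (Quotient)
open Path.Homotopic.Quotient renaming mk → cls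

variable {X : Type*} [MetricSpace X] {r : ℝ} (hX : IsGeodesicSpace X) (p : X) (hr : 0 < r)

theorem sampling_rotateLoop {y : X} (α : Path y y) (s : I) :
    sampling hX p hr (cls (rotateLoop α s)) = Path.Homotopic.Quotient.refl _ ↔
      sampling hX p hr (cls α) = Path.Homotopic.Quotient.refl _ := by
  rw [cls_rotateLoop, sampling_trans, sampling_trans, sampling_symm]
  constructor
  · intro h
    have e := congrArg (fun z => ((sampling hX p hr (arc α s)).trans z).trans
      (sampling hX p hr (arc α s)).symm) h
    simpa only [Path.Homotopic.Quotient.trans_assoc, trans_symm_cancel,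
      Path.Homotopic.Quotient.trans_symm, Path.Homotopic.Quotient.trans_refl,
      Path.Homotopic.Quotient.refl_trans] using e
  · intro h
    rw [h]; simp

theorem attachDisc_ker_ne_bot_iff {y : X} {α : Path y y} {δ : ℝ} (S : LoopSample α δ)
    (hδ : δ ≤ r) :
    (FundamentalGroup.map (AttachDisc.incl (S.ripsLoop hr hδ))
        (Realization.vertex (rips X r hr) p)).ker ≠ ⊥ ↔
      sampling hX p hr (cls α) ≠ Path.Homotopic.Quotient.refl _ := by
  refine Iff.trans ?_ (not_congr (sampling_rotateLoop hX p hr α (S.t 0)))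
  rw [← cls_ripsLoop hX p hr S hδ]
  constructor
  · intro h h'
    exact h (attachDisc_ker_eq_bot _ h' _)
  · intro h
    obtain ⟨d⟩ := nonempty_vertex_path hX hr p (α (S.t 0))
    exact attachDisc_ker_ne_bot _ h d

theorem IsFilling.pathLength_eq {x₁ x₂ x₃ : X} {α : Path x₁ x₁} (h : IsFilling x₂ x₃ α) :
    pathLength α = ENNReal.ofReal (dist x₁ x₂ + dist x₂ x₃ + dist x₃ x₁) := by
  obtain ⟨g₁, g₂, g₃, h₁, h₂, h₃, rfl⟩ := h
  rw [pathLength_trans, pathLength_trans, h₁, h₂, h₃, ENNReal.ofReal_add (by positivity) (by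
      positivity),
    ENNReal.ofReal_add (by positivity) (by positivity)]

/-- The bigon has length at most `2r < 3r`; hence distance exactly `r` is allowed. -/
theorem sampling_geodesic_eq {x y : X} {f g : Path x y} (hf : IsGeodesic f) (hg : IsGeodesic g)
    (h : dist x y ≤ r) : sampling hX p hr (cls f) = sampling hX p hr (cls g) := by
  refine sampling_eq_of_pathLength_lt hX p hr f g ?_
  rw [hf, hg, ← ENNReal.ofReal_add dist_nonneg dist_nonneg]
  exact (ENNReal.ofReal_lt_ofReal_iff (by positivity)).2 (by linarith)

theorem sampling_filling_eq {x₁ x₂ x₃ : X} {α β : Path x₁ x₁} (hα : IsFilling x₂ x₃ α)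
    (hβ : IsFilling x₂ x₃ β) (h₁₂ : dist x₁ x₂ ≤ r) (h₂₃ : dist x₂ x₃ ≤ r) (h₃₁ : dist x₃ x₁ ≤ r) :
    sampling hX p hr (cls α) = sampling hX p hr (cls β) := by
  obtain ⟨f₁, f₂, f₃, hf₁, hf₂, hf₃, rfl⟩ := hα
  obtain ⟨g₁, g₂, g₃, hg₁, hg₂, hg₃, rfl⟩ := hβ
  simp only [Path.Homotopic.Quotient.mk_trans, sampling_trans]
  rw [sampling_geodesic_eq hX p hr hf₁ hg₁ h₁₂, sampling_geodesic_eq hX p hr hf₂ hg₂ h₂₃,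
    sampling_geodesic_eq hX p hr hf₃ hg₃ h₃₁]

theorem dist_eq_of_sampling_ne {x₁ x₂ x₃ : X} {α : Path x₁ x₁} (hα : IsFilling x₂ x₃ α)
    (h₁₂ : dist x₁ x₂ ≤ r) (h₂₃ : dist x₂ x₃ ≤ r) (h₃₁ : dist x₃ x₁ ≤ r)
    (h : sampling hX p hr (cls α) ≠ Path.Homotopic.Quotient.refl _) :
    dist x₁ x₂ = r ∧ dist x₂ x₃ = r ∧ dist x₃ x₁ = r := by
  have : ¬ dist x₁ x₂ + dist x₂ x₃ + dist x₃ x₁ < 3 * r := fun hlt => by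
    refine h (sampling_of_pathLength_lt hX p hr α ?_)
    rw [hα.pathLength_eq]
    exact (ENNReal.ofReal_lt_ofReal_iff (by positivity)).2 hlt
  refine ⟨?_, ?_, ?_⟩ <;> linarith

/-- Discs and `(r/2)`-samples disappear: the kernel detects whether the attaching loop is essential,
and every sample of a filling gives the same answer. -/
theorem isCriticalTriangle_iff {x₁ x₂ x₃ : X} : IsCriticalTriangle p r hr x₁ x₂ x₃ ↔
    dist x₁ x₂ = r ∧ dist x₂ x₃ = r ∧ dist x₃ x₁ = r ∧ ∃ α : Path x₁ x₁, IsFilling x₂ x₃ α ∧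
      sampling hX p hr (cls α) ≠ Path.Homotopic.Quotient.refl _ := by
  classical
  constructor
  · rintro ⟨hface, -, -, -, α, hα, S, hS⟩
    have hd := hface.2
    rw [Finset.coe_insert, Finset.coe_pair, Metric.diam_triple] at hd
    have hS' := (attachDisc_ker_ne_bot_iff hX p hr S _).1 hS
    have h := dist_eq_of_sampling_ne hX p hr hα
      ((le_max_left _ _).trans ((le_max_left _ _).trans hd)) ((le_max_right _ _).trans hd)
      (by rw [dist_comm]; exact (le_max_right _ _).trans ((le_max_left _ _).trans hd)) hS'
    exact ⟨h.1, h.2.1, h.2.2, α, hα, hS'⟩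
  · rintro ⟨h₁₂, h₂₃, h₃₁, α, hα, h⟩
    have hne : ∀ {x y : X}, dist x y = r → x ≠ y := fun h => dist_pos.1 (h ▸ hr)
    obtain ⟨S, -⟩ := exists_loopSample α (half_pos hr)
    refine ⟨⟨Finset.insert_nonempty _ _, ?_⟩, hne h₁₂, hne h₂₃, hne h₃₁, α, hα, S,
      (attachDisc_ker_ne_bot_iff hX p hr S _).2 h⟩
    rw [Finset.coe_insert, Finset.coe_pair, Metric.diam_triple]
    exact max_le (max_le h₁₂.le (by rw [dist_comm, h₃₁])) h₂₃.le

theorem criticalTriangle_filling {x₁ x₂ x₃ : X} (h : IsCriticalTriangle p r hr x₁ x₂ x₃)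
    {α : Path x₁ x₁} (hα : IsFilling x₂ x₃ α) : pathLength α = ENNReal.ofReal (3 * r) ∧
      sampling hX p hr (cls α) ≠ Path.Homotopic.Quotient.refl _ := by
  obtain ⟨h₁₂, h₂₃, h₃₁, β, hβ, hs⟩ := (isCriticalTriangle_iff hX p hr).1 h
  refine ⟨?_, ?_⟩
  · rw [hα.pathLength_eq, h₁₂, h₂₃, h₃₁]
    congr 1; ring
  · rwa [sampling_filling_eq hX p hr hα hβ h₁₂.le h₂₃.le h₃₁.le]

theorem lasso_notMem_of_sampling_ne {y : X} (α : Path y y)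
    (h : sampling hX p hr (cls α) ≠ Path.Homotopic.Quotient.refl _) (s : I) (γ : Path p (α s)) :
    loopClass (lasso γ (rotateLoop α s)) ∉ lassoSubgroup p (3 * r) := by
  intro hmem
  have := lassoSubgroup_le_ker hX hr hmem
  rw [MonoidHom.mem_ker, loopClass_lasso, samplingHom_lassoClass, sampling_rotateLoop] at this
  exact h this

end CriticalTriangles

end RipsLoc

namespace RipsLoc

/-! ### Kernels of bonding maps -/

section BondingKernel

open Path.Homotopic (Quotient)
open Path.Homotopic.Quotient renaming mk → cls

theorem exists_conj_lasso {X : Type*} [MetricSpace X] {p y : X} (g : FundamentalGroup X p)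
    (c : Quotient p y) : ∃ c' : Quotient p y, ∀ q, g * lassoClass c q * g⁻¹ = lassoClass c' q := by
  refine ⟨(show Quotient p p from g).symm.trans c, fun q => ?_⟩
  rw [lassoClass_conj c ((show Quotient p p from g).symm.trans c),
    Path.Homotopic.Quotient.trans_assoc, Path.Homotopic.Quotient.trans_symm,
    Path.Homotopic.Quotient.trans_refl]
  change _ = g⁻¹⁻¹ * _ * g⁻¹
  rw [inv_inv]

theorem lassoClass_cast {X : Type*} [MetricSpace X] {p y z : X} (c : Quotient p y)
    (q : Quotient z z) (h : z = y) :
    lassoClass (c.cast rfl h) q = lassoClass c (q.cast h.symm h.symm) := by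
  subst h; simp

variable {X : Type*} [MetricSpace X] {r : ℝ} (hX : IsGeodesicSpace X) (p : X) (hr : 0 < r)

/-- The classes of samples of lassos around fillings of critical triangles. -/
def criticalLassos : Set (RipsGroup p r hr) :=
  {g | ∃ x₁ x₂ x₃ : X, IsCriticalTriangle p r hr x₁ x₂ x₃ ∧
    ∃ α : Path x₁ x₁, IsFilling x₂ x₃ α ∧ ∃ (s : I) (γ : Path p (α s))
      (S : LoopSample (lasso γ (rotateLoop α s)) r) (h0 : S.t 0 = 0), g = S.ripsClass hr h0}

theorem samplingHom_mem_criticalLassos {x₁ x₂ x₃ : X} (h : IsCriticalTriangle p r hr x₁ x₂ x₃)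
    {α : Path x₁ x₁} (hα : IsFilling x₂ x₃ α) (s : I) (c : Quotient p (α s)) :
    samplingHom hX p hr (lassoClass c (cls (rotateLoop α s))) ∈ criticalLassos p hr := by
  induction c using Path.Homotopic.Quotient.ind with | mk γ =>
  obtain ⟨S, h0⟩ := exists_loopSample (lasso γ (rotateLoop α s)) hr
  exact ⟨x₁, x₂, x₃, h, α, hα, s, γ, S, h0, by rw [ripsClass_eq hX p hr S h0, loopClass_lasso]⟩

theorem samplingHom_filling_mem {x₁ x₂ x₃ : X} (h : IsCriticalTriangle p r hr x₁ x₂ x₃)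
    {α : Path x₁ x₁} (hα : IsFilling x₂ x₃ α) (c : Quotient p x₁) :
    samplingHom hX p hr (lassoClass c (cls α)) ∈ Subgroup.closure (criticalLassos p hr) := by
  have e : x₁ = α 0 := α.source.symm
  have := samplingHom_mem_criticalLassos hX p hr h hα 0 (c.cast rfl e.symm)
  rw [lassoClass_cast, cls_rotateLoop_zero α rfl] at this
  exact Subgroup.subset_closure this

include hX in
theorem criticalLassos_normal : (Subgroup.closure (criticalLassos p hr)).Normal := by
  refine closure_normal_of_conj ?_
  rintro g _ ⟨x₁, x₂, x₃, h, α, hα, s, γ, S, h0, rfl⟩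
  obtain ⟨g, rfl⟩ := samplingHom_surjective hX p hr g
  obtain ⟨c, hc⟩ := exists_conj_lasso g (cls γ)
  rw [ripsClass_eq hX p hr S h0, ← map_inv, ← map_mul, ← map_mul, loopClass_lasso, hc]
  exact samplingHom_mem_criticalLassos hX p hr h hα s c

/-- Fillings of critical triangles have length `3r < 3r'`. -/
theorem criticalLassos_le_ker (hX : IsGeodesicSpace X) {r' : ℝ} (h : r < r') :
    Subgroup.closure (criticalLassos p hr) ≤ (bonding p hr h.le).ker := by
  refine (Subgroup.closure_le _).2 ?_
  rintro _ ⟨x₁, x₂, x₃, hc, α, hα, s, γ, S, h0, rfl⟩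
  have hl := (criticalTriangle_filling hX p hr hc hα).1
  rw [SetLike.mem_coe, MonoidHom.mem_ker, ripsClass_eq hX p hr S h0, bonding_samplingHom,
    loopClass_lasso, samplingHom_lassoClass, sampling_rotateLoop]
  refine sampling_of_pathLength_lt hX p _ α ?_
  rw [hl]
  exact (ENNReal.ofReal_lt_ofReal_iff (by linarith)).2 (by linarith)

/-! ### Labels that vanish on loops with trivial sample at scale `r`. -/

section Label

variable {G : Type*} [Group G] {ν : PathLabel X G}

theorem label_eq_of_sampling_eq
    (h1 : ∀ (x : X) (q : Quotient x x),
      sampling hX p hr q = Path.Homotopic.Quotient.refl _ → ν.map q = 1)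
    {x y : X} {q q' : Quotient x y} (h : sampling hX p hr q = sampling hX p hr q') :
    ν.map q = ν.map q' := by
  have := h1 x (q.trans q'.symm) (by rw [sampling_trans, sampling_symm, h]; simp)
  rwa [ν.map_trans, ν.map_symm, mul_inv_eq_one] at this

variable (ν) in
/-- The label of a geodesic. -/
noncomputable def edgeLabel (x y : X) : G := ν.map (cls (hX x y).choose)

variable (h1 : ∀ (x : X) (q : Quotient x x),
  sampling hX p hr q = Path.Homotopic.Quotient.refl _ → ν.map q = 1)
include h1

theorem label_geodesic {x y : X} {f : Path x y} (hf : IsGeodesic f) (h : dist x y ≤ r) :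
    ν.map (cls f) = edgeLabel hX ν x y :=
  label_eq_of_sampling_eq hX p hr h1 (sampling_geodesic_eq hX p hr hf (hX x y).choose_spec h)

theorem edgeLabel_mul {x y z : X} (hxy : dist x y < r) (hyz : dist y z < r) (hxz : dist x z < r) :
    edgeLabel hX ν x y * edgeLabel hX ν y z = edgeLabel hX ν x z := by
  rw [edgeLabel, edgeLabel, edgeLabel, ← ν.map_trans]
  refine label_eq_of_sampling_eq hX p hr h1 ?_
  rw [sampling_trans, sampling_small hX p hr _ ((hX x y).choose_spec.diam_lt hxy) hxy,
    sampling_small hX p hr _ ((hX y z).choose_spec.diam_lt hyz) hyz,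
    sampling_small hX p hr _ ((hX x z).choose_spec.diam_lt hxz) hxz, ripsEdge_trans]

theorem edgeLabel_self (x : X) : edgeLabel hX ν x x = 1 := by
  have h : dist x x < r := by rwa [dist_self]
  exact left_eq_mul.1 (edgeLabel_mul hX p hr h1 h h h).symm

theorem edgeLabel_inv {x y : X} (h : dist x y < r) :
    edgeLabel hX ν y x = (edgeLabel hX ν x y)⁻¹ := by
  refine eq_inv_of_mul_eq_one_right ?_
  rw [edgeLabel_mul hX p hr h1 h (by rwa [dist_comm]) (by rwa [dist_self]), edgeLabel_self hX p hr
      h1]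

theorem label_half {x y : X} {f : Path x y} (hf : IsGeodesic f) {l : ℝ} (hl : dist x y < 2 * l)
    (hlr : l ≤ r) : ∃ a, dist x a < l ∧ dist a y < l ∧
      ν.map (cls f) = edgeLabel hX ν x a * edgeLabel hX ν a y := by
  have hlen : (pathLength f).toReal = dist x y := by
    rw [hf, ENNReal.toReal_ofReal dist_nonneg]
  obtain ⟨s, hs⟩ := exists_arcLength_eq hf.ne_top (l := dist x y / 2) (by positivity)
    (by rw [hlen]; linarith [dist_nonneg (x := x) (y := y)])
  obtain ⟨g0, d0⟩ := hf.subpath (s := 0) (t := s) s.2.1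
  obtain ⟨g1, d1⟩ := hf.subpath (s := s) (t := 1) s.2.2
  rw [arcLength_zero, hs, sub_zero] at d0
  rw [arcLength_one, hs, hlen] at d1
  have e0 := label_geodesic hX p hr h1 g0 (by rw [d0]; linarith)
  have e1 := label_geodesic hX p hr h1 g1 (by rw [d1]; linarith)
  rw [← ν.map_seg_zero_one, ← seg_trans f 0 s 1, ν.map_trans, seg, seg, e0, e1]
  refine ⟨f s, ?_, ?_, ?_⟩
  · rw [f.source] at d0; linarith
  · rw [f.target] at d1; linarith
  · rw [f.source, f.target]

theorem label_two_edges {x a y : X} (hxa : dist x a ≤ r / 2) (hay : dist a y ≤ r / 2)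
    {f : Path x y} (hf : IsGeodesic f) :
    edgeLabel hX ν x a * edgeLabel hX ν a y = ν.map (cls f) := by
  rw [edgeLabel, edgeLabel, ← ν.map_trans, ← Path.Homotopic.Quotient.mk_trans]
  refine label_eq_of_sampling_eq hX p hr h1 (sampling_eq_of_pathLength_lt hX p hr _ _ ?_)
  have h1 : dist x y ≤ r := (dist_triangle x a y).trans (by linarith)
  rw [pathLength_trans, (hX x a).choose_spec, (hX a y).choose_spec, hf,
    ← ENNReal.ofReal_add dist_nonneg dist_nonneg, ← ENNReal.ofReal_add (by positivity) dist_nonneg]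
  exact (ENNReal.ofReal_lt_ofReal_iff (by positivity)).2 (by linarith)

/-- The product of the labels along a closed hexagon. -/
noncomputable def hexLabel (hX : IsGeodesicSpace X) (ν : PathLabel X G) (u : Fin 6 → X) : G :=
  edgeLabel hX ν (u 0) (u 1) * edgeLabel hX ν (u 1) (u 2) *
    (edgeLabel hX ν (u 2) (u 3) * edgeLabel hX ν (u 3) (u 4)) *
    (edgeLabel hX ν (u 4) (u 5) * edgeLabel hX ν (u 5) (u 0))

/-- Two consecutive sides can be replaced by a geodesic of length at most `r`. The resulting
triangle either has trivial sample or is critical. -/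
theorem hexLabel_of_le
    (hcrit : ∀ x₁ x₂ x₃ : X, IsCriticalTriangle p r hr x₁ x₂ x₃ → ∀ α : Path x₁ x₁,
      IsFilling x₂ x₃ α → ν.map (cls α) = 1) (u : Fin 6 → X)
    (hu : ∀ i, dist (u i) (u (i + 1)) ≤ r / 2) : hexLabel hX ν u = 1 := by
  have d0 : dist (u 0) (u 1) ≤ r / 2 := hu 0
  have d1 : dist (u 1) (u 2) ≤ r / 2 := hu 1
  have d2 : dist (u 2) (u 3) ≤ r / 2 := hu 2
  have d3 : dist (u 3) (u 4) ≤ r / 2 := hu 3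
  have d4 : dist (u 4) (u 5) ≤ r / 2 := hu 4
  have d5 : dist (u 5) (u 0) ≤ r / 2 := hu 5
  have hf := (hX (u 0) (u 2)).choose_spec
  have hg := (hX (u 2) (u 4)).choose_spec
  have hk := (hX (u 4) (u 0)).choose_spec
  rw [hexLabel, label_two_edges hX p hr h1 d0 d1 hf, label_two_edges hX p hr h1 d2 d3 hg,
    label_two_edges hX p hr h1 d4 d5 hk, ← ν.map_trans, ← ν.map_trans,
    ← Path.Homotopic.Quotient.mk_trans, ← Path.Homotopic.Quotient.mk_trans]
  have hfill : IsFilling (u 2) (u 4) _ := ⟨_, _, _, hf, hg, hk, rfl⟩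
  by_cases hs : sampling hX p hr (cls (((hX (u 0) (u 2)).choose.trans
      (hX (u 2) (u 4)).choose).trans (hX (u 4) (u 0)).choose)) = Path.Homotopic.Quotient.refl _
  · exact h1 _ _ hs
  · have h02 : dist (u 0) (u 2) ≤ r := (dist_triangle _ (u 1) _).trans (by linarith)
    have h24 : dist (u 2) (u 4) ≤ r := (dist_triangle _ (u 3) _).trans (by linarith)
    have h40 : dist (u 4) (u 0) ≤ r := (dist_triangle _ (u 5) _).trans (by linarith)
    obtain ⟨e1, e2, e3⟩ := dist_eq_of_sampling_ne hX p hr hfill h02 h24 h40 hs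
    exact hcrit _ _ _ ((isCriticalTriangle_iff hX p hr).2 ⟨e1, e2, e3, _, hfill, hs⟩) _ hfill

/-- Labels multiply only on triangles with sides `< r`. Sides at most `r/2` stay below `r` after
small moves, whereas sides of length `r` would not; this is why hexagons replace triangles. -/
theorem edgeLabel_move {x y x' y' : X} (h : dist x y ≤ r / 2) (hx : dist x' x < r / 8)
    (hy : dist y' y < r / 8) : edgeLabel hX ν x' y' =
      edgeLabel hX ν x' x * edgeLabel hX ν x y * (edgeLabel hX ν y' y)⁻¹ := by
  have t1 : dist x' y < r := (dist_triangle x' x y).trans_lt (by linarith)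
  have t2 : dist x' y' < r := (dist_triangle4_right x' y' x y).trans_lt (by
    linarith)
  rw [edgeLabel_mul hX p hr h1 (by linarith) (by linarith) t1,
    ← edgeLabel_inv hX p hr h1 (by linarith), edgeLabel_mul hX p hr h1 t1
      (by rw [dist_comm]; linarith) t2]

theorem hexLabel_move (u u' : Fin 6 → X) (hu : ∀ i, dist (u i) (u (i + 1)) ≤ r / 2)
    (h : ∀ i, dist (u' i) (u i) < r / 8) : hexLabel hX ν u' =
      edgeLabel hX ν (u' 0) (u 0) * hexLabel hX ν u * (edgeLabel hX ν (u' 0) (u 0))⁻¹ := by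
  rw [hexLabel, hexLabel, edgeLabel_move hX p hr h1 (hu 0) (h 0) (h 1),
    edgeLabel_move hX p hr h1 (hu 1) (h 1) (h 2), edgeLabel_move hX p hr h1 (hu 2) (h 2) (h 3),
    edgeLabel_move hX p hr h1 (hu 3) (h 3) (h 4), edgeLabel_move hX p hr h1 (hu 4) (h 4) (h 5),
    edgeLabel_move hX p hr h1 (hu 5) (h 5) (h 0)]
  simp only [zero_add, show (1 : Fin 6) + 1 = 2 from rfl, show (2 : Fin 6) + 1 = 3 from rfl,
    show (3 : Fin 6) + 1 = 4 from rfl, show (4 : Fin 6) + 1 = 5 from rfl,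
    show (5 : Fin 6) + 1 = 0 from rfl]
  group

/-- Otherwise hexagons with nontrivial label and sides below `r/2 + 1/(n+1)` subconverge to one with
sides at most `r/2`. Its label is trivial, and nearby hexagons have conjugate labels. -/
theorem exists_hexLabel_eq_one [CompactSpace X]
    (hcrit : ∀ x₁ x₂ x₃ : X, IsCriticalTriangle p r hr x₁ x₂ x₃ → ∀ α : Path x₁ x₁,
      IsFilling x₂ x₃ α → ν.map (cls α) = 1) :
    ∃ ε > 0, ∀ u : Fin 6 → X, (∀ i, dist (u i) (u (i + 1)) < r / 2 + ε) → hexLabel hX ν u = 1 := by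
  by_contra! hcon
  have := fun n : ℕ => hcon (1 / ((n : ℝ) + 1)) (by positivity)
  choose v hv hv1 using this
  obtain ⟨u, φ, hφ, hlim⟩ := CompactSpace.tendsto_subseq v
  rw [tendsto_pi_nhds] at hlim
  have hε : Filter.Tendsto (fun n => 1 / ((φ n : ℝ) + 1)) Filter.atTop (𝓝 0) :=
    tendsto_one_div_add_atTop_nhds_zero_nat.comp hφ.tendsto_atTop
  have hu : ∀ i, dist (u i) (u (i + 1)) ≤ r / 2 := fun i => by
    have e : r / 2 = r / 2 + 0 := by ring
    rw [e]
    exact le_of_tendsto_of_tendsto' ((hlim i).dist (hlim (i + 1))) (hε.const_add _)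
      fun n => (hv (φ n) i).le
  have hclose : ∀ᶠ n in Filter.atTop, ∀ i, dist (v (φ n) i) (u i) < r / 8 := by
    rw [Filter.eventually_all]
    exact fun i => (Metric.tendsto_nhds.1 (hlim i)) (r / 8) (by positivity)
  obtain ⟨n, hn⟩ := hclose.exists
  refine hv1 (φ n) ?_
  rw [hexLabel_move hX p hr h1 u _ hu hn, hexLabel_of_le hX p hr h1 hcrit u hu]
  group

theorem exists_label_triangle_eq_one [CompactSpace X]
    (hcrit : ∀ x₁ x₂ x₃ : X, IsCriticalTriangle p r hr x₁ x₂ x₃ → ∀ α : Path x₁ x₁,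
      IsFilling x₂ x₃ α → ν.map (cls α) = 1) :
    ∃ ε > 0, ∀ x y z (f : Path x y) (g : Path y z) (k : Path z x), IsGeodesic f → IsGeodesic g →
      IsGeodesic k → dist x y < r + ε → dist y z < r + ε → dist z x < r + ε →
      ν.map (cls f) * ν.map (cls g) * ν.map (cls k) = 1 := by
  obtain ⟨ε, hε, h⟩ := exists_hexLabel_eq_one hX p hr h1 hcrit
  -- Half of a side `< r + δ` is below `r/2 + δ`; the cap `r/2` keeps this at most `r`, as
  -- `label_half` requires.
  set δ := min ε (r / 2) with hδ
  have hδ0 : 0 < δ := lt_min hε (by positivity)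
  have hδr : δ ≤ r / 2 := min_le_right _ _
  have hδε : δ ≤ ε := min_le_left _ _
  refine ⟨δ, hδ0, fun x y z f g k hf hg hk hxy hyz hzx => ?_⟩
  obtain ⟨a, xa, ay, ef⟩ := label_half hX p hr h1 hf (l := r / 2 + δ) (by linarith) (by linarith)
  obtain ⟨b, yb, bz, eg⟩ := label_half hX p hr h1 hg (l := r / 2 + δ) (by linarith) (by linarith)
  obtain ⟨c, zc, cx, ek⟩ := label_half hX p hr h1 hk (l := r / 2 + δ) (by linarith) (by linarith)
  rw [ef, eg, ek]
  refine h ![x, a, y, b, z, c] fun i => ?_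
  refine lt_of_lt_of_le ?_ (add_le_add_right hδε _)
  fin_cases i
  exacts [xa, ay, yb, bz, zc, cx]

end Label

end BondingKernel

end RipsLoc

namespace RipsLoc

/-! ### Kernels between consecutive critical values -/

section ConsecutiveCritical

open Path.Homotopic (Quotient)
open Path.Homotopic.Quotient renaming mk → cls

variable {X : Type*} [MetricSpace X] {r : ℝ} (hX : IsGeodesicSpace X) (p : X)

theorem samplingHom_mono {a b : ℝ} (ha : 0 < a) (hb : 0 < b) (hab : a ≤ b)
    {g : FundamentalGroup X p} (h : samplingHom hX p ha g = 1) : samplingHom hX p hb g = 1 := by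
  rw [← bonding_samplingHom hX p ha hab g, h, map_one]

/-- The classes whose samples are trivial in some Rips complex of scale less than `r`. -/
def earlyKernel (hr : 0 < r) : Subgroup (FundamentalGroup X p) where
  carrier := {g | ∃ b, ∃ hb : 0 < b, b < r ∧ samplingHom hX p hb g = 1}
  one_mem' := ⟨r / 2, half_pos hr, half_lt_self hr, map_one _⟩
  mul_mem' := by
    rintro g g' ⟨b, hb, hbr, h⟩ ⟨b', hb', hbr', h'⟩
    refine ⟨max b b', lt_max_of_lt_left hb, max_lt hbr hbr', ?_⟩
    rw [map_mul, samplingHom_mono hX p hb _ (le_max_left _ _) h,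
      samplingHom_mono hX p hb' _ (le_max_right _ _) h', one_mul]
  inv_mem' := by
    rintro g ⟨b, hb, hbr, h⟩
    exact ⟨b, hb, hbr, by rw [map_inv, h, inv_one]⟩

theorem earlyKernel_normal (hr : 0 < r) : (earlyKernel hX p hr).Normal := by
  refine ⟨fun g hg k => ?_⟩
  obtain ⟨b, hb, hbr, h⟩ := hg
  exact ⟨b, hb, hbr, by rw [map_mul, map_mul, h, mul_one, ← map_mul, mul_inv_cancel, map_one]⟩

/-- A class whose sample is trivial at scale `r` has a trivial sample at a smaller scale. -/
theorem exists_smaller_scale (hr : 0 < r) {g : FundamentalGroup X p}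
    (hg : samplingHom hX p hr g = 1) : ∃ b, ∃ hb : 0 < b, b < r ∧ samplingHom hX p hb g = 1 := by
  obtain ⟨f, hf⟩ := Path.Homotopic.Quotient.mk_surjective (FundamentalGroup.toPath g)
  obtain ⟨G, _, ν, hν⟩ := exists_pathLabel hX (earlyKernel_normal hX p hr)
  have hν1 : ∀ (x : X) (q : Quotient x x) (b : ℝ) (hb : 0 < b), b < r →
      sampling hX p hb q = Path.Homotopic.Quotient.refl _ → ν.map q = 1 := by
    intro x q b hb hbr h
    exact (hν (cls (hX p x).choose) q).2 ⟨b, hb, hbr, (samplingHom_lassoClass hX hb _ _).2 h⟩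
  have key : ν.map (cls f) = 1 := by
    refine label_eq_one_of_sampling hX p hr ν ?_ f ?_ ?_
    · intro x y z f g k hf hg hk hxy hyz hzx
      -- The strict inequalities leave room for a scale `b < r` at which the triangle is already a
      -- simplex.
      obtain ⟨b, hb, hbr⟩ := exists_between (max_lt (max_lt hxy hyz) hzx)
      have h1 : dist x y < b := ((le_max_left _ _).trans (le_max_left _ _)).trans_lt hb
      have h2 : dist y z < b := ((le_max_right _ _).trans (le_max_left _ _)).trans_lt hb
      have h3 : dist z x < b := (le_max_right _ _).trans_lt hb
      have hb0 : 0 < b := dist_nonneg.trans_lt h1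
      rw [← ν.map_trans, ← ν.map_trans]
      refine hν1 _ _ b hb0 hbr ?_
      rw [sampling_trans, sampling_trans, sampling_small hX p hb0 f (hf.diam_lt h1) h1,
        sampling_small hX p hb0 g (hg.diam_lt h2) h2, sampling_small hX p hb0 k (hk.diam_lt h3) h3,
        ripsEdge_trans hb0 _ _ (by rwa [dist_comm]), ripsEdge_trans hb0 _ _ (by rwa [dist_self]),
        ripsEdge_self]
    · intro t
      -- At scale `r / 2` a short arc and its chord have the same sample, and the label kills
      -- whatever dies below `r`.
      obtain ⟨W, hW, ht, h⟩ := exists_nhd_diam_lt f (half_pos hr) t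
      refine ⟨W, hW, ht, fun a b hab hs => ?_⟩
      have hd := h a b hab hs
      have hd' := dist_lt_of_diam_lt hd
      have hk := (hX (f a) (f b)).choose_spec
      refine ⟨_, hk, label_eq_of_sampling_eq hX p (half_pos hr)
        (fun x q => hν1 x q _ (half_pos hr) (half_lt_self hr)) ?_⟩
      rw [seg, sampling_small hX p _ _ hd hd', sampling_small hX p _ _ (hk.diam_lt hd') hd']
    · rw [hf]; exact hg
  have := (hν (Path.Homotopic.Quotient.refl p) (cls f)).1 key
  rw [lassoClass_refl, hf] at this
  exact this

/-- Let `q` be the infimum of the scales in `(r, r')` at which `g` is trivial. If `q > r`, then `g`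
dies already at `q` because `q` is not right critical, and slightly below `q` because it is not left
critical, a contradiction. -/
theorem exists_trivial_scale_near {r' : ℝ} (hr : 0 < r) (hr' : 0 < r') (hrr : r < r')
    (hnc : ∀ q, r < q → q < r' → ¬ IsCriticalValue p q) {g : FundamentalGroup X p}
    (hg : samplingHom hX p hr' g = 1) {ε : ℝ} (hε : 0 < ε) :
    ∃ b, ∃ hb : 0 < b, r < b ∧ b < r + ε ∧ samplingHom hX p hb g = 1 := by
  let T : Set ℝ := {b | r < b ∧ b < r' ∧ ∃ hb : 0 < b, samplingHom hX p hb g = 1}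
  obtain ⟨b, hb, hbr', h⟩ := exists_smaller_scale hX p hr' hg
  obtain ⟨b₁, hb₁, hb₁'⟩ := exists_between (max_lt hrr hbr')
  have hb₁T : b₁ ∈ T := ⟨(le_max_left _ _).trans_lt hb₁, hb₁',
    hb.trans ((le_max_right _ _).trans_lt hb₁),
    samplingHom_mono hX p hb _ ((le_max_right _ _).trans hb₁.le) h⟩
  have hbdd : BddBelow T := ⟨r, fun b hb => hb.1.le⟩
  have hinf : r ≤ sInf T := le_csInf ⟨b₁, hb₁T⟩ fun b hb => hb.1.le
  by_cases hq : sInf T < r + ε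
  · obtain ⟨b, hbT, hb⟩ := (csInf_lt_iff hbdd ⟨b₁, hb₁T⟩).1 hq
    exact ⟨b, hbT.2.2.choose, hbT.1, hb, hbT.2.2.choose_spec⟩
  exfalso
  set q := sInf T with hqdef
  have hqr : r < q := by linarith
  have hq0 : 0 < q := hr.trans hqr
  have hqr' : q < r' := (csInf_le hbdd hb₁T).trans_lt hb₁'
  have hcrit := hnc q hqr hqr'
  rw [IsCriticalValue, not_or] at hcrit
  have hqT : samplingHom hX p hq0 g = 1 := by
    have hright := hcrit.2
    simp only [IsRightCritical, not_exists, not_forall, not_not] at hright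
    obtain ⟨η, hη, hle, hbij⟩ := hright hq0
    obtain ⟨b, hbT, hb⟩ := (csInf_lt_iff hbdd ⟨b₁, hb₁T⟩).1 (show sInf T < q + η by linarith)
    refine hbij.1 ?_
    rw [map_one, bonding_samplingHom hX p hq0 hle]
    exact samplingHom_mono hX p hbT.2.2.choose _ hb.le hbT.2.2.choose_spec
  have hleft := hcrit.1
  simp only [IsLeftCritical, not_and, not_exists, not_forall, not_not] at hleft
  -- The bound `η < q - r` keeps the smaller scale `q - η` above `r`.
  obtain ⟨η, hη, hηq, h0, hle, hbij⟩ := hleft hq0 (q - r) (by linarith)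
  have hηT : q - η ∈ T := by
    refine ⟨by linarith, by linarith, h0, hbij.1 ?_⟩
    rw [map_one, bonding_samplingHom hX p h0 hle]
    exact hqT
  have := csInf_le hbdd hηT
  linarith

-- The label modulo critical lassos vanishes on geodesic triangles with sides `< r + ε`, and the
-- class dies at some `b < r + ε`; comparison at scale `b` makes its label trivial.
include hX in
theorem ker_bonding_eq [CompactSpace X] (hr : 0 < r) {r' : ℝ} (hrr : r < r')
    (hnc : ∀ q, r < q → q < r' → ¬ IsCriticalValue p q) :
    (bonding p hr hrr.le).ker = Subgroup.closure (criticalLassos p hr) := by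
  refine le_antisymm (fun g hg => ?_) (criticalLassos_le_ker p hr hX hrr)
  obtain ⟨g, rfl⟩ := samplingHom_surjective hX p hr g
  rw [MonoidHom.mem_ker, bonding_samplingHom] at hg
  have hN := criticalLassos_normal hX p hr
  obtain ⟨G, _, ν, hν⟩ := exists_pathLabel hX (hN.comap (samplingHom hX p hr))
  have h1 : ∀ (x : X) (q : Quotient x x),
      sampling hX p hr q = Path.Homotopic.Quotient.refl _ → ν.map q = 1 := by
    intro x q h
    refine (hν (cls (hX p x).choose) q).2 ?_
    rw [Subgroup.mem_comap, (samplingHom_lassoClass hX hr _ _).2 h]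
    exact one_mem _
  have hcrit : ∀ x₁ x₂ x₃ : X, IsCriticalTriangle p r hr x₁ x₂ x₃ → ∀ α : Path x₁ x₁,
      IsFilling x₂ x₃ α → ν.map (cls α) = 1 := fun x₁ x₂ x₃ h α hα =>
    (hν (cls (hX p x₁).choose) _).2 (samplingHom_filling_mem hX p hr h hα _)
  obtain ⟨ε, hε, htri⟩ := exists_label_triangle_eq_one hX p hr h1 hcrit
  obtain ⟨b, hb, hrb, hbε, hbg⟩ := exists_trivial_scale_near hX p hr _ hrr hnc hg hε
  obtain ⟨f, hf⟩ := Path.Homotopic.Quotient.mk_surjective (FundamentalGroup.toPath g)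
  have key : ν.map (cls f) = 1 := by
    refine label_eq_one_of_sampling hX p hb ν ?_ f ?_ ?_
    · intro x y z f g k hf hg hk hxy hyz hzx
      exact htri x y z f g k hf hg hk (hxy.trans hbε) (hyz.trans hbε) (hzx.trans hbε)
    · intro t
      obtain ⟨W, hW, ht, h⟩ := exists_nhd_diam_lt f hr t
      refine ⟨W, hW, ht, fun a b hab hs => ?_⟩
      have hd := h a b hab hs
      have hd' := dist_lt_of_diam_lt hd
      have hk := (hX (f a) (f b)).choose_spec
      refine ⟨_, hk, label_eq_of_sampling_eq hX p hr h1 ?_⟩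
      rw [seg, sampling_small hX p _ _ hd hd', sampling_small hX p _ _ (hk.diam_lt hd') hd']
    · rw [hf]; exact hbg
  have := (hν (Path.Homotopic.Quotient.refl p) (cls f)).1 key
  rw [lassoClass_refl, hf] at this
  exact this

end ConsecutiveCritical

end RipsLoc

namespace RipsLoc

/-! ### Loops of minimal length outside the lasso subgroup -/

section EssentialLoops

open Path.Homotopic (Quotient)
open Path.Homotopic.Quotient renaming mk → cls

variable {X : Type*} [MetricSpace X] {r : ℝ} {G : Type*} [Group G] {ν : PathLabel X G}

/-! ### Labels that kill all loops shorter than `3r`. -/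

section Short

variable (short : ∀ (x : X) (β : Path x x), pathLength β < ENNReal.ofReal (3 * r) →
  ν.map (cls β) = 1)
include short

theorem label_eq_of_pathLength_lt {x y : X} {f g : Path x y}
    (h : pathLength f + pathLength g < ENNReal.ofReal (3 * r)) :
    ν.map (cls f) = ν.map (cls g) := by
  have := short x (f.trans g.symm) (by rwa [pathLength_trans, pathLength_symm])
  rwa [Path.Homotopic.Quotient.mk_trans, Path.Homotopic.Quotient.mk_symm, ν.map_trans, ν.map_symm,
    mul_inv_eq_one] at this

theorem label_eq_of_le {x y : X} {f g : Path x y} {a b : ℝ} (ha : 0 ≤ a) (hb : 0 ≤ b)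
    (hf : pathLength f ≤ ENNReal.ofReal a) (hg : pathLength g ≤ ENNReal.ofReal b)
    (h : a + b < 3 * r) : ν.map (cls f) = ν.map (cls g) := by
  refine label_eq_of_pathLength_lt short ((add_le_add hf hg).trans_lt ?_)
  rw [← ENNReal.ofReal_add ha hb]
  exact (ENNReal.ofReal_lt_ofReal_iff (by linarith)).2 h

/-- A partial converse to `lassoSubgroup_le_ker`. Triangles with sides `< r` have perimeter `< 3r`,
and a short arc of a rectifiable loop forms with its chord a loop of length `< 3r`. -/
theorem label_eq_one_of_rectifiable (hX : IsGeodesicSpace X) (p : X) (hr : 0 < r) {x : X}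
    (f : Path x x) (hf : pathLength f ≠ ∞)
    (hs : sampling hX p hr (cls f) = Path.Homotopic.Quotient.refl _) : ν.map (cls f) = 1 := by
  refine label_eq_one_of_sampling hX p hr ν ?_ f ?_ hs
  · intro x y z f g k hf hg hk hxy hyz hzx
    rw [← ν.map_trans, ← ν.map_trans, ← Path.Homotopic.Quotient.mk_trans,
      ← Path.Homotopic.Quotient.mk_trans]
    refine short _ _ ?_
    rw [pathLength_trans, pathLength_trans, hf, hg, hk,
      ← ENNReal.ofReal_add dist_nonneg dist_nonneg, ← ENNReal.ofReal_add (by positivity)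
          dist_nonneg]
    exact (ENNReal.ofReal_lt_ofReal_iff (by positivity)).2 (by linarith)
  · intro t
    refine ⟨arcLength f ⁻¹' Metric.ball (arcLength f t) (r / 2),
      Metric.isOpen_ball.preimage (continuous_arcLength hf), Metric.mem_ball_self (by positivity),
      fun a b hab hsub => ⟨_, (hX (f a) (f b)).choose_spec, ?_⟩⟩
    have ha : |arcLength f a - arcLength f t| < r / 2 := hsub (left_mem_Icc.2 hab)
    have hb : |arcLength f b - arcLength f t| < r / 2 := hsub (right_mem_Icc.2 hab)
    rw [abs_lt] at ha hb
    have hd := dist_le_arcLength hf hab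
    exact label_eq_of_le short (by linarith [arcLength_monotone hf hab]) dist_nonneg
      (pathLength_subpath_eq hf hab).le (hX (f a) (f b)).choose_spec.le (by linarith)

end Short

/-- The arc of a loop `α` from `α t` through the base point to `α s`. -/
noncomputable def outerArc {y : X} (α : Path y y) (s t : I) : Path (α t) (α s) :=
  ((α.subpath t 1).cast rfl α.target.symm).trans ((α.subpath 0 s).cast α.source.symm rfl)

variable {y : X} {α : Path y y}

theorem pathLength_outerArc (hr : 0 < r) (hα : pathLength α = ENNReal.ofReal (3 * r)) (s t : I) :
    pathLength (outerArc α s t) =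
      ENNReal.ofReal (3 * r - (arcLength α t - arcLength α s)) := by
  have hne : pathLength α ≠ ∞ := by rw [hα]; exact ENNReal.ofReal_ne_top
  have h1 : arcLength α 1 = 3 * r := by
    rw [arcLength_one, hα, ENNReal.toReal_ofReal (by positivity)]
  have ht : arcLength α t ≤ arcLength α 1 := arcLength_monotone hne t.2.2
  rw [outerArc, pathLength_trans, pathLength_cast, pathLength_cast,
    pathLength_subpath_eq hne t.2.2, pathLength_subpath_eq hne s.2.1, arcLength_zero, sub_zero,
    ← ENNReal.ofReal_add (by linarith) (arcLength_nonneg s), h1]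
  congr 1; ring

theorem label_outerArc (s t : I) :
    ν.map (cls (outerArc α s t)) = ν.map (seg α t 1) * ν.map (seg α 0 s) := by
  rw [outerArc, Path.Homotopic.Quotient.mk_trans, ν.map_trans, ν.map_cls_cast, ν.map_cls_cast]
  rfl

theorem label_loop_split (s t : I) :
    ν.map (cls α) = ν.map (seg α 0 s) * ν.map (seg α s t) * ν.map (seg α t 1) := by
  rw [← ν.map_trans, ← ν.map_trans, seg_trans, seg_trans, ν.map_seg_zero_one]

/-! ### A loop of length `3r` with nontrivial label. -/

section Essential

variable (hr : 0 < r) (hα : pathLength α = ENNReal.ofReal (3 * r))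
  (short : ∀ (x : X) (β : Path x x), pathLength β < ENNReal.ofReal (3 * r) → ν.map (cls β) = 1)
  (hν : ν.map (cls α) ≠ 1) (hX : IsGeodesicSpace X)
include hr hα

omit hr in
theorem ne_top_of_pathLength_eq : pathLength α ≠ ∞ := by rw [hα]; exact ENNReal.ofReal_ne_top

theorem arcLength_one_eq : arcLength α 1 = 3 * r := by
  rw [arcLength_one, hα, ENNReal.toReal_ofReal (by positivity)]

include short hν hX

/-- A chord shorter than both arcs forms with either of them a loop shorter than `3r`. Both arcs
then carry the label of the chord, up to orientation, and the label of `α` would be trivial. -/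
theorem dist_eq_min {s t : I} (hst : s ≤ t) : dist (α s) (α t) =
    min (arcLength α t - arcLength α s) (3 * r - (arcLength α t - arcLength α s)) := by
  have hne := ne_top_of_pathLength_eq hα
  have h0 := arcLength_monotone hne hst
  have h1 : arcLength α t ≤ arcLength α 1 := arcLength_monotone hne t.2.2
  rw [arcLength_one_eq hr hα] at h1
  have hs0 := arcLength_nonneg (f := α) s
  have hout : dist (α s) (α t) ≤ 3 * r - (arcLength α t - arcLength α s) := by
    have := ofReal_dist_le_pathLength (outerArc α s t)
    rw [pathLength_outerArc hr hα, ENNReal.ofReal_le_ofReal_iff (by linarith), dist_comm] at this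
    exact this
  refine le_antisymm (le_min (dist_le_arcLength hne hst) hout) ?_
  by_contra! hlt
  obtain ⟨hlt1, hlt2⟩ := lt_min_iff.1 hlt
  obtain ⟨g, hg⟩ := hX (α s) (α t)
  have e1 : ν.map (seg α s t) = ν.map (cls g) :=
    label_eq_of_le short (by linarith) dist_nonneg (pathLength_subpath_eq hne hst).le hg.le
      (by linarith)
  have e2 : ν.map (cls (outerArc α s t)) = ν.map (cls g.symm) :=
    label_eq_of_le short (by linarith) dist_nonneg (pathLength_outerArc hr hα s t).le hg.symm.le
      (by rw [dist_comm]; linarith)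
  rw [label_outerArc, Path.Homotopic.Quotient.mk_symm, ν.map_symm, ← e1] at e2
  refine hν ?_
  rw [label_loop_split s t, ← inv_inv (ν.map (seg α s t)), ← e2]
  group

theorem dist_eq_norm (s t : I) :
    dist (α s) (α t) = ‖((arcLength α s - arcLength α t : ℝ) : AddCircle (3 * r))‖ := by
  wlog hst : s ≤ t generalizing s t
  · rw [dist_comm, this t s (le_of_not_ge hst), ← norm_neg, ← AddCircle.coe_neg, neg_sub]
  have hne := ne_top_of_pathLength_eq hα
  have h0 := arcLength_monotone hne hst
  have h1 : arcLength α t ≤ arcLength α 1 := arcLength_monotone hne t.2.2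
  rw [arcLength_one_eq hr hα] at h1
  have hs0 := arcLength_nonneg (f := α) s
  rw [dist_eq_min hr hα short hν hX hst]
  have h3 : |3 * r| = 3 * r := abs_of_pos (by positivity)
  rcases le_total (arcLength α t - arcLength α s) (3 * r / 2) with h | h
  · rw [min_eq_left (by linarith), (AddCircle.norm_coe_eq_abs_iff _ (by positivity)).2]
    · rw [abs_of_nonpos (by linarith)]; ring
    · rw [h3, abs_of_nonpos (by linarith)]; linarith
  · have e : ((arcLength α s - arcLength α t : ℝ) : AddCircle (3 * r)) =
        ((arcLength α s - arcLength α t + 3 * r : ℝ) : AddCircle (3 * r)) := by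
      rw [AddCircle.coe_add, AddCircle.coe_period, add_zero]
    rw [min_eq_right (by linarith), e, (AddCircle.norm_coe_eq_abs_iff _ (by positivity)).2]
    · rw [abs_of_nonneg (by linarith)]; ring
    · rw [h3, abs_of_nonneg (by linarith)]; linarith

/-- Arc length modulo `3r` is the required reparameterization. Distances depend on it alone, so any
section of it gives the isometric circle. -/
theorem isGeodesicCircle_of_label : IsGeodesicCircle α := by
  have hne := ne_top_of_pathLength_eq hα
  have h3 : 0 < 3 * r := by positivity
  have hsurj : Function.Surjective fun t : I => (arcLength α t : AddCircle (3 * r)) := by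
    intro z
    have : Fact (0 < 3 * r) := ⟨h3⟩
    obtain ⟨x, hx, rfl⟩ := (AddCircle.coe_image_Icc_eq (3 * r) 0).ge (mem_univ z)
    obtain ⟨t, ht⟩ := exists_arcLength_eq hne hx.1
      (by rw [hα, ENNReal.toReal_ofReal h3.le]; linarith [hx.2])
    exact ⟨t, by simp only [ht]⟩
  have hinv := Function.surjInv_eq hsurj
  refine ⟨3 * r, h3, fun z => α (Function.surjInv hsurj z), Isometry.of_dist_eq fun z w => ?_,
    arcLength α, continuous_arcLength hne, arcLength_monotone hne, arcLength_zero,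
    arcLength_one_eq hr hα, fun t => dist_eq_zero.1 ?_⟩
  · rw [dist_eq_norm hr hα short hν hX, AddCircle.coe_sub, hinv, hinv, ← dist_eq_norm_sub]
  · rw [dist_eq_norm hr hα short hν hX, AddCircle.coe_sub, hinv, sub_self, norm_zero]

/-- The loop is rectifiable, so its sample at scale `r` is nontrivial; its length `3r < 3(r + ε)`
kills it at scale `r + ε`. Thus `r` is right critical. -/
theorem isCriticalValue_of_label (p : X) : IsCriticalValue p r := by
  refine Or.inr ⟨hr, fun ε hε h' hbij => ?_⟩
  refine hν (label_eq_one_of_rectifiable short hX p hr α (ne_top_of_pathLength_eq hα) ?_)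
  let c : Quotient p y := cls (hX p y).choose
  refine (samplingHom_lassoClass hX hr c (cls α)).1 (hbij.1 ?_)
  rw [map_one, bonding_samplingHom hX p hr h', samplingHom_lassoClass]
  refine sampling_of_pathLength_lt hX p _ α ?_
  rw [hα]
  exact (ENNReal.ofReal_lt_ofReal_iff (by positivity)).2 (by linarith)

omit hr hα hν in
theorem edgeLabel_of_pathLength_le {x z : X} {f : Path x z} (hf : pathLength f ≤ ENNReal.ofReal r)
    (h : dist x z = r) (hr : 0 < r) : ν.map (cls f) = edgeLabel hX ν x z :=
  label_eq_of_le short hr.le hr.le hf ((hX x z).choose_spec.le.trans (by rw [h])) (by linarith)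

/-- The three points cut `α` into arcs of length `r`. Each arc has the label of a geodesic, as
bigons of length `2r` are trivial, so the product is conjugate to the label of `α`. -/
theorem triangle_label_of_le {s t u : I} (hst : s ≤ t) (htu : t ≤ u) (hne : α s ≠ α t)
    (h1 : dist (α s) (α t) = dist (α t) (α u)) (h2 : dist (α t) (α u) = dist (α u) (α s)) :
    (dist (α s) (α t) = r ∧ dist (α t) (α u) = r ∧ dist (α u) (α s) = r) ∧
      edgeLabel hX ν (α s) (α t) * edgeLabel hX ν (α t) (α u) * edgeLabel hX ν (α u) (α s) ≠ 1 := by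
  have htop := ne_top_of_pathLength_eq hα
  have d1 := dist_eq_min hr hα short hν hX hst
  have d2 := dist_eq_min hr hα short hν hX htu
  have d3 := dist_eq_min hr hα short hν hX (hst.trans htu)
  rw [dist_comm] at d3
  have hpos := dist_pos.2 hne
  have a1 := arcLength_monotone htop hst
  have a2 := arcLength_monotone htop htu
  have a3 : arcLength α u ≤ arcLength α 1 := arcLength_monotone htop u.2.2
  have a0 := arcLength_nonneg (f := α) s
  rw [arcLength_one_eq hr hα] at a3
  have l1 := le_min_iff.1 d1.le
  have l2 := le_min_iff.1 d2.le
  have l3 := le_min_iff.1 d3.le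
  -- Each distance is realized by the inner or the outer arc; the eight combinations are linear and
  -- either force length `r` or are contradictory.
  have key : arcLength α t - arcLength α s = r ∧ arcLength α u - arcLength α t = r := by
    rcases min_choice (arcLength α t - arcLength α s)
        (3 * r - (arcLength α t - arcLength α s)) with m1 | m1 <;>
      rcases min_choice (arcLength α u - arcLength α t)
        (3 * r - (arcLength α u - arcLength α t)) with m2 | m2 <;>
      rcases min_choice (arcLength α u - arcLength α s)
        (3 * r - (arcLength α u - arcLength α s)) with m3 | m3 <;>
      rw [m1] at d1 <;> rw [m2] at d2 <;> rw [m3] at d3 <;> constructor <;>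
      linarith [l1.1, l1.2, l2.1, l2.2, l3.1, l3.2]
  have e1 : dist (α s) (α t) = r := by
    rw [d1, key.1]; exact min_eq_left (by linarith)
  have e2 := h1.symm.trans e1
  have e3 := h2.symm.trans e2
  refine ⟨⟨e1, e2, e3⟩, ?_⟩
  have hsu : arcLength α u - arcLength α s = 2 * r := by linarith [key.1, key.2]
  rw [← edgeLabel_of_pathLength_le short hX (f := α.subpath s t)
      (by rw [pathLength_subpath_eq htop hst, key.1]) e1 hr,
    ← edgeLabel_of_pathLength_le short hX (f := α.subpath t u)
      (by rw [pathLength_subpath_eq htop htu, key.2]) e2 hr,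
    ← edgeLabel_of_pathLength_le short hX (f := outerArc α s u)
      (by rw [pathLength_outerArc hr hα, hsu]; exact ENNReal.ofReal_le_ofReal (by linarith)) e3 hr,
    label_outerArc]
  intro h
  refine hν ?_
  have e : ν.map (seg α s t) * ν.map (seg α t u) = ν.map (seg α s u) := by
    rw [← ν.map_trans, seg_trans]
  change ν.map (seg α s t) * ν.map (seg α t u) * _ = 1 at h
  rw [e] at h
  rw [label_loop_split s u, eq_inv_of_mul_eq_one_left h]
  group

omit hα hν in
theorem edgeLabel_swap {x z : X} (h : dist x z = r) :
    edgeLabel hX ν z x = (edgeLabel hX ν x z)⁻¹ := by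
  rw [← edgeLabel_of_pathLength_le short hX (f := (hX x z).choose.symm) _
    ((dist_comm z x).trans h) hr, Path.Homotopic.Quotient.mk_symm, ν.map_symm, edgeLabel]
  rw [pathLength_symm, (hX x z).choose_spec, h]

/-- Nontriviality survives cyclic shifts by conjugation and swaps by inversion, so the parameters
may be put in increasing order. -/
theorem triangle_label (s t u : I) (hne : α s ≠ α t)
    (h1 : dist (α s) (α t) = dist (α t) (α u)) (h2 : dist (α t) (α u) = dist (α u) (α s)) :
    (dist (α s) (α t) = r ∧ dist (α t) (α u) = r ∧ dist (α u) (α s) = r) ∧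
      edgeLabel hX ν (α s) (α t) * edgeLabel hX ν (α t) (α u) * edgeLabel hX ν (α u) (α s) ≠ 1 := by
  let Q : X → X → X → Prop := fun x y z => (dist x y = r ∧ dist y z = r ∧ dist z x = r) ∧
    edgeLabel hX ν x y * edgeLabel hX ν y z * edgeLabel hX ν z x ≠ 1
  have cyc : ∀ {x y z}, Q x y z → Q y z x := by
    rintro x y z ⟨⟨d1, d2, d3⟩, h⟩
    refine ⟨⟨d2, d3, d1⟩, fun h' => h ?_⟩
    rw [mul_assoc, eq_inv_of_mul_eq_one_left h', mul_inv_cancel]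
  have swap : ∀ {x y z}, Q x y z → Q y x z := by
    rintro x y z ⟨⟨d1, d2, d3⟩, h⟩
    refine ⟨⟨(dist_comm _ _).trans d1, (dist_comm _ _).trans d3, (dist_comm _ _).trans d2⟩,
      fun h' => h ?_⟩
    rw [edgeLabel_swap hr short hX d1, edgeLabel_swap hr short hX d3,
      edgeLabel_swap hr short hX d2] at h'
    have : (edgeLabel hX ν x y)⁻¹ * (edgeLabel hX ν z x)⁻¹ * (edgeLabel hX ν y z)⁻¹ =
        (edgeLabel hX ν y z * edgeLabel hX ν z x * edgeLabel hX ν x y)⁻¹ := by group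
    rw [this, inv_eq_one] at h'
    rw [mul_assoc, eq_inv_of_mul_eq_one_left h', mul_inv_cancel]
  have base : ∀ {s t u : I}, s ≤ t → t ≤ u → α s ≠ α t →
      dist (α s) (α t) = dist (α t) (α u) → dist (α t) (α u) = dist (α u) (α s) →
      Q (α s) (α t) (α u) := fun hst htu hne h1 h2 =>
    triangle_label_of_le hr hα short hν hX hst htu hne h1 h2
  have hpos := dist_pos.2 hne
  have ne2 : α t ≠ α u := dist_pos.1 (h1 ▸ hpos)
  have ne3 : α u ≠ α s := dist_pos.1 (h2 ▸ h1 ▸ hpos)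
  have c1 := dist_comm (α s) (α t)
  have c2 := dist_comm (α t) (α u)
  have c3 := dist_comm (α u) (α s)
  change Q (α s) (α t) (α u)
  rcases le_total s t with hst | hst <;> rcases le_total t u with htu | htu <;>
    rcases le_total s u with hsu | hsu
  · exact base hst htu hne h1 h2
  · exact base hst htu hne h1 h2
  · exact cyc (swap (base hsu htu ne3.symm (by linarith) (by linarith)))
  · exact cyc (base hsu hst ne3 (by linarith) (by linarith))
  · exact swap (base hst hsu hne.symm (by linarith) (by linarith))
  · exact cyc (cyc (base htu hsu ne2 (by linarith) (by linarith)))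
  · exact cyc (cyc (swap (base htu hst ne2.symm (by linarith) (by linarith))))
  · exact cyc (cyc (swap (base htu hst ne2.symm (by linarith) (by linarith))))

theorem isCriticalTriangle_of_label (p : X) {x₁ x₂ x₃ : X} (hx₁ : x₁ ∈ range α)
    (hx₂ : x₂ ∈ range α) (hx₃ : x₃ ∈ range α) (hne : x₁ ≠ x₂) (h1 : dist x₁ x₂ = dist x₂ x₃)
    (h2 : dist x₂ x₃ = dist x₃ x₁) : IsCriticalTriangle p r hr x₁ x₂ x₃ := by
  obtain ⟨s, rfl⟩ := hx₁
  obtain ⟨t, rfl⟩ := hx₂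
  obtain ⟨u, rfl⟩ := hx₃
  obtain ⟨⟨d1, d2, d3⟩, h⟩ := triangle_label hr hα short hν hX s t u hne h1 h2
  have hfill : IsFilling (α t) (α u) _ := ⟨_, _, _, (hX (α s) (α t)).choose_spec,
    (hX (α t) (α u)).choose_spec, (hX (α u) (α s)).choose_spec, rfl⟩
  refine (isCriticalTriangle_iff hX p hr).2 ⟨d1, d2, d3, _, hfill, fun hs => h ?_⟩
  have := label_eq_one_of_rectifiable short hX p hr _
    (by rw [hfill.pathLength_eq]; exact ENNReal.ofReal_ne_top) hs
  rwa [Path.Homotopic.Quotient.mk_trans, Path.Homotopic.Quotient.mk_trans, ν.map_trans,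
    ν.map_trans] at this

end Essential

end EssentialLoops

end RipsLoc

/-! ### Assembly of the three statements. -/

theorem mainTheorem2 {X : Type*} [MetricSpace X] [CompactSpace X]
    (hX : RipsLoc.IsGeodesicSpace X) (p : X) (r : ℝ) (hr : 0 < r) :
    -- critical triangles
    (∀ x₁ x₂ x₃ : X, RipsLoc.IsCriticalTriangle p r hr x₁ x₂ x₃ →
      (dist x₁ x₂ = r ∧ dist x₂ x₃ = r ∧ dist x₃ x₁ = r) ∧
      ∀ α : Path x₁ x₁, RipsLoc.IsFilling x₂ x₃ α →
        RipsLoc.pathLength α = ENNReal.ofReal (3 * r) ∧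
        ∀ (s : unitInterval) (γ : Path p (α s)),
          RipsLoc.loopClass (RipsLoc.lasso γ (RipsLoc.rotateLoop α s)) ∉
            RipsLoc.lassoSubgroup p (3 * r)) ∧
    -- kernels of bonding maps between consecutive critical values
    (∀ (r' : ℝ) (hrr' : r ≤ r'), RipsLoc.AreConsecutiveCritical p r r' →
      (RipsLoc.bonding p hr hrr').ker =
        Subgroup.closure {g | ∃ x₁ x₂ x₃ : X, RipsLoc.IsCriticalTriangle p r hr x₁ x₂ x₃ ∧
          ∃ α : Path x₁ x₁, RipsLoc.IsFilling x₂ x₃ α ∧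
          ∃ (s : unitInterval) (γ : Path p (α s))
            (S : RipsLoc.LoopSample (RipsLoc.lasso γ (RipsLoc.rotateLoop α s)) r)
            (h0 : S.t 0 = 0), g = S.ripsClass hr h0}) ∧
    -- the converse
    (∀ (y : X) (α : Path y y), RipsLoc.pathLength α = ENNReal.ofReal (3 * r) →
      ((∃ (s : unitInterval) (γ : Path p (α s)),
          RipsLoc.loopClass (RipsLoc.lasso γ (RipsLoc.rotateLoop α s)) ∉
            RipsLoc.lassoSubgroup p (3 * r)) ↔
        (∀ (s : unitInterval) (γ : Path p (α s)),
          RipsLoc.loopClass (RipsLoc.lasso γ (RipsLoc.rotateLoop α s)) ∉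
            RipsLoc.lassoSubgroup p (3 * r))) ∧
      ((∃ (s : unitInterval) (γ : Path p (α s)),
          RipsLoc.loopClass (RipsLoc.lasso γ (RipsLoc.rotateLoop α s)) ∉
            RipsLoc.lassoSubgroup p (3 * r)) →
        RipsLoc.IsGeodesicCircle α ∧ RipsLoc.IsCriticalValue p r ∧
        ∀ x₁ ∈ Set.range α, ∀ x₂ ∈ Set.range α, ∀ x₃ ∈ Set.range α,
          x₁ ≠ x₂ → dist x₁ x₂ = dist x₂ x₃ → dist x₂ x₃ = dist x₃ x₁ →
            RipsLoc.IsCriticalTriangle p r hr x₁ x₂ x₃)) := by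
  refine ⟨fun x₁ x₂ x₃ h => ?_, fun r' hrr' h => ?_, fun y α hα => ?_⟩
  · obtain ⟨d1, d2, d3, -⟩ := (RipsLoc.isCriticalTriangle_iff hX p hr).1 h
    refine ⟨⟨d1, d2, d3⟩, fun α hα => ?_⟩
    obtain ⟨hl, hs⟩ := RipsLoc.criticalTriangle_filling hX p hr h hα
    exact ⟨hl, RipsLoc.lasso_notMem_of_sampling_ne hX p hr α hs⟩
  · exact RipsLoc.ker_bonding_eq hX p hr h.2.2.1 h.2.2.2
  · obtain ⟨G, _, ν, hν⟩ :=
      RipsLoc.exists_pathLabel hX (RipsLoc.lassoSubgroup_normal p (3 * r))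
    -- Changing the starting point or the tail only conjugates, so all lassos around `α` are
    -- governed by the single condition `ν(α) ≠ 1`.
    have hiff : ∀ (s : unitInterval) (γ : Path p (α s)),
        RipsLoc.loopClass (RipsLoc.lasso γ (RipsLoc.rotateLoop α s)) ∉
          RipsLoc.lassoSubgroup p (3 * r) ↔ ν.map (Path.Homotopic.Quotient.mk α) ≠ 1 := by
      intro s γ
      rw [RipsLoc.loopClass_lasso, ← hν, RipsLoc.PathLabel.map_rotateLoop]
      refine not_congr ⟨fun h => ?_, fun h => by rw [h]; group⟩
      rw [mul_assoc, inv_mul_eq_one] at h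
      exact right_eq_mul.1 h
    refine ⟨⟨fun ⟨s, γ, h⟩ s' γ' => (hiff s' γ').2 ((hiff s γ).1 h),
      fun h => ⟨0, (hX p (α 0)).choose, h _ _⟩⟩, fun ⟨s, γ, h⟩ => ?_⟩
    have hα1 := (hiff s γ).1 h
    have short : ∀ (x : X) (β : Path x x),
        RipsLoc.pathLength β < ENNReal.ofReal (3 * r) →
          ν.map (Path.Homotopic.Quotient.mk β) = 1 := fun x β hβ =>
      (hν (Path.Homotopic.Quotient.mk (hX p x).choose) _).2
        (RipsLoc.lassoClass_mem_of_pathLength_lt _ β hβ)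
    exact ⟨RipsLoc.isGeodesicCircle_of_label hr hα short hα1 hX,
      RipsLoc.isCriticalValue_of_label hr hα short hα1 hX p,
      fun x₁ hx₁ x₂ hx₂ x₃ hx₃ hne h1 h2 =>
        RipsLoc.isCriticalTriangle_of_label hr hα short hα1 hX p hx₁ hx₂ hx₃ hne h1 h2⟩
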